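/- Let $n\ge 2$, let $M$ be an $n$-dimensional $C^\infty$ Riemannian manifold with metric $\langle\,,\rangle_M$, and endow $M\times\mathbb R$ with the product metric $\langle\,,\rangle=\langle\,,\rangle_M+dt^2$ and its Levi-Civita connection $\overline\nabla$. Let $\partial_t$ be the gradient of the projection $\pi_{\mathbb R}:M\times\mathbb R\to\mathbb R$. Let $\Sigma$ be an (immersed) $n$-dimensional smooth hypersurface of $M\times\mathbb R$ with a smooth unit normal field $N$. Its shape operator is $AX=-\overline\nabla_XN$, its height function is $\xi=\pi_{\mathbb R}|_\Sigma$, its angle function is $\theta=\langle N,\partial_t\rangle$, and $\nabla\xi$ is the gradient of $\xi$ with respect to the induced metric on $\Sigma$. The field $\nabla\xi$ is a principal direction of $\Sigma$ if at every point $\nabla\xi\neq0$ and $A\nabla\xi=\lambda\nabla\xi$ for some real $\lambda$, the corresponding principal curvature. The horizontal sections of $\Sigma$ are the sets $\Sigma_t=\{x\in\Sigma : \xi(x)=t\}$. Let $\Sigma_0$ be a smooth $(n-1)$-manifold, $f:\Sigma_0\to M$ a smooth immersion with a smooth unit normal field $\eta$, and $I\ni0$ an open interval such that for all $p\in\Sigma_0$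 the geodesic $\gamma_p(s)=\exp_M(f(p),s\eta(p))$ is defined for $s\in I$ and such that the maps $f_s:\Sigma_0\to M$, $f_s(p)=\gamma_p(s)$, are immersions for all $s\in I$ (the parallel hypersurfaces of $f$). Let $a:I\to\mathbb R$ be smooth with $a'>0$. The hypersurface $\Sigma$ is an $(f_s,a)$-graph if it is parametrized (up to a diffeomorphism $\Sigma_0\times I\to\Sigma$) by $(p,s)\mapsto(f_s(p),a(s))$, $p\in\Sigma_0$, $s\in I$. If $\Sigma$ is an $(f_s,a)$-graph, then: (i) $\theta$ and $\nabla\xi$ never vanish on $\Sigma$; (ii) $\nabla\xi$ is a principal direction of $\Sigma$; (iii) if $\Sigma$ is connected, or if $N$ is the upward unit normal field ($\theta>0$), then $\theta$ and the principal curvature of $\Sigma$ in the direction $\nabla\xi$ are constant along each horizontal section $\Sigma_t$. Conversely, if $\Sigma$ is a hypersurface whose angle function $\theta$ never vanishes and which has $\nabla\xi$ as a principal direction, then $\Sigma$ is locally an $(f_s,a)$-graph: every point of $\Sigma$ has an open neighbourhood in $\Sigma$ which is an $(f_s,a)$-graph for some $\Sigma_0$, $f$, $\eta$, $I$, $a$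 as above, where moreover $(p,s)\mapsto f_s(p)$ can be taken to be a diffeomorphism of $\Sigma_0\times I$ onto an open subset of $M$. -/

import Mathlib

open Bundle Set Manifold
open scoped ContDiff Topology

noncomputable section

namespace ParallelGraph

/-! ### Riemannian notions on a general manifold

A metric is given by its values `h x : T_x X → T_x X → ℝ`. In the theorem it is a smooth Riemannian
metric on `M`, the product metric on `M × ℝ`, or the metric induced on a hypersurface. -/

/-- The vector representing the functional `ℓ` with respect to the inner product `b`. It is unique
(and exists, in finite dimension) when `b` is an inner product and `ℓ` is linear. -/
def sharp {V : Type*} [Zero V] (b : V → V → ℝ) (ℓ : V → ℝ) : V :=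
  open scoped Classical in
  if hz : ∃ z, ∀ w, b z w = ℓ w then hz.choose else 0

section General

variable {E : Type*} [NormedAddCommGroup E] [NormedSpace ℝ E]
  {H : Type*} [TopologicalSpace H] {I : ModelWithCorners ℝ E H}
  {X : Type*} [TopologicalSpace X] [ChartedSpace H X]
  {E' : Type*} [NormedAddCommGroup E'] [NormedSpace ℝ E']
  {H' : Type*} [TopologicalSpace H'] {J : ModelWithCorners ℝ E' H'}
  {S : Type*} [TopologicalSpace S] [ChartedSpace H' S]

/-- The gradient at `x` of a real function with respect to the metric `h`. -/
def grad (h : ∀ x : X, TangentSpace I x → TangentSpace I x → ℝ) (ζ : X → ℝ) (x : X) :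
    TangentSpace I x :=
  sharp (h x) (fun w ↦ mvfderiv I ζ x w)

/-- The metric induced by a map `F : S → X`. -/
def inducedMetric (J : ModelWithCorners ℝ E' H')
    (h : ∀ x : X, TangentSpace I x → TangentSpace I x → ℝ) (F : S → X)
    (x : S) (v w : TangentSpace J x) : ℝ :=
  h (F x) (mfderiv J I F x v) (mfderiv J I F x w)

/-- The differential at `x` of the preferred chart around `x₀`: the coordinates of a tangent
vector. -/
def toCoord (I : ModelWithCorners ℝ E H) (x₀ x : X) : TangentSpace I x →L[ℝ] E :=
  mvfderiv I (extChartAt I x₀) x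

/-- The tangent vector at `x` with given coordinates in the preferred chart around `x₀`. -/
def ofCoord (I : ModelWithCorners ℝ E H) (x₀ x : X) : E →L[ℝ] TangentSpace I x :=
  (toCoord I x₀ x).inverse

/-- The metric in the preferred chart around `x₀`, at the point of coordinates `y`. -/
def coordMetric (h : ∀ x : X, TangentSpace I x → TangentSpace I x → ℝ) (x₀ : X) (y u v : E) : ℝ :=
  h ((extChartAt I x₀).symm y) (ofCoord I x₀ _ u) (ofCoord I x₀ _ v)

/-- The Christoffel symbols `Γ_y(u, v)` of the Levi-Civita connection of `h` in the preferred chart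
around `x₀`: the vector `Γ` such that, for all `w`,
`⟨Γ, w⟩ = (∂_u ⟨v, w⟩ + ∂_v ⟨u, w⟩ - ∂_w ⟨u, v⟩) / 2`. -/
def christoffel (h : ∀ x : X, TangentSpace I x → TangentSpace I x → ℝ) (x₀ : X) (y u v : E) : E :=
  sharp (coordMetric h x₀ y) fun w ↦
    (fderiv ℝ (fun z ↦ coordMetric h x₀ z v w) y u
      + fderiv ℝ (fun z ↦ coordMetric h x₀ z u w) y v
      - fderiv ℝ (fun z ↦ coordMetric h x₀ z u v) y w) / 2

/-- The Levi-Civita covariant derivative `∇_v V` at `x` of a vector field `V` along the map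
`F : S → X`, in the direction `v ∈ T_x S`; it is computed in the chart around `F x`, as
`d V (v) + Γ (d F (v), V)`. -/
def covDeriv (J : ModelWithCorners ℝ E' H')
    (h : ∀ x : X, TangentSpace I x → TangentSpace I x → ℝ) (F : S → X)
    (V : ∀ x : S, TangentSpace I (F x)) (x : S) (v : TangentSpace J x) : TangentSpace I (F x) :=
  ofCoord I (F x) (F x)
    (mvfderiv J (fun y ↦ toCoord I (F x) (F y) (V y)) x v
      + christoffel h (F x) (extChartAt I (F x) (F x))
          (toCoord I (F x) (F x) (mfderiv J I F x v)) (toCoord I (F x) (F x) (V x)))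

/-- The curve `γ` is a geodesic on the open set `T` of parameters: `∇_{γ'} γ' = 0`. -/
def IsGeodesicOn (h : ∀ x : X, TangentSpace I x → TangentSpace I x → ℝ) (γ : ℝ → X) (T : Set ℝ) :
    Prop :=
  ContMDiffOn 𝓘(ℝ, ℝ) I ∞ γ T ∧
    ∀ s ∈ T, covDeriv 𝓘(ℝ, ℝ) h γ (fun r ↦ mfderiv 𝓘(ℝ, ℝ) I γ r (1 : ℝ)) s (1 : ℝ) = 0

/-- `F` is a smooth immersion. -/
structure IsImmersed (J : ModelWithCorners ℝ E' H') (I : ModelWithCorners ℝ E H) (F : S → X) :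
    Prop where
  smooth : ContMDiff J I ∞ F
  injective : ∀ x, Function.Injective (mfderiv J I F x)

/-- `N` is a smooth unit normal field along `F`. -/
structure IsUnitNormal [IsManifold I 1 X] (J : ModelWithCorners ℝ E' H')
    (h : ∀ x : X, TangentSpace I x → TangentSpace I x → ℝ) (F : S → X)
    (N : ∀ x : S, TangentSpace I (F x)) : Prop where
  smooth : ContMDiff J I.tangent ∞ (fun x ↦ (⟨F x, N x⟩ : TangentBundle I X))
  unit : ∀ x, h (F x) (N x) (N x) = 1
  normal : ∀ (x : S) (v : TangentSpace J x), h (F x) (N x) (mfderiv J I F x v) = 0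

end General

/-! ### Hypersurfaces of `M × ℝ` -/

section Product

variable {n : ℕ} {M : Type*} [TopologicalSpace M] [ChartedSpace (EuclideanSpace ℝ (Fin n)) M]
  [IsManifold (𝓡 n) ∞ M]
  {E' : Type*} [NormedAddCommGroup E'] [NormedSpace ℝ E']
  {H' : Type*} [TopologicalSpace H'] {J : ModelWithCorners ℝ E' H'}
  {S : Type*} [TopologicalSpace S] [ChartedSpace H' S]
  {P : Type*} [TopologicalSpace P] [ChartedSpace (EuclideanSpace ℝ (Fin (n - 1))) P]

/-- The values of a smooth Riemannian metric on `M`. -/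
def metric (g : ContMDiffRiemannianMetric (𝓡 n) ∞ (EuclideanSpace ℝ (Fin n))
      (fun x : M ↦ TangentSpace (𝓡 n) x)) (x : M) (u v : TangentSpace (𝓡 n) x) : ℝ :=
  g.inner x u v

/-- The product metric `⟨ , ⟩_M + dt²` on `M × ℝ`. -/
def prodMetric (g : ContMDiffRiemannianMetric (𝓡 n) ∞ (EuclideanSpace ℝ (Fin n))
      (fun x : M ↦ TangentSpace (𝓡 n) x)) (q : M × ℝ)
    (u v : TangentSpace ((𝓡 n).prod 𝓘(ℝ, ℝ)) q) : ℝ :=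
  g.inner q.1 (mfderiv ((𝓡 n).prod 𝓘(ℝ, ℝ)) (𝓡 n) Prod.fst q u)
      (mfderiv ((𝓡 n).prod 𝓘(ℝ, ℝ)) (𝓡 n) Prod.fst q v)
    + mvfderiv ((𝓡 n).prod 𝓘(ℝ, ℝ)) (Prod.snd : M × ℝ → ℝ) q u
      * mvfderiv ((𝓡 n).prod 𝓘(ℝ, ℝ)) (Prod.snd : M × ℝ → ℝ) q v

/-- The vertical field `∂_t`: the gradient of the projection `M × ℝ → ℝ`. -/
def dt (g : ContMDiffRiemannianMetric (𝓡 n) ∞ (EuclideanSpace ℝ (Fin n))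
      (fun x : M ↦ TangentSpace (𝓡 n) x)) (q : M × ℝ) : TangentSpace ((𝓡 n).prod 𝓘(ℝ, ℝ)) q :=
  grad (prodMetric g) Prod.snd q

/-- The height function `ξ`. -/
def height (F : S → M × ℝ) (x : S) : ℝ := (F x).2

/-- The gradient `∇ξ` of the height function, for the metric induced on the hypersurface. -/
def gradHeight (J : ModelWithCorners ℝ E' H')
    (g : ContMDiffRiemannianMetric (𝓡 n) ∞ (EuclideanSpace ℝ (Fin n))
      (fun x : M ↦ TangentSpace (𝓡 n) x)) (F : S → M × ℝ) (x : S) : TangentSpace J x :=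
  grad (inducedMetric J (prodMetric g) F) (height F) x

/-- The angle function `θ = ⟨N, ∂_t⟩`. -/
def angle (g : ContMDiffRiemannianMetric (𝓡 n) ∞ (EuclideanSpace ℝ (Fin n))
      (fun x : M ↦ TangentSpace (𝓡 n) x)) (F : S → M × ℝ)
    (N : ∀ x : S, TangentSpace ((𝓡 n).prod 𝓘(ℝ, ℝ)) (F x)) (x : S) : ℝ :=
  prodMetric g (F x) (N x) (dt g (F x))

/-- The shape operator `A v = -∇_v N`, as a vector of the ambient tangent space at `F x`. -/
def shapeOperator (J : ModelWithCorners ℝ E' H')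
    (g : ContMDiffRiemannianMetric (𝓡 n) ∞ (EuclideanSpace ℝ (Fin n))
      (fun x : M ↦ TangentSpace (𝓡 n) x)) (F : S → M × ℝ)
    (N : ∀ x : S, TangentSpace ((𝓡 n).prod 𝓘(ℝ, ℝ)) (F x)) (x : S) (v : TangentSpace J x) :
    TangentSpace ((𝓡 n).prod 𝓘(ℝ, ℝ)) (F x) :=
  -covDeriv J (prodMetric g) F N x v

/-- `v ∈ T_x S` is a principal direction with principal curvature `κ`: `v ≠ 0` and `A v = κ v`. -/
def HasPrincipalCurvature
    (g : ContMDiffRiemannianMetric (𝓡 n) ∞ (EuclideanSpace ℝ (Fin n))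
      (fun x : M ↦ TangentSpace (𝓡 n) x)) (F : S → M × ℝ)
    (N : ∀ x : S, TangentSpace ((𝓡 n).prod 𝓘(ℝ, ℝ)) (F x)) (x : S) (v : TangentSpace J x)
    (κ : ℝ) : Prop :=
  v ≠ 0 ∧ shapeOperator J g F N x v = κ • mfderiv J ((𝓡 n).prod 𝓘(ℝ, ℝ)) F x v

/-- `v ∈ T_x S` is a principal direction. -/
def IsPrincipalDirection
    (g : ContMDiffRiemannianMetric (𝓡 n) ∞ (EuclideanSpace ℝ (Fin n))
      (fun x : M ↦ TangentSpace (𝓡 n) x)) (F : S → M × ℝ)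
    (N : ∀ x : S, TangentSpace ((𝓡 n).prod 𝓘(ℝ, ℝ)) (F x)) (x : S) (v : TangentSpace J x) : Prop :=
  ∃ κ : ℝ, HasPrincipalCurvature g F N x v κ

/-! ### Parallel families and `(f_s, a)`-graphs -/

/-- `f s : P → M`, for `s` in the open interval `T ∋ 0`, is the family of immersions parallel to
`f 0`, in the direction of the unit normal field `η` of `f 0`: the curve `s ↦ f s p` is the geodesic
`s ↦ exp (f 0 p, s η p)`, and the hypersurfaces `f s` have no focal points, that is, they are
immersions. -/
structure IsParallelFamily
    (g : ContMDiffRiemannianMetric (𝓡 n) ∞ (EuclideanSpace ℝ (Fin n))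
      (fun x : M ↦ TangentSpace (𝓡 n) x)) (T : Set ℝ) (f : ℝ → P → M)
    (η : ∀ p : P, TangentSpace (𝓡 n) (f 0 p)) : Prop where
  isOpen : IsOpen T
  ordConnected : T.OrdConnected
  zero_mem : (0 : ℝ) ∈ T
  smooth : ContMDiffOn ((𝓡 (n - 1)).prod 𝓘(ℝ, ℝ)) (𝓡 n) ∞ (fun q : P × ℝ ↦ f q.2 q.1) (univ ×ˢ T)
  unitNormal : IsUnitNormal (𝓡 (n - 1)) (metric g) (f 0) η
  geodesic : ∀ p, IsGeodesicOn (metric g) (fun s ↦ f s p) T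
  velocity : ∀ p, mfderiv 𝓘(ℝ, ℝ) (𝓡 n) (fun s ↦ f s p) 0 (1 : ℝ) = η p
  immersion : ∀ s ∈ T, IsImmersed (𝓡 (n - 1)) (𝓡 n) (f s)

/-- The map `(p, s) ↦ f s p = exp (f 0 p, s η p)`, which is the normal exponential map in the
trivialization of the normal bundle by `η`, is a diffeomorphism of `P × T` onto its (open) image. -/
def IsNormalDiffeo (T : Set ℝ) (f : ℝ → P → M) : Prop :=
  ∃ Φ : PartialDiffeomorph ((𝓡 (n - 1)).prod 𝓘(ℝ, ℝ)) (𝓡 n) (P × ℝ) M ∞,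
    Φ.source = univ ×ˢ T ∧ ∀ p, ∀ s ∈ T, Φ (p, s) = f s p

/-- The part `W` of the hypersurface `F : S → M × ℝ` is the `(f_s, a)`-graph of the family `f` and
the function `a`: it is parametrized diffeomorphically by `P × T`, as `(p, s) ↦ (f s p, a s)`. -/
structure IsGraphOn (J : ModelWithCorners ℝ E' H')
    (g : ContMDiffRiemannianMetric (𝓡 n) ∞ (EuclideanSpace ℝ (Fin n))
      (fun x : M ↦ TangentSpace (𝓡 n) x)) (T : Set ℝ) (f : ℝ → P → M)
    (η : ∀ p : P, TangentSpace (𝓡 n) (f 0 p)) (a : ℝ → ℝ) (F : S → M × ℝ) (W : Set S) :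
    Prop where
  parallel : IsParallelFamily g T f η
  smooth : ContDiffOn ℝ ∞ a T
  deriv_pos : ∀ s ∈ T, 0 < deriv a s
  param : ∃ Ψ : PartialDiffeomorph ((𝓡 (n - 1)).prod 𝓘(ℝ, ℝ)) J (P × ℝ) S ∞,
    Ψ.source = univ ×ˢ T ∧ Ψ.target = W ∧ ∀ p, ∀ s ∈ T, F (Ψ (p, s)) = (f s p, a s)

/-- `F` is locally an `(f_s, a)`-graph: each point has an open neighbourhood which is such a graph,
over a family whose normal exponential map is a diffeomorphism onto its image. -/
def IsLocallyGraph (J : ModelWithCorners ℝ E' H')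
    (g : ContMDiffRiemannianMetric (𝓡 n) ∞ (EuclideanSpace ℝ (Fin n))
      (fun x : M ↦ TangentSpace (𝓡 n) x)) (F : S → M × ℝ) : Prop :=
  ∀ x : S, ∃ W : Set S, IsOpen W ∧ x ∈ W ∧
    ∃ (P : Type) (_ : TopologicalSpace P) (_ : ChartedSpace (EuclideanSpace ℝ (Fin (n - 1))) P),
      IsManifold (𝓡 (n - 1)) ∞ P ∧ T2Space P ∧ SecondCountableTopology P ∧
      ∃ (T : Set ℝ) (f : ℝ → P → M) (η : ∀ p : P, TangentSpace (𝓡 n) (f 0 p)) (a : ℝ → ℝ),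
        IsGraphOn J g T f η a F W ∧ IsNormalDiffeo (n := n) T f

end Product

end ParallelGraph

end

/-!
Write `∂_s` for the velocity of the curves `s ↦ (f_s p, a s)` of an `(f_s, a)`-graph. By the Gauss
lemma the geodesics `s ↦ f_s p` are orthogonal to the hypersurfaces `f_s`, and the height is
constant on the images of the slices, so the component of `N` along `M` is `-a' θ` times the unit
velocity of the geodesic. Hence `θ² (1 + a'²) = 1` and `∇ξ = a' θ² ∂_s`. As the velocity of a
geodesic is parallel, differentiating `N` along `∂_s` gives `A ∂_s = -(θ' / a') ∂_s`, where
`θ' / a'` depends on `s` only, up to the sign of `θ`.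

Conversely, the projection of `∇ξ` to `M` is `-θ` times the component of `N` along `M`, so along an
integral curve of `∇ξ`, rescaled to have a projection of unit speed, the acceleration of that
projection is proportional to its velocity if `∇ξ` is principal: the projection is a geodesic. Since
`θ ≠ 0`, `Σ` projects to `M` by local diffeomorphisms. The geodesics issued from a level set of the
height start orthogonally to its projection, and by the Gauss lemma they remain orthogonal to the
projections of its images under the flow. So the height stays constant on these images, and `Σ` is
locally a graph.
-/

noncomputable section

namespace ParallelGraph

/-! ### Smooth flows of vector fields -/

section InverseFunction

variable {E : Type*} [NormedAddCommGroup E] [NormedSpace ℝ E] [CompleteSpace E]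
  {F : Type*} [NormedAddCommGroup F] [NormedSpace ℝ F]

theorem exists_openPartialHomeomorph_contDiffOn_symm {f : E → F} {U : Set E} (hU : IsOpen U)
    (hf : ContDiffOn ℝ ∞ f U) {a : E} (ha : a ∈ U) (hinv : (fderiv ℝ f a).IsInvertible) :
    ∃ e : OpenPartialHomeomorph E F, a ∈ e.source ∧ e.source ⊆ U ∧ (∀ x, e x = f x) ∧
      ContDiffOn ℝ ∞ e.symm e.target := by
  have hfa : ContDiffAt ℝ ∞ f a := hf.contDiffAt (hU.mem_nhds ha)
  obtain ⟨f', hf'⟩ := id hinv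
  have hderiv : HasFDerivAt f (f' : E →L[ℝ] F) a :=
    hf' ▸ (hfa.differentiableAt (by simp)).hasFDerivAt
  have hopen : IsOpen (U ∩ fderiv ℝ f ⁻¹' range ((↑) : (E ≃L[ℝ] F) → E →L[ℝ] F)) :=
    (hf.continuousOn_fderiv_of_isOpen hU (by simp)).isOpen_inter_preimage hU
      ContinuousLinearEquiv.isOpen
  let e := (hfa.toOpenPartialHomeomorph f hderiv (by simp)).restrOpen _ hopen
  refine ⟨e, ⟨hfa.mem_toOpenPartialHomeomorph_source hderiv (by simp), ha, hinv⟩,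
    fun x hx ↦ hx.2.1, fun x ↦ rfl, fun y hy ↦ ?_⟩
  obtain ⟨-, hyU, f'', hf''⟩ := e.map_target hy
  have hsmooth := hf.contDiffAt (hU.mem_nhds hyU)
  have hderiv' := (hsmooth.differentiableAt (by simp)).hasFDerivAt
  rw [← hf''] at hderiv'
  exact (e.contDiffAt_symm hy hderiv' hsmooth).contDiffWithinAt

end InverseFunction

section Superposition

theorem exists_forall_norm_comp_add_sub_lt {K E F : Type*} [TopologicalSpace K] [CompactSpace K]
    [NormedAddCommGroup E] [NormedAddCommGroup F] (D : C(E, F)) (γ : C(K, E)) {c : ℝ} (hc : 0 < c) :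
    ∃ δ > 0, ∀ h : C(K, E), ‖h‖ < δ → ∀ t, ‖D (γ t + h t) - D (γ t)‖ < c := by
  have hcont : Continuous fun h : C(K, E) ↦ D.comp (γ + h) :=
    (ContinuousMap.continuous_postcomp D).comp (by fun_prop)
  obtain ⟨δ, hδ, hball⟩ := Metric.continuous_iff.1 hcont 0 c hc
  refine ⟨δ, hδ, fun h hh t ↦ ?_⟩
  simpa [dist_eq_norm] using (ContinuousMap.dist_lt_iff hc).1 (hball h (by simpa using hh)) t

universe u

variable {K : Type*} [TopologicalSpace K] [CompactSpace K]
  {E : Type u} [NormedAddCommGroup E] [NormedSpace ℝ E]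
  {F : Type u} [NormedAddCommGroup F] [NormedSpace ℝ F]

set_option synthInstance.maxHeartbeats 200000 in -- slow unification of instances on `C(K, _)`
/-- The pointwise evaluation `A ↦ (h ↦ (t ↦ A t (h t)))` of continuous families of operators on
continuous functions, as a bounded bilinear map. It expresses the derivative of superposition
operators. -/
def pointwiseApply : C(K, E →L[ℝ] F) →L[ℝ] C(K, E) →L[ℝ] C(K, F) :=
  LinearMap.mkContinuous₂
    (LinearMap.mk₂ ℝ (fun (A : C(K, E →L[ℝ] F)) (h : C(K, E)) ↦
        (⟨fun t ↦ A t (h t), by fun_prop⟩ : C(K, F)))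
      (fun _ _ _ ↦ by ext; simp) (fun _ _ _ ↦ by ext; simp) (fun _ _ _ ↦ by ext; simp)
      (fun _ _ _ ↦ by ext; simp)) 1
    (fun A h ↦ by
      rw [ContinuousMap.norm_le _ (by positivity), one_mul]
      exact fun t ↦ (A t).le_of_opNorm_le_of_le (A.norm_coe_le_norm t) (h.norm_coe_le_norm t))

@[simp] theorem pointwiseApply_apply (A : C(K, E →L[ℝ] F)) (h : C(K, E)) (t : K) :
    pointwiseApply A h t = A t (h t) := rfl

theorem hasFDerivAt_superposition {v : E → F} (hv : ContDiff ℝ 1 v) (γ : C(K, E)) :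
    HasFDerivAt (fun γ : C(K, E) ↦ (⟨v, hv.continuous⟩ : C(E, F)).comp γ)
      (pointwiseApply
        ((⟨fderiv ℝ v, hv.continuous_fderiv one_ne_zero⟩ : C(E, E →L[ℝ] F)).comp γ)) γ := by
  rw [hasFDerivAt_iff_isLittleO_nhds_zero, Asymptotics.isLittleO_iff]
  intro c hc
  obtain ⟨δ, hδ, hclose⟩ := exists_forall_norm_comp_add_sub_lt
    ⟨fderiv ℝ v, hv.continuous_fderiv one_ne_zero⟩ γ hc
  filter_upwards [Metric.ball_mem_nhds (0 : C(K, E)) hδ] with h hh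
  rw [ContinuousMap.norm_le _ (by positivity)]
  intro t
  have hseg : ∀ z ∈ segment ℝ (γ t) (γ t + h t), ‖fderiv ℝ v z - fderiv ℝ v (γ t)‖ ≤ c := by
    intro z hz
    rw [segment_eq_image'] at hz
    obtain ⟨r, hr, rfl⟩ := hz
    have hrh : ‖r • h‖ < δ := by
      rw [norm_smul, Real.norm_of_nonneg hr.1]
      exact (mul_le_of_le_one_left (norm_nonneg h) hr.2).trans_lt (mem_ball_zero_iff.1 hh)
    simpa using (hclose _ hrh t).le
  have hmean := (convex_segment (γ t) (γ t + h t)).norm_image_sub_le_of_norm_fderiv_le' (𝕜 := ℝ)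
    (fun z _ ↦ (hv.differentiable one_ne_zero) z) hseg (left_mem_segment ℝ _ _)
    (right_mem_segment ℝ _ _)
  simp only [add_sub_cancel_left] at hmean
  simpa using hmean.trans (mul_le_mul_of_nonneg_left (h.norm_coe_le_norm t) hc.le)

set_option synthInstance.maxHeartbeats 200000 in -- slow unification of instances on `C(K, _)`
theorem contDiff_superposition {v : E → F} (hv : ContDiff ℝ ∞ v) :
    ContDiff ℝ ∞ (fun γ : C(K, E) ↦ (⟨v, hv.continuous⟩ : C(E, F)).comp γ) := by
  rw [contDiff_infty]
  intro n
  induction n generalizing F with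
  | zero => exact contDiff_zero.2 (ContinuousMap.continuous_postcomp _)
  | succ n ih =>
    rw [Nat.cast_add, Nat.cast_one]
    refine contDiff_succ_iff_hasFDerivAt.2
      ⟨_, ?_, hasFDerivAt_superposition (hv.of_le (by simp))⟩
    exact (pointwiseApply (K := K) (E := E) (F := F)).contDiff.comp (ih (hv.fderiv_right (by simp)))

end Superposition

section Flow

open unitInterval

variable {E : Type*} [NormedAddCommGroup E] [NormedSpace ℝ E]

/-- The primitive, vanishing at `0`, of a continuous curve on the unit interval, as a bounded
operator. -/
def primitive : C(I, E) →L[ℝ] C(I, E) :=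
  have hcont (γ : C(I, E)) : Continuous (IccExtend (zero_le_one' ℝ) γ) :=
    γ.continuous.Icc_extend'
  LinearMap.mkContinuous
    { toFun := fun γ ↦ ⟨fun t ↦ ∫ r in (0 : ℝ)..t, IccExtend zero_le_one γ r,
        (intervalIntegral.continuous_primitive (fun a b ↦ (hcont γ).intervalIntegrable a b) 0).comp
          continuous_subtype_val⟩
      map_add' := fun γ γ' ↦ by
        ext t
        exact intervalIntegral.integral_add ((hcont γ).intervalIntegrable _ _)
          ((hcont γ').intervalIntegrable _ _)
      map_smul' := fun c γ ↦ by
        ext t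
        exact intervalIntegral.integral_smul c _ } 1
    (fun γ ↦ by
      rw [one_mul, ContinuousMap.norm_le _ (by positivity)]
      intro t
      refine (intervalIntegral.norm_integral_le_of_norm_le_const
        (C := ‖γ‖) fun r _ ↦ γ.norm_coe_le_norm _).trans ?_
      rw [sub_zero, abs_of_nonneg t.2.1]
      exact mul_le_of_le_one_right (norm_nonneg γ) t.2.2)

theorem primitive_apply_eq {γ : C(I, E)} {φ : ℝ → E} (hφ : ∀ r : I, γ r = φ r) (t : I) :
    primitive γ t = ∫ r in (0 : ℝ)..t, φ r := by
  refine intervalIntegral.integral_congr fun r hr ↦ ?_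
  rw [uIcc_of_le t.2.1] at hr
  rw [IccExtend_of_mem _ _ ⟨hr.1, hr.2.trans t.2.2⟩, hφ]

/-- The integral form of the equation `γ' = s v(γ)`, `γ(0) = x` on the unit interval: `γ` is the
integral curve of `v` issued from `x`, with time rescaled from `[0, s]`. The fixed interval of
parameters turns the flow into a problem on one Banach space of curves. -/
def IsRescaledIntegralCurve (v : C(E, E)) (s : ℝ) (x : E) (γ : C(I, E)) : Prop :=
  γ = ContinuousLinearMap.const ℝ I x + s • primitive (v.comp γ)

theorem IsRescaledIntegralCurve.apply_eq {v : C(E, E)} {s : ℝ} {x : E} {γ : C(I, E)}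
    (h : IsRescaledIntegralCurve v s x γ) (t : I) : γ t = x + s • primitive (v.comp γ) t :=
  congrArg (fun β : C(I, E) ↦ β t) h

theorem IsRescaledIntegralCurve.comp_mul {v : C(E, E)} {s : ℝ} {x : E} {γ : C(I, E)}
    (h : IsRescaledIntegralCurve v s x γ) (τ : I) :
    IsRescaledIntegralCurve v (s * τ) x (γ.comp ⟨fun r ↦ τ * r, by fun_prop⟩) := by
  set β : C(I, E) := γ.comp ⟨fun r ↦ τ * r, by fun_prop⟩
  have hext : ∀ r : I, v.comp β r = IccExtend zero_le_one (v.comp γ) (τ * r) := fun r ↦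
    (IccExtend_of_mem zero_le_one (v.comp γ) (τ * r).2).symm
  ext r
  calc β r = x + s • primitive (v.comp γ) (τ * r) := h.apply_eq _
    _ = x + (s * τ) • primitive (v.comp β) r := by
      rw [primitive_apply_eq (φ := fun q ↦ IccExtend zero_le_one (v.comp γ) (τ * q)) hext r,
        mul_smul, intervalIntegral.smul_integral_comp_mul_left]
      simp [primitive]

/-- The defect of the integral equation `γ = x + s ∫ v(γ)`, coupled with the parameters `(s, x)`
so that the inverse function theorem applies. -/
def integralDefect (v : C(E, E)) (q : (ℝ × E) × C(I, E)) : (ℝ × E) × C(I, E) :=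
  (q.1, q.2 - ContinuousLinearMap.const ℝ I q.1.2 - q.1.1 • primitive (v.comp q.2))

theorem integralDefect_eq_iff {v : C(E, E)} {p : ℝ × E} {γ : C(I, E)} :
    integralDefect v (p, γ) = (p, 0) ↔ IsRescaledIntegralCurve v p.1 p.2 γ := by
  simp [integralDefect, IsRescaledIntegralCurve, sub_sub, sub_eq_zero]

section Smooth

variable {v : E → E} (hv : ContDiff ℝ ∞ v)
include hv

theorem contDiff_primitive_superposition : ContDiff ℝ ∞ fun q : (ℝ × E) × C(I, E) ↦
    primitive ((⟨v, hv.continuous⟩ : C(E, E)).comp q.2) :=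
  primitive.contDiff.comp ((contDiff_superposition hv).comp contDiff_snd)

theorem contDiff_integralDefect : ContDiff ℝ ∞ (integralDefect ⟨v, hv.continuous⟩) :=
  have hconst : ContDiff ℝ ∞ fun q : (ℝ × E) × C(I, E) ↦ ContinuousLinearMap.const ℝ I q.1.2 :=
    ContDiff.comp (g := ContinuousLinearMap.const ℝ I) (ContinuousLinearMap.contDiff _)
      (contDiff_snd.comp contDiff_fst)
  contDiff_fst.prodMk ((contDiff_snd.sub hconst).sub
    ((contDiff_fst.comp contDiff_fst).smul (contDiff_primitive_superposition hv)))

theorem isInvertible_fderiv_integralDefect (x₀ : E) :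
    (fderiv ℝ (integralDefect ⟨v, hv.continuous⟩)
      ((0, x₀), ContinuousLinearMap.const ℝ I x₀)).IsInvertible := by
  set q₀ : (ℝ × E) × C(I, E) := ((0, x₀), ContinuousLinearMap.const ℝ I x₀)
  set w := primitive ((⟨v, hv.continuous⟩ : C(E, E)).comp q₀.2) with hw
  have hconst : HasFDerivAt
      (fun q : (ℝ × E) × C(I, E) ↦ ContinuousLinearMap.const ℝ I q.1.2) _ q₀ :=
    ((ContinuousLinearMap.const ℝ I).comp ((ContinuousLinearMap.snd ℝ ℝ E).comp
      (.fst ℝ (ℝ × E) C(I, E)))).hasFDerivAt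
  have htime : HasFDerivAt (fun q : (ℝ × E) × C(I, E) ↦ q.1.1) _ q₀ :=
    ((ContinuousLinearMap.fst ℝ ℝ E).comp (.fst ℝ (ℝ × E) C(I, E))).hasFDerivAt
  have hdefect := (hasFDerivAt_fst (p := q₀)).prodMk ((hasFDerivAt_snd.sub hconst).sub
    (htime.smul ((contDiff_primitive_superposition hv).differentiable (by simp) q₀).hasFDerivAt))
  refine ⟨ContinuousLinearEquiv.skewProd (.refl ℝ _) (.refl ℝ _)
    (-((ContinuousLinearMap.const ℝ I).comp (.snd ℝ ℝ E))
      - (ContinuousLinearMap.fst ℝ ℝ E).smulRight w), ?_⟩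
  refine Eq.trans ?_ hdefect.fderiv.symm
  ext q <;> simp [q₀, ContinuousLinearEquiv.skewProd, hw]

theorem exists_contDiffOn_rescaledIntegralCurve [CompleteSpace E] (x₀ : E) :
    ∃ γ : ℝ × E → C(I, E), ∃ δ > 0, ∃ ε > 0,
      ContDiffOn ℝ ∞ γ (Metric.ball (0, x₀) δ) ∧
      ∀ p ∈ Metric.ball (0, x₀) δ, γ p ∈ Metric.ball (ContinuousLinearMap.const ℝ I x₀) ε ∧
        ∀ β ∈ Metric.ball (ContinuousLinearMap.const ℝ I x₀) ε,
          IsRescaledIntegralCurve ⟨v, hv.continuous⟩ p.1 p.2 β ↔ β = γ p := by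
  obtain ⟨e, hmem, -, he, hsymm⟩ := exists_openPartialHomeomorph_contDiffOn_symm isOpen_univ
    (contDiff_integralDefect hv).contDiffOn (mem_univ _) (isInvertible_fderiv_integralDefect hv x₀)
  set c : C(I, E) := ContinuousLinearMap.const ℝ I x₀
  have hbase : e ((0, x₀), c) = ((0, x₀), 0) := by
    rw [he, integralDefect_eq_iff, IsRescaledIntegralCurve]; simp [c]
  have htarget : ((0, x₀), 0) ∈ e.target := hbase ▸ e.map_source hmem
  let γ : ℝ × E → C(I, E) := fun p ↦ (e.symm (p, 0)).2
  have hγ₀ : γ (0, x₀) = c := by simp only [γ, ← hbase, e.left_inv hmem]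
  have hcont : ContinuousAt γ (0, x₀) :=
    continuousAt_snd.comp (ContinuousAt.comp (f := fun p : ℝ × E ↦ (p, (0 : C(I, E))))
      (e.symm.continuousAt htarget) (by fun_prop))
  obtain ⟨ε, hε, hsource⟩ := Metric.isOpen_iff.1 e.open_source _ hmem
  have hnear : ∀ᶠ p in 𝓝 ((0 : ℝ), x₀), (p, (0 : C(I, E))) ∈ e.target ∧ γ p ∈ Metric.ball c ε :=
    ((continuousAt_id.prodMk continuousAt_const).eventually
      (e.open_target.mem_nhds htarget)).and
      (hcont.eventually (hγ₀ ▸ Metric.ball_mem_nhds c hε))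
  obtain ⟨δ, hδ, hball⟩ := Metric.eventually_nhds_iff.1 hnear
  refine ⟨γ, min δ ε, lt_min hδ hε, ε, hε, ?_, fun p hp ↦ ?_⟩
  · exact contDiff_snd.comp_contDiffOn (hsymm.comp (by fun_prop)
      fun p hp ↦ (hball ((Metric.mem_ball.1 hp).trans_le (min_le_left _ _))).1)
  obtain ⟨hp_target, hγp⟩ := hball ((Metric.mem_ball.1 hp).trans_le (min_le_left _ _))
  refine ⟨hγp, fun β hβ ↦ ?_⟩
  have hpβ : (p, β) ∈ e.source := hsource <| by
    rw [← ball_prod_same]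
    exact ⟨Metric.ball_subset_ball (min_le_right _ _) hp, hβ⟩
  rw [← integralDefect_eq_iff, ← he]
  constructor
  · intro h
    simp only [γ, ← h, e.left_inv hpβ]
  · rintro rfl
    have hinv := e.right_inv hp_target
    have hfst : (e.symm (p, 0)).1 = p := by
      simpa [he, integralDefect] using congrArg Prod.fst hinv
    convert hinv using 2
    exact Prod.ext hfst.symm rfl

end Smooth

theorem hasDerivAt_of_eq_add_integral [CompleteSpace E] {v φ : ℝ → E} {a b t₀ : ℝ}
    (ht₀ : t₀ ∈ Ioo a b) (hv : ContinuousOn v (Ioo a b)) {x : E}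
    (hφ : ∀ t ∈ Ioo a b, φ t = x + ∫ q in t₀..t, v q) {t : ℝ} (ht : t ∈ Ioo a b) :
    HasDerivAt φ (v t) t := by
  have hprim : HasDerivAt (fun r ↦ x + ∫ q in t₀..r, v q) (v t) t :=
    (intervalIntegral.integral_hasDerivAt_right
      (hv.mono (ordConnected_Ioo.uIcc_subset ht₀ ht)).intervalIntegrable
      (hv.stronglyMeasurableAtFilter isOpen_Ioo t ht)
      (hv.continuousAt (Ioo_mem_nhds ht.1 ht.2))).const_add x
  refine hprim.congr_of_eventuallyEq ?_
  filter_upwards [Ioo_mem_nhds ht.1 ht.2] with r hr using hφ r hr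

theorem exists_contDiffOn_flow [CompleteSpace E] {v : E → E} (hv : ContDiff ℝ ∞ v) (x₀ : E) :
    ∃ Φ : ℝ × E → E, ∃ δ > 0, ContDiffOn ℝ ∞ Φ (Metric.ball (0, x₀) δ) ∧
      (∀ x ∈ Metric.ball x₀ δ, Φ (0, x) = x) ∧
      ∀ p ∈ Metric.ball (0, x₀) δ, HasDerivAt (fun r ↦ Φ (r, p.2)) (v (Φ p)) p.1 := by
  obtain ⟨γ, δ, hδ, ε, -, hγ, hsol⟩ := exists_contDiffOn_rescaledIntegralCurve hv x₀
  have hmem {p : ℝ × E} :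
      p ∈ Metric.ball (0, x₀) δ ↔ p.1 ∈ Ioo (-δ) δ ∧ p.2 ∈ Metric.ball x₀ δ := by
    simp [← ball_prod_same, Real.ball_eq_Ioo]
  have hcurve : ∀ p ∈ Metric.ball (0, x₀) δ,
      IsRescaledIntegralCurve ⟨v, hv.continuous⟩ p.1 p.2 (γ p) :=
    fun p hp ↦ ((hsol p hp).2 _ (hsol p hp).1).2 rfl
  let Φ : ℝ × E → E := fun p ↦ γ p 1
  have hrescale : ∀ p ∈ Metric.ball (0, x₀) δ, ∀ τ : I, γ p τ = Φ (p.1 * τ, p.2) := by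
    intro p hp τ
    have hp' : (p.1 * τ, p.2) ∈ Metric.ball (0, x₀) δ := by
      refine hmem.2 ⟨?_, (hmem.1 hp).2⟩
      rw [mem_Ioo, ← abs_lt, abs_mul, abs_of_nonneg τ.2.1]
      exact (mul_le_of_le_one_right (abs_nonneg _) τ.2.2).trans_lt (abs_lt.2 (hmem.1 hp).1)
    have hclose : (γ p).comp ⟨fun r ↦ τ * r, by fun_prop⟩ ∈
        Metric.ball (ContinuousLinearMap.const ℝ I x₀) ε :=
      ((ContinuousMap.dist_le dist_nonneg).2 fun r ↦ ContinuousMap.dist_apply_le_dist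
        (f := γ p) (g := ContinuousLinearMap.const ℝ I x₀) (τ * r)).trans_lt (hsol p hp).1
    have huniq := ((hsol _ hp').2 _ hclose).1 ((hcurve p hp).comp_mul τ)
    simp [Φ, ← huniq]
  have hintegral : ∀ p ∈ Metric.ball (0, x₀) δ,
      Φ p = p.2 + ∫ q in (0 : ℝ)..p.1, v (Φ (q, p.2)) := by
    intro p hp
    rw [show Φ p = _ from (hcurve p hp).apply_eq 1,
      primitive_apply_eq (φ := fun q ↦ v (Φ (p.1 * q, p.2))) fun r ↦ congrArg v (hrescale p hp r),
      intervalIntegral.smul_integral_comp_mul_left (fun q ↦ v (Φ (q, p.2)))]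
    simp
  have hsmooth : ContDiffOn ℝ ∞ Φ (Metric.ball (0, x₀) δ) :=
    ContDiff.comp_contDiffOn (g := ContinuousMap.evalCLM ℝ (1 : I))
      (ContinuousLinearMap.contDiff _) hγ
  refine ⟨Φ, δ, hδ, hsmooth, fun x hx ↦ ?_, fun p hp ↦ ?_⟩
  · rw [hintegral (0, x) (hmem.2 ⟨by simpa using hδ, hx⟩)]; simp
  obtain ⟨ht, hx⟩ := hmem.1 hp
  exact hasDerivAt_of_eq_add_integral (v := fun q ↦ v (Φ (q, p.2))) (by simpa using hδ)
    (hv.continuous.comp_continuousOn (hsmooth.continuousOn.comp (by fun_prop)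
      fun q hq ↦ hmem.2 ⟨hq, hx⟩))
    (fun r hr ↦ hintegral (r, p.2) (hmem.2 ⟨hr, hx⟩)) ht

theorem exists_contDiff_eventuallyEq [FiniteDimensional ℝ E] {F : Type*} [NormedAddCommGroup F]
    [NormedSpace ℝ F] {v : E → F} {U : Set E} (hU : IsOpen U) (hv : ContDiffOn ℝ ∞ v U) {x₀ : E}
    (hx₀ : x₀ ∈ U) : ∃ w : E → F, ContDiff ℝ ∞ w ∧ w =ᶠ[𝓝 x₀] v := by
  obtain ⟨χ, hχU⟩ : ∃ χ : ContDiffBump x₀, tsupport χ ⊆ U := by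
    obtain ⟨r, hr, hrU⟩ := Metric.nhds_basis_closedBall.mem_iff.1 (hU.mem_nhds hx₀)
    exact ⟨⟨r / 2, r, half_pos hr, half_lt_self hr⟩, by rwa [ContDiffBump.tsupport_eq]⟩
  refine ⟨fun x ↦ χ x • v x, contDiff_iff_contDiffAt.2 fun x ↦ ?_, ?_⟩
  · by_cases hx : x ∈ tsupport χ
    · exact χ.contDiff.contDiffAt.smul (hv.contDiffAt (hU.mem_nhds (hχU hx)))
    · refine contDiffAt_const (c := 0) |>.congr_of_eventuallyEq ?_
      filter_upwards [(isClosed_tsupport χ).isOpen_compl.mem_nhds hx] with y hy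
      rw [image_eq_zero_of_notMem_tsupport hy, zero_smul]
  · filter_upwards [χ.eventuallyEq_one] with x hx
    rw [hx, Pi.one_apply, one_smul]

theorem exists_contDiffOn_flow_of_contDiffOn [FiniteDimensional ℝ E] {v : E → E} {U : Set E}
    (hU : IsOpen U) (hv : ContDiffOn ℝ ∞ v U) {x₀ : E} (hx₀ : x₀ ∈ U) :
    ∃ Φ : ℝ × E → E, ∃ δ > 0, ContDiffOn ℝ ∞ Φ (Metric.ball (0, x₀) δ) ∧
      (∀ x ∈ Metric.ball x₀ δ, Φ (0, x) = x) ∧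
      ∀ p ∈ Metric.ball (0, x₀) δ,
        Φ p ∈ U ∧ HasDerivAt (fun r ↦ Φ (r, p.2)) (v (Φ p)) p.1 := by
  have : CompleteSpace E := FiniteDimensional.complete ℝ E
  obtain ⟨w, hw, hwv⟩ := exists_contDiff_eventuallyEq hU hv hx₀
  obtain ⟨Φ, δ, hδ, hΦ, hΦ₀, hderiv⟩ := exists_contDiffOn_flow hw x₀
  have hcont : ContinuousAt Φ (0, x₀) :=
    hΦ.continuousOn.continuousAt (Metric.ball_mem_nhds _ hδ)
  rw [← hΦ₀ x₀ (Metric.mem_ball_self hδ)] at hwv hx₀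
  obtain ⟨δ', hδ', hnear⟩ := Metric.eventually_nhds_iff_ball.1
    ((hcont.eventually hwv).and (hcont.eventually (hU.mem_nhds hx₀)))
  refine ⟨Φ, min δ δ', lt_min hδ hδ', hΦ.mono (Metric.ball_subset_ball (min_le_left _ _)),
    fun x hx ↦ hΦ₀ x (Metric.ball_subset_ball (min_le_left _ _) hx), fun p hp ↦ ?_⟩
  obtain ⟨heq, hmem⟩ := hnear p (Metric.ball_subset_ball (min_le_right _ _) hp)
  exact ⟨hmem, heq ▸ hderiv p (Metric.ball_subset_ball (min_le_left _ _) hp)⟩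

end Flow

/-! ### Coordinates of tangent vectors -/

section Coordinates

variable {E : Type*} [NormedAddCommGroup E] [NormedSpace ℝ E]
  {H : Type*} [TopologicalSpace H] {I : ModelWithCorners ℝ E H}
  {X : Type*} [TopologicalSpace X] [ChartedSpace H X]
  {E' : Type*} [NormedAddCommGroup E'] [NormedSpace ℝ E']
  {H' : Type*} [TopologicalSpace H'] {J : ModelWithCorners ℝ E' H'}
  {S : Type*} [TopologicalSpace S] [ChartedSpace H' S]

theorem mvfderiv_real_one {f : ℝ → E} {s : ℝ} :
    mvfderiv 𝓘(ℝ, ℝ) f s (1 : ℝ) = deriv f s := by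
  rw [← fderiv_apply_one_eq_deriv]
  exact congrArg (fun L : ℝ →L[ℝ] E ↦ L 1) (mfderiv_eq_fderiv (f := f) (x := s))

section IsManifoldOne

variable [IsManifold I 1 X] {x₀ x : X}

theorem isInvertible_toCoord (hx : x ∈ (extChartAt I x₀).source) :
    (toCoord I x₀ x).IsInvertible :=
  isInvertible_mfderiv_extChartAt hx

theorem ofCoord_toCoord (hx : x ∈ (extChartAt I x₀).source) (v : TangentSpace I x) :
    ofCoord I x₀ x (toCoord I x₀ x v) = v :=
  (isInvertible_toCoord hx).inverse_apply_self v

theorem toCoord_ofCoord (hx : x ∈ (extChartAt I x₀).source) (u : E) :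
    toCoord I x₀ x (ofCoord I x₀ x u) = u :=
  (isInvertible_toCoord hx).self_apply_inverse u

theorem toCoord_mfderiv {F : S → X} {y : S} (hF : MDifferentiableAt J I F y)
    (hy : F y ∈ (extChartAt I x₀).source) (v : TangentSpace J y) :
    toCoord I x₀ (F y) (mfderiv J I F y v) = mvfderiv J (fun z ↦ extChartAt I x₀ (F z)) y v :=
  (mfderiv_comp_apply y (mdifferentiableAt_extChartAt (by rwa [← extChartAt_source I])) hF v).symm

theorem trivializationAt_eq_toCoord (hx : x ∈ (extChartAt I x₀).source) (v : TangentSpace I x) :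
    trivializationAt E (TangentSpace I) x₀ ⟨x, v⟩ = (x, toCoord I x₀ x v) := by
  rw [extChartAt_source] at hx
  have hcoe := congrArg (fun L ↦ L v)
    (TangentBundle.continuousLinearMapAt_trivializationAt (𝕜 := ℝ) (I := I) hx)
  refine Prod.ext (TangentBundle.trivializationAt_fst x₀ _) (Eq.trans ?_ hcoe)
  exact (Trivialization.continuousLinearMapAt_apply_of_mem ℝ _
    (by rwa [TangentBundle.trivializationAt_baseSet]) v).symm

variable {F : S → X} {V : ∀ y : S, TangentSpace I (F y)} {y : S}

theorem eventually_trivializationAt_eq_toCoord (hF : ContinuousAt F y)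
    (hy : F y ∈ (extChartAt I x₀).source) :
    (fun z ↦ (trivializationAt E (TangentSpace I) x₀ ⟨F z, V z⟩).2) =ᶠ[𝓝 y]
      fun z ↦ toCoord I x₀ (F z) (V z) := by
  filter_upwards [hF.preimage_mem_nhds ((isOpen_extChartAt_source x₀).mem_nhds hy)] with z hz
  rw [trivializationAt_eq_toCoord hz]

theorem mdifferentiableAt_tangentBundle_iff :
    MDifferentiableAt J I.tangent (fun z ↦ (⟨F z, V z⟩ : TangentBundle I X)) y ↔
      MDifferentiableAt J I F y ∧
        MDifferentiableAt J 𝓘(ℝ, E) (fun z ↦ toCoord I (F y) (F z) (V z)) y := by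
  rw [mdifferentiableAt_totalSpace]
  exact and_congr_right fun hF ↦
    (eventually_trivializationAt_eq_toCoord hF.continuousAt
      (mem_extChartAt_source (F y))).mdifferentiableAt_iff

end IsManifoldOne

section IsManifoldSmooth

variable [IsManifold I ∞ X] {F : S → X} {V : ∀ y : S, TangentSpace I (F y)} {y : S}

theorem contMDiffAt_tangentBundle_iff_of_mem {x₀ : X} (hy : F y ∈ (extChartAt I x₀).source) :
    ContMDiffAt J I.tangent ∞ (fun z ↦ (⟨F z, V z⟩ : TangentBundle I X)) y ↔
      ContMDiffAt J I ∞ F y ∧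
        ContMDiffAt J 𝓘(ℝ, E) ∞ (fun z ↦ toCoord I x₀ (F z) (V z)) y := by
  have hmem : (⟨F y, V y⟩ : TangentBundle I X) ∈
      (trivializationAt E (TangentSpace I : X → Type _) x₀).source := by
    rwa [Trivialization.mem_source, TangentBundle.trivializationAt_baseSet, ← extChartAt_source I]
  refine (Trivialization.contMDiffAt_iff (IM := J) (IB := I) (n := ∞)
    (f := fun z ↦ (⟨F z, V z⟩ : TangentBundle I X)) hmem).trans (and_congr_right fun hF ↦ ?_)
  exact (eventually_trivializationAt_eq_toCoord hF.continuousAt hy).contMDiffAt_iff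

theorem contMDiffAt_tangentBundle_iff :
    ContMDiffAt J I.tangent ∞ (fun z ↦ (⟨F z, V z⟩ : TangentBundle I X)) y ↔
      ContMDiffAt J I ∞ F y ∧
        ContMDiffAt J 𝓘(ℝ, E) ∞ (fun z ↦ toCoord I (F y) (F z) (V z)) y :=
  contMDiffAt_tangentBundle_iff_of_mem (mem_extChartAt_source (F y))

theorem contMDiffOn_ofCoord (x₀ : X) (u : E) :
    ContMDiffOn I I.tangent ∞ (fun x ↦ (⟨x, ofCoord I x₀ x u⟩ : TangentBundle I X))
      (extChartAt I x₀).source := by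
  set e := trivializationAt E (TangentSpace I : X → Type _) x₀ with he
  have hbase : e.baseSet = (extChartAt I x₀).source :=
    (TangentBundle.trivializationAt_baseSet x₀).trans (extChartAt_source I x₀).symm
  have hconst : ContMDiffOn I (I.prod 𝓘(ℝ, E)) ∞ (fun x : X ↦ (x, u)) (extChartAt I x₀).source :=
    (contMDiff_id.prodMk contMDiff_const).contMDiffOn
  refine ((e.contMDiffOn_symm (IB := I) (n := ∞)).comp hconst fun x hx ↦ ?_).congr fun x hx ↦ ?_
  · rwa [mem_preimage, e.mem_target, hbase]
  · have hex : e ⟨x, ofCoord I x₀ x u⟩ = (x, u) := by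
      rw [he, trivializationAt_eq_toCoord hx, toCoord_ofCoord hx]
    rw [Function.comp_apply, ← hex]
    exact (e.left_inv (by rwa [e.mem_source, hbase])).symm

end IsManifoldSmooth

end Coordinates

section Velocity

variable {E : Type*} [NormedAddCommGroup E] [NormedSpace ℝ E]
  {H : Type*} [TopologicalSpace H] {I : ModelWithCorners ℝ E H}
  {X : Type*} [TopologicalSpace X] [ChartedSpace H X]
  {V : Type*} [NormedAddCommGroup V] [NormedSpace ℝ V] {b : V → X} {q : V}

theorem contDiffAt_extChartAt_comp (hb : ContMDiffAt 𝓘(ℝ, V) I ∞ b q) :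
    ContDiffAt ℝ ∞ (extChartAt I (b q) ∘ b) q :=
  (contMDiffAt_extChartAt.comp q hb).contDiffAt

variable [IsManifold I ∞ X]

theorem eventually_toCoord_mfderiv_eq_fderiv (hb : ContMDiffAt 𝓘(ℝ, V) I ∞ b q) (e : V) :
    (fun z ↦ toCoord I (b q) (b z) (mfderiv 𝓘(ℝ, V) I b z e)) =ᶠ[𝓝 q]
      fun z ↦ fderiv ℝ (extChartAt I (b q) ∘ b) z e := by
  filter_upwards [hb.continuousAt.preimage_mem_nhds (extChartAt_source_mem_nhds (I := I) (b q)),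
    (contMDiffAt_iff_contMDiffAt_nhds (n := 1) (by simp)).1 (hb.of_le (by simp))] with z hz hbz
  exact (toCoord_mfderiv (hbz.mdifferentiableAt one_ne_zero) hz e).trans
    (congrArg (fun L : V →L[ℝ] E ↦ L e) mfderiv_eq_fderiv)

theorem contMDiffAt_mfderiv_apply (hb : ContMDiffAt 𝓘(ℝ, V) I ∞ b q) (e : V) :
    ContMDiffAt 𝓘(ℝ, V) I.tangent ∞
      (fun z ↦ (⟨b z, mfderiv 𝓘(ℝ, V) I b z e⟩ : TangentBundle I X)) q := by
  refine contMDiffAt_tangentBundle_iff.2 ⟨hb, ?_⟩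
  exact ((((contDiffAt_extChartAt_comp hb).fderiv_right (m := ∞) (by simp)).clm_apply
    contDiffAt_const).contMDiffAt).congr_of_eventuallyEq (eventually_toCoord_mfderiv_eq_fderiv hb e)

end Velocity

/-! ### The covariant derivative -/

section CovDeriv

variable {E : Type*} [NormedAddCommGroup E] [NormedSpace ℝ E]
  {H : Type*} [TopologicalSpace H] {I : ModelWithCorners ℝ E H}
  {X : Type*} [TopologicalSpace X] [ChartedSpace H X]
  {h : ∀ x : X, TangentSpace I x → TangentSpace I x → ℝ}
  {E' : Type*} [NormedAddCommGroup E'] [NormedSpace ℝ E']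
  {H' : Type*} [TopologicalSpace H'] {J : ModelWithCorners ℝ E' H'}
  {S : Type*} [TopologicalSpace S] [ChartedSpace H' S]

theorem covDeriv_congr {F : S → X} {V W : ∀ x : S, TangentSpace I (F x)} {x : S}
    (hVW : ∀ᶠ y in 𝓝 x, V y = W y) (v : TangentSpace J x) :
    covDeriv J h F V x v = covDeriv J h F W x v := by
  have hderiv : mvfderiv J (fun y ↦ toCoord I (F x) (F y) (V y)) x =
      mvfderiv J (fun y ↦ toCoord I (F x) (F y) (W y)) x :=
    Filter.EventuallyEq.mfderiv_eq (hVW.mono fun y hy ↦ congrArg _ hy)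
  rw [covDeriv, covDeriv, hderiv, hVW.self_of_nhds]

theorem christoffel_symm (hh : ∀ x u v, h x u v = h x v u) (x₀ : X) (y u v : E) :
    christoffel h x₀ y u v = christoffel h x₀ y v u := by
  have hcoord : ∀ z, coordMetric h x₀ z u v = coordMetric h x₀ z v u := fun z ↦ hh _ _ _
  simp only [christoffel, hcoord,
    add_comm (fderiv ℝ (fun z ↦ coordMetric h x₀ z v _) y u)]

section IsManifoldOne

variable [IsManifold I 1 X]

theorem covDeriv_comp {E'' : Type*} [NormedAddCommGroup E''] [NormedSpace ℝ E'']
    {H'' : Type*} [TopologicalSpace H''] {K : ModelWithCorners ℝ E'' H''}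
    {Y : Type*} [TopologicalSpace Y] [ChartedSpace H'' Y]
    {F : S → X} {V : ∀ x : S, TangentSpace I (F x)} {c : Y → S} {y : Y}
    (hc : MDifferentiableAt K J c y)
    (hV : MDifferentiableAt J I.tangent (fun x ↦ (⟨F x, V x⟩ : TangentBundle I X)) (c y))
    (v : TangentSpace K y) :
    covDeriv K h (fun z ↦ F (c z)) (fun z ↦ V (c z)) y v =
      covDeriv J h F V (c y) (mfderiv K J c y v) := by
  obtain ⟨hF, hVcoord⟩ := mdifferentiableAt_tangentBundle_iff.1 hV
  have hbase : mfderiv K I (fun z ↦ F (c z)) y v = mfderiv J I F (c y) (mfderiv K J c y v) :=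
    mfderiv_comp_apply y hF hc v
  have hfiber : mvfderiv K (fun z ↦ toCoord I (F (c y)) (F (c z)) (V (c z))) y v =
      mvfderiv J (fun x ↦ toCoord I (F (c y)) (F x) (V x)) (c y) (mfderiv K J c y v) :=
    mfderiv_comp_apply y hVcoord hc v
  rw [covDeriv, covDeriv, hbase, hfiber]

theorem toCoord_covDeriv (F : S → X) (V : ∀ x : S, TangentSpace I (F x)) (x : S)
    (v : TangentSpace J x) :
    toCoord I (F x) (F x) (covDeriv J h F V x v) =
      mvfderiv J (fun y ↦ toCoord I (F x) (F y) (V y)) x v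
        + christoffel h (F x) (extChartAt I (F x) (F x))
            (toCoord I (F x) (F x) (mfderiv J I F x v)) (toCoord I (F x) (F x) (V x)) :=
  toCoord_ofCoord (mem_extChartAt_source _) _

end IsManifoldOne

/-- In coordinates this is the symmetry of the Christoffel symbols and of second derivatives. -/
theorem covDeriv_mfderiv_comm [IsManifold I ∞ X] (hh : ∀ x u v, h x u v = h x v u)
    {V : Type*} [NormedAddCommGroup V] [NormedSpace ℝ V] {b : V → X} {q : V}
    (hb : ContMDiffAt 𝓘(ℝ, V) I ∞ b q) (e u : V) :
    covDeriv 𝓘(ℝ, V) h b (fun z ↦ mfderiv 𝓘(ℝ, V) I b z e) q u =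
      covDeriv 𝓘(ℝ, V) h b (fun z ↦ mfderiv 𝓘(ℝ, V) I b z u) q e := by
  set β := extChartAt I (b q) ∘ b
  have hβ : ContDiffAt ℝ ∞ β q := contDiffAt_extChartAt_comp hb
  have hsecond : ∀ e u : V, mvfderiv 𝓘(ℝ, V)
      (fun z ↦ toCoord I (b q) (b z) (mfderiv 𝓘(ℝ, V) I b z e)) q u =
        fderiv ℝ (fderiv ℝ β) q u e := fun e u ↦ by
    have hdiff : DifferentiableAt ℝ (fderiv ℝ β) q :=
      (hβ.fderiv_right (m := 1) (by norm_cast)).differentiableAt one_ne_zero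
    have hcoord : (mvfderiv 𝓘(ℝ, V)
        (fun z ↦ toCoord I (b q) (b z) (mfderiv 𝓘(ℝ, V) I b z e)) q : V →L[ℝ] E) =
          fderiv ℝ (fun z ↦ fderiv ℝ β z e) q :=
      (eventually_toCoord_mfderiv_eq_fderiv hb e).mfderiv_eq.trans mfderiv_eq_fderiv
    refine (congrArg (fun L : V →L[ℝ] E ↦ L u) hcoord).trans ?_
    rw [fderiv_clm_apply hdiff (differentiableAt_const e)]
    simp
  unfold covDeriv
  rw [hsecond, hsecond, christoffel_symm hh,
    ((hβ.of_le (m := 2) (by norm_cast)).isSymmSndFDerivAt (by simp)).eq]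

end CovDeriv

/-! ### Riemannian metrics in coordinates -/

theorem sharp_eq {V : Type*} [Zero V] {b : V → V → ℝ} {ℓ : V → ℝ} {z : V}
    (hb : ∀ z z', (∀ w, b z w = b z' w) → z = z') (hz : ∀ w, b z w = ℓ w) : sharp b ℓ = z := by
  have hex : ∃ z, ∀ w, b z w = ℓ w := ⟨z, hz⟩
  rw [sharp, dif_pos hex]
  exact hb _ _ fun w ↦ (hex.choose_spec w).trans (hz w).symm

theorem apply_sharp {V : Type*} [NormedAddCommGroup V] [NormedSpace ℝ V] [FiniteDimensional ℝ V]
    (b : V →L[ℝ] V →L[ℝ] ℝ) (hb : ∀ v, v ≠ 0 → 0 < b v v) (ℓ : V →L[ℝ] ℝ) (w : V) :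
    b (sharp (fun u v ↦ b u v) ℓ) w = ℓ w := by
  suffices hex : ∃ z, ∀ w, b z w = ℓ w by
    rw [sharp, dif_pos hex]
    exact hex.choose_spec w
  let B : V →ₗ[ℝ] Module.Dual ℝ V := ContinuousLinearMap.coeLM ℝ ∘ₗ (b : V →ₗ[ℝ] V →L[ℝ] ℝ)
  have hinj : Function.Injective B := (injective_iff_map_eq_zero B).2 fun v hv ↦ by
    by_contra hne
    exact (hb v hne).ne' (LinearMap.congr_fun hv v)
  obtain ⟨z, hz⟩ := (LinearMap.injective_iff_surjective_of_finrank_eq_finrank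
    Subspace.dual_finrank_eq.symm).1 hinj ℓ
  exact ⟨z, LinearMap.congr_fun hz⟩

section Leibniz

variable {E : Type*} [NormedAddCommGroup E] [NormedSpace ℝ E]
  {F : Type*} [NormedAddCommGroup F] [NormedSpace ℝ F]
  {E' : Type*} [NormedAddCommGroup E'] [NormedSpace ℝ E']
  {H' : Type*} [TopologicalSpace H'] {J : ModelWithCorners ℝ E' H'}
  {S : Type*} [TopologicalSpace S] [ChartedSpace H' S] {x : S}

theorem mvfderiv_comp_fderiv {φ : E → F} {σ : S → E} (hφ : DifferentiableAt ℝ φ (σ x))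
    (hσ : MDifferentiableAt J 𝓘(ℝ, E) σ x) (v : TangentSpace J x) :
    mvfderiv J (fun y ↦ φ (σ y)) x v = fderiv ℝ φ (σ x) (mvfderiv J σ x v) :=
  (mfderiv_comp_apply x hφ.mdifferentiableAt hσ v).trans
    (congrArg (fun D : E →L[ℝ] F ↦ D (mvfderiv J σ x v)) mfderiv_eq_fderiv)

theorem mvfderiv_clm_apply {L : S → E →L[ℝ] F} {U : S → E}
    (hL : MDifferentiableAt J 𝓘(ℝ, E →L[ℝ] F) L x) (hU : MDifferentiableAt J 𝓘(ℝ, E) U x)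
    (v : TangentSpace J x) :
    mvfderiv J (fun y ↦ L y (U y)) x v = mvfderiv J L x v (U x) + L x (mvfderiv J U x v) := by
  have hpair : HasMFDerivAt J 𝓘(ℝ, (E →L[ℝ] F) × E) (fun y ↦ (L y, U y)) x
      ((mvfderiv J L x : E' →L[ℝ] E →L[ℝ] F).prod (mvfderiv J U x : E' →L[ℝ] E)) :=
    ⟨hL.continuousAt.prodMk hU.continuousAt, hL.hasMFDerivAt.2.prodMk hU.hasMFDerivAt.2⟩
  have happly := ((hasFDerivAt_fst (𝕜 := ℝ) (p := (L x, U x))).clm_apply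
    hasFDerivAt_snd).hasMFDerivAt.comp x hpair
  exact (congrArg (fun D : E' →L[ℝ] F ↦ D v) happly.mfderiv).trans (add_comm _ _)

set_option synthInstance.maxHeartbeats 100000 in
-- unifying the instances on `E →L[ℝ] E →L[ℝ] ℝ` is slow
theorem mvfderiv_bilin_apply {G : E → E →L[ℝ] E →L[ℝ] ℝ} {σ U W : S → E}
    (hG : DifferentiableAt ℝ G (σ x)) (hσ : MDifferentiableAt J 𝓘(ℝ, E) σ x)
    (hU : MDifferentiableAt J 𝓘(ℝ, E) U x) (hW : MDifferentiableAt J 𝓘(ℝ, E) W x)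
    (v : TangentSpace J x) :
    mvfderiv J (fun y ↦ G (σ y) (U y) (W y)) x v =
      fderiv ℝ G (σ x) (mvfderiv J σ x v) (U x) (W x) + G (σ x) (mvfderiv J U x v) (W x)
        + G (σ x) (U x) (mvfderiv J W x v) := by
  have hGσ : MDifferentiableAt J 𝓘(ℝ, E →L[ℝ] E →L[ℝ] ℝ) (fun y ↦ G (σ y)) x :=
    DifferentiableAt.comp_mdifferentiableAt (F' := E →L[ℝ] E →L[ℝ] ℝ) hG hσ
  have hGσ_deriv : mvfderiv J (fun y ↦ G (σ y)) x v = fderiv ℝ G (σ x) (mvfderiv J σ x v) :=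
    mvfderiv_comp_fderiv (F := E →L[ℝ] E →L[ℝ] ℝ) (φ := G) hG hσ v
  rw [mvfderiv_clm_apply (F := ℝ) (L := fun y ↦ G (σ y) (U y)) (hGσ.clm_apply hU) hW,
    mvfderiv_clm_apply (F := E →L[ℝ] ℝ) hGσ hU, hGσ_deriv, add_apply]

end Leibniz

section Metric

variable {n : ℕ} {M : Type*} [TopologicalSpace M] [ChartedSpace (EuclideanSpace ℝ (Fin n)) M]
  [IsManifold (𝓡 n) ∞ M]
  (g : ContMDiffRiemannianMetric (𝓡 n) ∞ (EuclideanSpace ℝ (Fin n))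
      (fun x : M ↦ TangentSpace (𝓡 n) x))

theorem contMDiffAt_inner {E' : Type*} [NormedAddCommGroup E'] [NormedSpace ℝ E']
    {H' : Type*} [TopologicalSpace H'] {J : ModelWithCorners ℝ E' H'}
    {S : Type*} [TopologicalSpace S] [ChartedSpace H' S] {F : S → M}
    {V W : ∀ x : S, TangentSpace (𝓡 n) (F x)} {x : S}
    (hV : ContMDiffAt J (𝓡 n).tangent ∞ (fun y ↦ (⟨F y, V y⟩ : TangentBundle (𝓡 n) M)) x)
    (hW : ContMDiffAt J (𝓡 n).tangent ∞ (fun y ↦ (⟨F y, W y⟩ : TangentBundle (𝓡 n) M)) x) :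
    ContMDiffAt J 𝓘(ℝ, ℝ) ∞ (fun y ↦ g.inner (F y) (V y) (W y)) x := by
  let _ : RiemannianBundle (fun x : M ↦ TangentSpace (𝓡 n) x) := ⟨g.toRiemannianMetric⟩
  exact ContMDiffAt.inner_bundle (IB := 𝓡 n) (E := fun x : M ↦ TangentSpace (𝓡 n) x) (v := V)
    (w := W) hV hW

/-- The metric in the preferred chart around `x₀`, as a bilinear form depending on the point of
coordinates `y`: a bundled version of `coordMetric (metric g) x₀ y`. -/
def metricCoord (x₀ : M) (y : EuclideanSpace ℝ (Fin n)) :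
    EuclideanSpace ℝ (Fin n) →L[ℝ] EuclideanSpace ℝ (Fin n) →L[ℝ] ℝ :=
  (ContinuousLinearMap.precomp ℝ (ofCoord (𝓡 n) x₀ _)).comp
    ((g.inner ((extChartAt (𝓡 n) x₀).symm y)).comp (ofCoord (𝓡 n) x₀ _))

theorem coordMetric_metric (x₀ : M) (y u v : EuclideanSpace ℝ (Fin n)) :
    coordMetric (metric g) x₀ y u v = metricCoord g x₀ y u v := rfl

theorem inner_eq_metricCoord {x₀ x : M} (hx : x ∈ (extChartAt (𝓡 n) x₀).source)
    (u v : TangentSpace (𝓡 n) x) :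
    g.inner x u v = metricCoord g x₀ (extChartAt (𝓡 n) x₀ x) (toCoord (𝓡 n) x₀ x u)
      (toCoord (𝓡 n) x₀ x v) := by
  rw [← coordMetric_metric, coordMetric, metric, (extChartAt (𝓡 n) x₀).left_inv hx,
    ofCoord_toCoord hx, ofCoord_toCoord hx]

theorem metricCoord_symm (x₀ : M) (y u v : EuclideanSpace ℝ (Fin n)) :
    metricCoord g x₀ y u v = metricCoord g x₀ y v u := g.symm _ _ _

variable {x₀ : M} {y : EuclideanSpace ℝ (Fin n)}

theorem metricCoord_pos (hy : y ∈ (extChartAt (𝓡 n) x₀).target) {u : EuclideanSpace ℝ (Fin n)}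
    (hu : u ≠ 0) : 0 < metricCoord g x₀ y u u := by
  refine g.pos _ _ fun h ↦ hu ?_
  rw [← toCoord_ofCoord (I := 𝓡 n) ((extChartAt (𝓡 n) x₀).map_target hy) u]
  exact (congrArg _ h).trans (map_zero _)

theorem metricCoord_ext (hy : y ∈ (extChartAt (𝓡 n) x₀).target) {u v : EuclideanSpace ℝ (Fin n)}
    (h : ∀ w, metricCoord g x₀ y u w = metricCoord g x₀ y v w) : u = v := by
  by_contra hne
  refine (metricCoord_pos g hy (sub_ne_zero.2 hne)).ne' ?_
  rw [map_sub (metricCoord g x₀ y), sub_apply, h, sub_self]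

theorem contDiffOn_metricCoord (x₀ : M) :
    ContDiffOn ℝ ∞ (metricCoord g x₀) (extChartAt (𝓡 n) x₀).target := by
  refine contDiffOn_clm_apply.2 fun u ↦ contDiffOn_clm_apply.2 fun v ↦ ?_
  have hinner : ContMDiffOn (𝓡 n) 𝓘(ℝ, ℝ) ∞
      (fun x ↦ g.inner x (ofCoord (𝓡 n) x₀ x u) (ofCoord (𝓡 n) x₀ x v))
      (extChartAt (𝓡 n) x₀).source := fun x hx ↦ by
    have hnhds := (isOpen_extChartAt_source (I := 𝓡 n) x₀).mem_nhds hx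
    exact (contMDiffAt_inner g ((contMDiffOn_ofCoord x₀ u).contMDiffAt hnhds)
      ((contMDiffOn_ofCoord x₀ v).contMDiffAt hnhds)).contMDiffWithinAt
  exact (hinner.comp (contMDiffOn_extChartAt_symm x₀)
    fun y hy ↦ (extChartAt (𝓡 n) x₀).map_target hy).contDiffOn

theorem differentiableAt_metricCoord (hy : y ∈ (extChartAt (𝓡 n) x₀).target) :
    DifferentiableAt ℝ (metricCoord g x₀) y :=
  ((contDiffOn_metricCoord g x₀).contDiffAt ((isOpen_extChartAt_target x₀).mem_nhds hy)
    ).differentiableAt (by simp)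

theorem hasFDerivAt_metricCoord_apply (hy : y ∈ (extChartAt (𝓡 n) x₀).target)
    (u v : EuclideanSpace ℝ (Fin n)) :
    HasFDerivAt (fun z ↦ metricCoord g x₀ z u v)
      (((fderiv ℝ (metricCoord g x₀) y).flip u).flip v) y := by
  refine (((differentiableAt_metricCoord g hy).hasFDerivAt.clm_apply
    (hasFDerivAt_const u y)).clm_apply (hasFDerivAt_const v y)).congr_fderiv ?_
  ext w
  simp

theorem fderiv_metricCoord_symm (hy : y ∈ (extChartAt (𝓡 n) x₀).target)
    (u v w : EuclideanSpace ℝ (Fin n)) :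
    fderiv ℝ (metricCoord g x₀) y w u v = fderiv ℝ (metricCoord g x₀) y w v u :=
  congrArg (fun L ↦ L w) ((hasFDerivAt_metricCoord_apply g hy u v).unique
    ((hasFDerivAt_metricCoord_apply g hy v u).congr_of_eventuallyEq
      (Filter.Eventually.of_forall fun z ↦ metricCoord_symm g x₀ z u v)))

theorem metricCoord_christoffel (hy : y ∈ (extChartAt (𝓡 n) x₀).target)
    (u v w : EuclideanSpace ℝ (Fin n)) :
    metricCoord g x₀ y (christoffel (metric g) x₀ y u v) w =
      (fderiv ℝ (metricCoord g x₀) y u v w + fderiv ℝ (metricCoord g x₀) y v u w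
        - fderiv ℝ (metricCoord g x₀) y w u v) / 2 := by
  let ℓ : EuclideanSpace ℝ (Fin n) →L[ℝ] ℝ := (1 / 2 : ℝ) •
    (fderiv ℝ (metricCoord g x₀) y u v + fderiv ℝ (metricCoord g x₀) y v u
      - ((fderiv ℝ (metricCoord g x₀) y).flip u).flip v)
  have hℓ : ∀ w, ℓ w = (fderiv ℝ (metricCoord g x₀) y u v w
      + fderiv ℝ (metricCoord g x₀) y v u w - fderiv ℝ (metricCoord g x₀) y w u v) / 2 :=
    fun w ↦ by
      simp only [ℓ, smul_apply, sub_apply, add_apply, ContinuousLinearMap.flip_apply, smul_eq_mul]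
      ring
  have hcoord : ∀ u v w, fderiv ℝ (fun z ↦ coordMetric (metric g) x₀ z u v) y w =
      fderiv ℝ (metricCoord g x₀) y w u v := fun u v w ↦
    congrArg (fun L ↦ L w) (hasFDerivAt_metricCoord_apply g hy u v).fderiv
  have hsharp : christoffel (metric g) x₀ y u v = sharp (fun u v ↦ metricCoord g x₀ y u v) ℓ :=
    congrArg (sharp _) (funext fun w ↦ by rw [hℓ, hcoord, hcoord, hcoord])
  rw [hsharp, apply_sharp _ (fun v hv ↦ metricCoord_pos g hy hv), hℓ]

theorem christoffel_smul_right (hy : y ∈ (extChartAt (𝓡 n) x₀).target) (c : ℝ)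
    (u v : EuclideanSpace ℝ (Fin n)) :
    christoffel (metric g) x₀ y u (c • v) = c • christoffel (metric g) x₀ y u v := by
  refine metricCoord_ext g hy fun w ↦ ?_
  have hform_smul : ∀ (B : EuclideanSpace ℝ (Fin n) →L[ℝ] EuclideanSpace ℝ (Fin n) →L[ℝ] ℝ) (u w),
      B (c • u) w = c * B u w := fun B u w ↦ by rw [B.map_smul, smul_apply, smul_eq_mul]
  have hderiv_smul : ∀ (L : EuclideanSpace ℝ (Fin n) →L[ℝ] EuclideanSpace ℝ (Fin n) →L[ℝ]
      EuclideanSpace ℝ (Fin n) →L[ℝ] ℝ) (v u w), L (c • v) u w = c * L v u w := fun L v u w ↦ by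
    rw [L.map_smul]; rfl
  rw [hform_smul, metricCoord_christoffel g hy, metricCoord_christoffel g hy, hform_smul,
    hderiv_smul, ContinuousLinearMap.map_smul, smul_eq_mul]
  ring

theorem christoffel_smul_left (hy : y ∈ (extChartAt (𝓡 n) x₀).target) (c : ℝ)
    (u v : EuclideanSpace ℝ (Fin n)) :
    christoffel (metric g) x₀ y (c • u) v = c • christoffel (metric g) x₀ y u v := by
  have hsymm := christoffel_symm (h := metric g) (fun x u v ↦ g.symm x u v)
  rw [hsymm, christoffel_smul_right g hy, hsymm]

end Metric

section LeviCivita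

variable {n : ℕ} {M : Type*} [TopologicalSpace M] [ChartedSpace (EuclideanSpace ℝ (Fin n)) M]
  [IsManifold (𝓡 n) ∞ M]
  (g : ContMDiffRiemannianMetric (𝓡 n) ∞ (EuclideanSpace ℝ (Fin n))
      (fun x : M ↦ TangentSpace (𝓡 n) x))
  {E' : Type*} [NormedAddCommGroup E'] [NormedSpace ℝ E']
  {H' : Type*} [TopologicalSpace H'] {J : ModelWithCorners ℝ E' H'}
  {S : Type*} [TopologicalSpace S] [ChartedSpace H' S]
  {F : S → M} {x : S}

theorem covDeriv_smul {V : ∀ x : S, TangentSpace (𝓡 n) (F x)} {ρ : S → ℝ}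
    (hρ : MDifferentiableAt J 𝓘(ℝ, ℝ) ρ x)
    (hV : MDifferentiableAt J (𝓡 n).tangent (fun y ↦ (⟨F y, V y⟩ : TangentBundle (𝓡 n) M)) x)
    (v : TangentSpace J x) :
    covDeriv J (metric g) F (fun y ↦ ρ y • V y) x v =
      mvfderiv J ρ x v • V x + ρ x • covDeriv J (metric g) F V x v := by
  have hcoord : (fun y ↦ toCoord (𝓡 n) (F x) (F y) (ρ y • V y)) =
      ρ • fun y ↦ toCoord (𝓡 n) (F x) (F y) (V y) := funext fun y ↦ map_smul _ _ _
  rw [covDeriv, covDeriv, hcoord, mvfderiv_smul hρ (mdifferentiableAt_tangentBundle_iff.1 hV).2,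
    map_smul, christoffel_smul_right g (mem_extChartAt_target _), add_apply, smul_apply,
    ContinuousLinearMap.smulRight_apply, map_add, map_add, map_smul, map_smul, map_smul,
    ofCoord_toCoord (mem_extChartAt_source _), map_add, smul_add]
  abel

theorem covDeriv_smul_direction (V : ∀ x : S, TangentSpace (𝓡 n) (F x)) (c : ℝ)
    (v : TangentSpace J x) :
    covDeriv J (metric g) F V x (c • v) = c • covDeriv J (metric g) F V x v := by
  rw [covDeriv, covDeriv, map_smul, map_smul, map_smul,
    christoffel_smul_left g (mem_extChartAt_target _), ← smul_add, map_smul]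

theorem mvfderiv_inner {V W : ∀ x : S, TangentSpace (𝓡 n) (F x)}
    (hV : MDifferentiableAt J (𝓡 n).tangent (fun y ↦ (⟨F y, V y⟩ : TangentBundle (𝓡 n) M)) x)
    (hW : MDifferentiableAt J (𝓡 n).tangent (fun y ↦ (⟨F y, W y⟩ : TangentBundle (𝓡 n) M)) x)
    (v : TangentSpace J x) :
    mvfderiv J (fun y ↦ g.inner (F y) (V y) (W y)) x v =
      g.inner (F x) (covDeriv J (metric g) F V x v) (W x)
        + g.inner (F x) (V x) (covDeriv J (metric g) F W x v) := by
  obtain ⟨hF, hVcoord⟩ := mdifferentiableAt_tangentBundle_iff.1 hV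
  have hWcoord := (mdifferentiableAt_tangentBundle_iff.1 hW).2
  have hsource := mem_extChartAt_source (I := 𝓡 n) (F x)
  have htarget := mem_extChartAt_target (I := 𝓡 n) (F x)
  have hcoord : (fun y ↦ g.inner (F y) (V y) (W y)) =ᶠ[𝓝 x] fun y ↦
      metricCoord g (F x) (extChartAt (𝓡 n) (F x) (F y)) (toCoord (𝓡 n) (F x) (F y) (V y))
        (toCoord (𝓡 n) (F x) (F y) (W y)) := by
    filter_upwards [hF.continuousAt.preimage_mem_nhds (extChartAt_source_mem_nhds (I := 𝓡 n) _)]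
      with y hy using inner_eq_metricCoord g hy _ _
  have hchart : MDifferentiableAt J 𝓘(ℝ, EuclideanSpace ℝ (Fin n))
      (fun y ↦ extChartAt (𝓡 n) (F x) (F y)) x :=
    (mdifferentiableAt_extChartAt (mem_chart_source _ _)).comp x hF
  have hderiv : mvfderiv J (fun y ↦ g.inner (F y) (V y) (W y)) x =
      mvfderiv J (fun y ↦ metricCoord g (F x) (extChartAt (𝓡 n) (F x) (F y))
        (toCoord (𝓡 n) (F x) (F y) (V y)) (toCoord (𝓡 n) (F x) (F y) (W y))) x :=
    hcoord.mfderiv_eq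
  rw [hderiv, mvfderiv_bilin_apply (σ := fun y ↦ extChartAt (𝓡 n) (F x) (F y))
    (differentiableAt_metricCoord g htarget) hchart hVcoord hWcoord,
    inner_eq_metricCoord g hsource, inner_eq_metricCoord g hsource, toCoord_covDeriv,
    toCoord_covDeriv, toCoord_mfderiv hF hsource, metricCoord_symm g _ _ _ (_ + _), map_add,
    map_add, add_apply, add_apply, metricCoord_christoffel g htarget,
    metricCoord_christoffel g htarget, fderiv_metricCoord_symm g htarget]
  rw [metricCoord_symm g (F x) _ (toCoord (𝓡 n) (F x) (F x) (V x))]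
  ring

end LeviCivita

/-! ### Geodesics and the Gauss lemma -/

section Gauss

variable {n : ℕ} {M : Type*} [TopologicalSpace M] [ChartedSpace (EuclideanSpace ℝ (Fin n)) M]
  [IsManifold (𝓡 n) ∞ M]
  (g : ContMDiffRiemannianMetric (𝓡 n) ∞ (EuclideanSpace ℝ (Fin n))
      (fun x : M ↦ TangentSpace (𝓡 n) x))

theorem hasDerivAt_inner {γ : ℝ → M} {V W : ∀ r, TangentSpace (𝓡 n) (γ r)} {s : ℝ}
    (hV : ContMDiffAt 𝓘(ℝ, ℝ) (𝓡 n).tangent ∞ (fun r ↦ (⟨γ r, V r⟩ : TangentBundle (𝓡 n) M)) s)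
    (hW : ContMDiffAt 𝓘(ℝ, ℝ) (𝓡 n).tangent ∞ (fun r ↦ (⟨γ r, W r⟩ : TangentBundle (𝓡 n) M)) s) :
    HasDerivAt (fun r ↦ g.inner (γ r) (V r) (W r))
      (g.inner (γ s) (covDeriv 𝓘(ℝ, ℝ) (metric g) γ V s (1 : ℝ)) (W s)
        + g.inner (γ s) (V s) (covDeriv 𝓘(ℝ, ℝ) (metric g) γ W s (1 : ℝ))) s := by
  have hleibniz := mvfderiv_inner g (hV.mdifferentiableAt (by simp))
    (hW.mdifferentiableAt (by simp)) (1 : ℝ)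
  exact ((contMDiffAt_inner g hV hW).mdifferentiableAt (by simp)).differentiableAt.hasDerivAt
    |>.congr_deriv (mvfderiv_real_one.symm.trans hleibniz)

variable {g} in
theorem IsGeodesicOn.hasDerivAt_speed {γ : ℝ → M} {T : Set ℝ} (hT : IsOpen T)
    (hγ : IsGeodesicOn (metric g) γ T) {s : ℝ} (hs : s ∈ T) :
    HasDerivAt (fun r ↦ g.inner (γ r) (mfderiv 𝓘(ℝ, ℝ) (𝓡 n) γ r (1 : ℝ))
      (mfderiv 𝓘(ℝ, ℝ) (𝓡 n) γ r (1 : ℝ))) 0 s := by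
  have hvelocity := contMDiffAt_mfderiv_apply (hγ.1.contMDiffAt (hT.mem_nhds hs)) (1 : ℝ)
  have hderiv := hasDerivAt_inner g hvelocity hvelocity
  rw [hγ.2 s hs] at hderiv
  simpa using hderiv

-- `⟨D_e b_e, b_u⟩ + ⟨b_e, D_e b_u⟩` is reduced to `⟨b_e, D_u b_e⟩ = ∂_u |b_e|² / 2`.
theorem mvfderiv_inner_mfderiv_eq_zero {V : Type*} [NormedAddCommGroup V] [NormedSpace ℝ V]
    {b : V → M} {q e u : V} (hb : ContMDiffAt 𝓘(ℝ, V) (𝓡 n) ∞ b q)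
    (hgeo : covDeriv 𝓘(ℝ, V) (metric g) b (fun z ↦ mfderiv 𝓘(ℝ, V) (𝓡 n) b z e) q e = 0)
    (hspeed : mvfderiv 𝓘(ℝ, V) (fun z ↦ g.inner (b z) (mfderiv 𝓘(ℝ, V) (𝓡 n) b z e)
      (mfderiv 𝓘(ℝ, V) (𝓡 n) b z e)) q u = 0) :
    mvfderiv 𝓘(ℝ, V) (fun z ↦ g.inner (b z) (mfderiv 𝓘(ℝ, V) (𝓡 n) b z e)
      (mfderiv 𝓘(ℝ, V) (𝓡 n) b z u)) q e = 0 := by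
  have he := (contMDiffAt_mfderiv_apply hb e).mdifferentiableAt (by simp)
  have hu := (contMDiffAt_mfderiv_apply hb u).mdifferentiableAt (by simp)
  have hmixed := (mvfderiv_inner g he he u).symm.trans hspeed
  rw [g.symm, ← two_mul, mul_eq_zero_iff_left two_ne_zero,
    covDeriv_mfderiv_comm (h := metric g) (fun x v w ↦ g.symm x v w) hb e u] at hmixed
  refine (mvfderiv_inner g he hu e).trans ?_
  rw [hgeo, map_zero, zero_apply, zero_add]
  exact hmixed

section Family

variable {V : Type*} [NormedAddCommGroup V] [NormedSpace ℝ V] {b : V × ℝ → M} {y : V} {s : ℝ}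

theorem hasMFDerivAt_curve (y : V) (s : ℝ) : HasMFDerivAt 𝓘(ℝ, ℝ) 𝓘(ℝ, V × ℝ)
    (fun r : ℝ ↦ (y, r)) s (ContinuousLinearMap.inr ℝ V ℝ) :=
  (hasFDerivAt_prodMk_right y s).hasMFDerivAt

omit [IsManifold (𝓡 n) ∞ M] in
theorem mfderiv_apply_zero_one (hb : MDifferentiableAt 𝓘(ℝ, V × ℝ) (𝓡 n) b (y, s)) :
    mfderiv 𝓘(ℝ, V × ℝ) (𝓡 n) b (y, s) ((0, 1) : V × ℝ) =
      mfderiv 𝓘(ℝ, ℝ) (𝓡 n) (fun r ↦ b (y, r)) s (1 : ℝ) :=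
  (congrArg (fun L : ℝ →L[ℝ] EuclideanSpace ℝ (Fin n) ↦ L 1)
    (hb.hasMFDerivAt.comp s (hasMFDerivAt_curve y s)).mfderiv).symm

omit [IsManifold (𝓡 n) ∞ M] in
theorem mfderiv_apply_prod_zero (hb : MDifferentiableAt 𝓘(ℝ, V × ℝ) (𝓡 n) b (y, s)) (v : V) :
    mfderiv 𝓘(ℝ, V × ℝ) (𝓡 n) b (y, s) ((v, 0) : V × ℝ) =
      mfderiv 𝓘(ℝ, V) (𝓡 n) (fun z ↦ b (z, s)) y v :=
  have hslice : HasMFDerivAt 𝓘(ℝ, V) 𝓘(ℝ, V × ℝ) (fun z ↦ (z, s)) y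
      (ContinuousLinearMap.inl ℝ V ℝ) := (hasFDerivAt_prodMk_left y s).hasMFDerivAt
  (congrArg (fun L : V →L[ℝ] EuclideanSpace ℝ (Fin n) ↦ L v)
    (HasMFDerivAt.comp (f := fun z ↦ (z, s)) y hb.hasMFDerivAt hslice).mfderiv).symm

theorem eventually_mdifferentiableAt (hb : ContMDiffAt 𝓘(ℝ, V × ℝ) (𝓡 n) ∞ b (y, s)) :
    ∀ᶠ z in 𝓝 (y, s), MDifferentiableAt 𝓘(ℝ, V × ℝ) (𝓡 n) b z :=
  ((contMDiffAt_iff_contMDiffAt_nhds (n := 1) (by simp)).1 (hb.of_le (by simp))).mono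
    fun _ hz ↦ hz.mdifferentiableAt one_ne_zero

theorem covDeriv_mfderiv_zero_one (hb : ContMDiffAt 𝓘(ℝ, V × ℝ) (𝓡 n) ∞ b (y, s)) :
    covDeriv 𝓘(ℝ, V × ℝ) (metric g) b
        (fun z ↦ mfderiv 𝓘(ℝ, V × ℝ) (𝓡 n) b z ((0, 1) : V × ℝ)) (y, s) ((0, 1) : V × ℝ) =
      covDeriv 𝓘(ℝ, ℝ) (metric g) (fun r ↦ b (y, r))
        (fun r ↦ mfderiv 𝓘(ℝ, ℝ) (𝓡 n) (fun r ↦ b (y, r)) r (1 : ℝ)) s (1 : ℝ) := by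
  have hcomp := covDeriv_comp (h := metric g) (F := b)
    (V := fun z ↦ mfderiv 𝓘(ℝ, V × ℝ) (𝓡 n) b z ((0, 1) : V × ℝ))
    (hasMFDerivAt_curve y s).mdifferentiableAt
    ((contMDiffAt_mfderiv_apply hb _).mdifferentiableAt (by simp)) (1 : ℝ)
  rw [(hasMFDerivAt_curve y s).mfderiv] at hcomp
  refine hcomp.symm.trans (covDeriv_congr ?_ _)
  filter_upwards [(Continuous.prodMk_right y).continuousAt.eventually
    (eventually_mdifferentiableAt hb)] with r hr using mfderiv_apply_zero_one hr

theorem hasDerivAt_gauss_family (hb : ContMDiffAt 𝓘(ℝ, V × ℝ) (𝓡 n) ∞ b (y, s))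
    (hgeo : covDeriv 𝓘(ℝ, ℝ) (metric g) (fun r ↦ b (y, r))
      (fun r ↦ mfderiv 𝓘(ℝ, ℝ) (𝓡 n) (fun r ↦ b (y, r)) r (1 : ℝ)) s (1 : ℝ) = 0)
    {c : ℝ} (hspeed : ∀ᶠ z in 𝓝 (y, s),
      g.inner (b z) (mfderiv 𝓘(ℝ, ℝ) (𝓡 n) (fun r ↦ b (z.1, r)) z.2 (1 : ℝ))
        (mfderiv 𝓘(ℝ, ℝ) (𝓡 n) (fun r ↦ b (z.1, r)) z.2 (1 : ℝ)) = c) (v : V) :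
    HasDerivAt (fun r ↦ g.inner (b (y, r)) (mfderiv 𝓘(ℝ, ℝ) (𝓡 n) (fun r ↦ b (y, r)) r (1 : ℝ))
      (mfderiv 𝓘(ℝ, V) (𝓡 n) (fun z ↦ b (z, r)) y v)) 0 s := by
  let e : V × ℝ := (0, 1)
  let u : V × ℝ := (v, 0)
  let β : V × ℝ → ℝ := fun z ↦ g.inner (b z) (mfderiv 𝓘(ℝ, V × ℝ) (𝓡 n) b z e)
    (mfderiv 𝓘(ℝ, V × ℝ) (𝓡 n) b z u)
  have hconstant : (fun z ↦ g.inner (b z) (mfderiv 𝓘(ℝ, V × ℝ) (𝓡 n) b z e)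
      (mfderiv 𝓘(ℝ, V × ℝ) (𝓡 n) b z e)) =ᶠ[𝓝 (y, s)] fun _ ↦ c := by
    filter_upwards [eventually_mdifferentiableAt hb, hspeed] with z hz hc
    rw [← hc, mfderiv_apply_zero_one hz]
  have hgauss : mvfderiv 𝓘(ℝ, V × ℝ) β (y, s) e = 0 :=
    mvfderiv_inner_mfderiv_eq_zero g hb ((covDeriv_mfderiv_zero_one g hb).trans hgeo)
      (congrArg (fun L : V × ℝ →L[ℝ] ℝ ↦ L u) (hconstant.mfderiv_eq.trans mfderiv_const))
  have hβ : DifferentiableAt ℝ β (y, s) := ((contMDiffAt_inner g (contMDiffAt_mfderiv_apply hb e)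
    (contMDiffAt_mfderiv_apply hb u)).mdifferentiableAt (by simp)).differentiableAt
  have hderiv : HasDerivAt (fun r ↦ β (y, r)) 0 s := by
    refine (hβ.hasFDerivAt.comp_hasDerivAt s
      (hasFDerivAt_prodMk_right y s).hasDerivAt).congr_deriv (Eq.trans ?_ hgauss)
    exact (congrArg (fun L : V × ℝ →L[ℝ] ℝ ↦ L e) (mfderiv_eq_fderiv (f := β))).symm
  refine hderiv.congr_of_eventuallyEq ?_
  filter_upwards [(Continuous.prodMk_right y).continuousAt.eventually
    (eventually_mdifferentiableAt hb)] with r hr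
  rw [← mfderiv_apply_zero_one hr, ← mfderiv_apply_prod_zero hr]

end Family

variable {E' : Type*} [NormedAddCommGroup E'] [NormedSpace ℝ E']
  {H' : Type*} [TopologicalSpace H'] {J : ModelWithCorners ℝ E' H'}
  {P : Type*} [TopologicalSpace P] [ChartedSpace H' P]

theorem totalSpaceMk_mfderiv_extChartAt_symm [IsManifold J 1 P] [J.Boundaryless] (p : P)
    (v : TangentSpace J p) :
    (⟨(extChartAt J p).symm (extChartAt J p p),
      mfderiv 𝓘(ℝ, E') J (extChartAt J p).symm (extChartAt J p p) v⟩ : TangentBundle J P) =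
      ⟨p, v⟩ := by
  have hderiv : mfderiv 𝓘(ℝ, E') J (extChartAt J p).symm (extChartAt J p p) =
      ContinuousLinearMap.id ℝ E' := by
    have hwithin := mfderivWithin_range_extChartAt_symm (I := J) (x := p)
    rwa [ModelWithCorners.range_eq_univ, mfderivWithin_univ] at hwithin
  exact Bundle.TotalSpace.ext (extChartAt_to_inv p) (heq_of_eq (congrArg (fun L ↦ L v) hderiv))

theorem hasDerivAt_gauss [IsManifold J ∞ P] [J.Boundaryless] {f : ℝ → P → M} {T : Set ℝ}
    (hT : IsOpen T)
    (hf : ContMDiffOn (J.prod 𝓘(ℝ, ℝ)) (𝓡 n) ∞ (fun q : P × ℝ ↦ f q.2 q.1) (univ ×ˢ T))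
    (hgeo : ∀ p, IsGeodesicOn (metric g) (fun s ↦ f s p) T)
    (hspeed : ∀ p, ∀ s ∈ T, g.inner (f s p) (mfderiv 𝓘(ℝ, ℝ) (𝓡 n) (fun s ↦ f s p) s (1 : ℝ))
      (mfderiv 𝓘(ℝ, ℝ) (𝓡 n) (fun s ↦ f s p) s (1 : ℝ)) = 1)
    (p : P) (v : TangentSpace J p) {s : ℝ} (hs : s ∈ T) :
    HasDerivAt (fun s ↦ g.inner (f s p) (mfderiv 𝓘(ℝ, ℝ) (𝓡 n) (fun s ↦ f s p) s (1 : ℝ))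
      (mfderiv J (𝓡 n) (f s) p v)) 0 s := by
  let φ : E' → P := (extChartAt J p).symm
  let y : E' := extChartAt J p p
  have hφ : ContMDiffAt 𝓘(ℝ, E') J ∞ φ y :=
    (contMDiffOn_extChartAt_symm p).contMDiffAt (extChartAt_target_mem_nhds p)
  have hf_at : ∀ p, ∀ r ∈ T, ContMDiffAt (J.prod 𝓘(ℝ, ℝ)) (𝓡 n) ∞ (fun q : P × ℝ ↦ f q.2 q.1)
      (p, r) := fun p r hr ↦ hf.contMDiffAt ((isOpen_univ.prod hT).mem_nhds ⟨mem_univ _, hr⟩)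
  have hb : ContMDiffAt 𝓘(ℝ, E' × ℝ) (𝓡 n) ∞ (fun z : E' × ℝ ↦ f z.2 (φ z.1)) (y, s) :=
    (hf_at (φ y) s hs).comp (f := fun z : E' × ℝ ↦ (φ z.1, z.2)) (y, s)
      ((hφ.comp (f := Prod.fst) (y, s) contDiffAt_fst.contMDiffAt).prodMk
        contDiffAt_snd.contMDiffAt)
  let IsConstantAt (q : TangentBundle J P) : Prop := HasDerivAt (fun s ↦ g.inner (f s q.1)
    (mfderiv 𝓘(ℝ, ℝ) (𝓡 n) (fun s ↦ f s q.1) s (1 : ℝ)) (mfderiv J (𝓡 n) (f s) q.1 q.2)) 0 s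
  suffices IsConstantAt ⟨p, v⟩ from this
  rw [← totalSpaceMk_mfderiv_extChartAt_symm p v]
  refine (hasDerivAt_gauss_family g hb ((hgeo (φ y)).2 s hs) (c := 1) ?_ v).congr_of_eventuallyEq ?_
  · filter_upwards [continuousAt_snd.preimage_mem_nhds (hT.mem_nhds hs)] with z hz
      using hspeed (φ z.1) z.2 hz
  · filter_upwards [hT.mem_nhds hs] with r hr
    have hfr : MDifferentiableAt J (𝓡 n) (f r) (φ y) := ((hf_at (φ y) r hr).comp (φ y)
      (f := fun p ↦ (p, r)) (contMDiffAt_id.prodMk contMDiffAt_const)).mdifferentiableAt (by simp)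
    exact congrArg _ (mfderiv_comp_apply y hfr (hφ.mdifferentiableAt (by simp)) v).symm

end Gauss

/-! ### The product `M × ℝ` -/

section ProdMk

variable {E₁ E₂ E' : Type*} [NormedAddCommGroup E₁] [NormedSpace ℝ E₁] [NormedAddCommGroup E₂]
  [NormedSpace ℝ E₂] [NormedAddCommGroup E'] [NormedSpace ℝ E']
  {H' : Type*} [TopologicalSpace H'] {J : ModelWithCorners ℝ E' H'}
  {S : Type*} [TopologicalSpace S] [ChartedSpace H' S]

theorem mvfderiv_prodMk {A : S → E₁} {B : S → E₂} {x : S}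
    (hA : MDifferentiableAt J 𝓘(ℝ, E₁) A x) (hB : MDifferentiableAt J 𝓘(ℝ, E₂) B x)
    (v : TangentSpace J x) :
    mvfderiv J (fun y ↦ (A y, B y)) x v = (mvfderiv J A x v, mvfderiv J B x v) := by
  have hAB : HasMFDerivAt J 𝓘(ℝ, E₁ × E₂) (fun y ↦ (A y, B y)) x
      ((mvfderiv J A x).prod (mvfderiv J B x)) :=
    ⟨hA.hasMFDerivAt.1.prodMk hB.hasMFDerivAt.1, hA.hasMFDerivAt.2.prodMk hB.hasMFDerivAt.2⟩
  exact congrArg (fun L : E' →L[ℝ] E₁ × E₂ ↦ L v) hAB.mfderiv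

end ProdMk

section Product

variable {n : ℕ} {M : Type*} [TopologicalSpace M] [ChartedSpace (EuclideanSpace ℝ (Fin n)) M]
  {E' : Type*} [NormedAddCommGroup E'] [NormedSpace ℝ E']
  {H' : Type*} [TopologicalSpace H'] {J : ModelWithCorners ℝ E' H'}
  {S : Type*} [TopologicalSpace S] [ChartedSpace H' S]

/-- The component along `M` of a tangent vector of `M × ℝ`. -/
def horizontal (q : M × ℝ) :
    TangentSpace ((𝓡 n).prod 𝓘(ℝ, ℝ)) q →L[ℝ] TangentSpace (𝓡 n) q.1 :=
  mfderiv ((𝓡 n).prod 𝓘(ℝ, ℝ)) (𝓡 n) Prod.fst q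

/-- The component along `ℝ` of a tangent vector of `M × ℝ`, as a real number. -/
def vertical (q : M × ℝ) : TangentSpace ((𝓡 n).prod 𝓘(ℝ, ℝ)) q →L[ℝ] ℝ :=
  mvfderiv ((𝓡 n).prod 𝓘(ℝ, ℝ)) (Prod.snd : M × ℝ → ℝ) q

/-- The tangent vector of `M × ℝ` with horizontal component `u` and vertical component `r`. -/
def tangentPair (q : M × ℝ) (u : TangentSpace (𝓡 n) q.1) (r : ℝ) :
    TangentSpace ((𝓡 n).prod 𝓘(ℝ, ℝ)) q :=
  ((u : EuclideanSpace ℝ (Fin n)), r)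

@[simp] theorem horizontal_tangentPair (q : M × ℝ) (u : TangentSpace (𝓡 n) q.1) (r : ℝ) :
    horizontal q (tangentPair q u r) = u := by
  rw [horizontal, mfderiv_fst]; rfl

@[simp] theorem vertical_tangentPair (q : M × ℝ) (u : TangentSpace (𝓡 n) q.1) (r : ℝ) :
    vertical q (tangentPair q u r) = r := by
  rw [vertical, mvfderiv, mfderiv_snd]; rfl

theorem eq_of_horizontal_vertical {q : M × ℝ} {u v : TangentSpace ((𝓡 n).prod 𝓘(ℝ, ℝ)) q}
    (hhor : horizontal q u = horizontal q v) (hver : vertical q u = vertical q v) : u = v := by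
  rw [horizontal, mfderiv_fst] at hhor
  rw [vertical, mvfderiv, mfderiv_snd] at hver
  exact Prod.ext hhor hver

theorem horizontal_mfderiv {F : S → M × ℝ} {x : S}
    (hF : MDifferentiableAt J ((𝓡 n).prod 𝓘(ℝ, ℝ)) F x) (v : TangentSpace J x) :
    horizontal (F x) (mfderiv J ((𝓡 n).prod 𝓘(ℝ, ℝ)) F x v) =
      mfderiv J (𝓡 n) (fun y ↦ (F y).1) x v :=
  (mfderiv_comp_apply x mdifferentiableAt_fst hF v).symm

theorem vertical_mfderiv {F : S → M × ℝ} {x : S}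
    (hF : MDifferentiableAt J ((𝓡 n).prod 𝓘(ℝ, ℝ)) F x) (v : TangentSpace J x) :
    vertical (F x) (mfderiv J ((𝓡 n).prod 𝓘(ℝ, ℝ)) F x v) =
      mvfderiv J (fun y ↦ (F y).2) x v :=
  (mfderiv_comp_apply x mdifferentiableAt_snd hF v).symm

section Coordinates

variable {q₀ q : M × ℝ}

theorem extChartAt_prod_real (q₀ q : M × ℝ) :
    extChartAt ((𝓡 n).prod 𝓘(ℝ, ℝ)) q₀ q = (extChartAt (𝓡 n) q₀.1 q.1, q.2) := by
  rw [extChartAt_prod, extChartAt_model_space_eq_id]; rfl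

theorem extChartAt_prod_real_symm (q₀ : M × ℝ) (y : EuclideanSpace ℝ (Fin n) × ℝ) :
    (extChartAt ((𝓡 n).prod 𝓘(ℝ, ℝ)) q₀).symm y = ((extChartAt (𝓡 n) q₀.1).symm y.1, y.2) := by
  rw [extChartAt_prod, extChartAt_model_space_eq_id]; rfl

theorem mem_extChartAt_prod_real_source (hq : q.1 ∈ (extChartAt (𝓡 n) q₀.1).source) :
    q ∈ (extChartAt ((𝓡 n).prod 𝓘(ℝ, ℝ)) q₀).source := by
  rw [extChartAt_prod, extChartAt_model_space_eq_id]
  exact ⟨hq, mem_univ _⟩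

variable [IsManifold (𝓡 n) ∞ M]

theorem toCoord_prod (hq : q.1 ∈ (extChartAt (𝓡 n) q₀.1).source)
    (u : TangentSpace ((𝓡 n).prod 𝓘(ℝ, ℝ)) q) :
    toCoord ((𝓡 n).prod 𝓘(ℝ, ℝ)) q₀ q u =
      (toCoord (𝓡 n) q₀.1 q.1 (horizontal q u), vertical q u) := by
  have hchart : MDifferentiableAt (𝓡 n) 𝓘(ℝ, EuclideanSpace ℝ (Fin n)) (extChartAt (𝓡 n) q₀.1)
      q.1 := mdifferentiableAt_extChartAt (by rwa [← extChartAt_source (𝓡 n)])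
  rw [toCoord, funext (extChartAt_prod_real q₀)]
  refine (mvfderiv_prodMk (hchart.comp q mdifferentiableAt_fst) mdifferentiableAt_snd u).trans ?_
  exact Prod.ext (mfderiv_comp_apply q hchart mdifferentiableAt_fst u) rfl

theorem horizontal_ofCoord (hq : q.1 ∈ (extChartAt (𝓡 n) q₀.1).source)
    (w : EuclideanSpace ℝ (Fin n) × ℝ) :
    horizontal q (ofCoord ((𝓡 n).prod 𝓘(ℝ, ℝ)) q₀ q w) = ofCoord (𝓡 n) q₀.1 q.1 w.1 := by
  have hw := (toCoord_prod hq _).symm.trans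
    (toCoord_ofCoord (mem_extChartAt_prod_real_source hq) w)
  exact (ofCoord_toCoord hq _).symm.trans (congrArg _ (congrArg Prod.fst hw))

theorem vertical_ofCoord (hq : q.1 ∈ (extChartAt (𝓡 n) q₀.1).source)
    (w : EuclideanSpace ℝ (Fin n) × ℝ) :
    vertical q (ofCoord ((𝓡 n).prod 𝓘(ℝ, ℝ)) q₀ q w) = w.2 :=
  congrArg Prod.snd ((toCoord_prod hq _).symm.trans
    (toCoord_ofCoord (mem_extChartAt_prod_real_source hq) w))

end Coordinates

variable [IsManifold (𝓡 n) ∞ M]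
  (g : ContMDiffRiemannianMetric (𝓡 n) ∞ (EuclideanSpace ℝ (Fin n))
      (fun x : M ↦ TangentSpace (𝓡 n) x))

theorem prodMetric_eq (q : M × ℝ) (u v : TangentSpace ((𝓡 n).prod 𝓘(ℝ, ℝ)) q) :
    prodMetric g q u v =
      g.inner q.1 (horizontal q u) (horizontal q v) + vertical q u * vertical q v := rfl

theorem eq_of_prodMetric_sub_eq {q : M × ℝ} {u v : TangentSpace ((𝓡 n).prod 𝓘(ℝ, ℝ)) q}
    (h : prodMetric g q u (u - v) = prodMetric g q v (u - v)) : u = v := by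
  have hnorm : g.inner q.1 (horizontal q (u - v)) (horizontal q (u - v))
      + vertical q (u - v) * vertical q (u - v) = 0 := by
    rw [prodMetric_eq, prodMetric_eq] at h
    rw [(horizontal q).map_sub u v, (g.inner q.1).map_sub (horizontal q u), sub_apply,
      ← (horizontal q).map_sub u v]
    linear_combination h + vertical q (u - v) * (vertical q).map_sub u v
  have hhor : horizontal q (u - v) = 0 := by
    by_contra hne
    exact (add_pos_of_pos_of_nonneg (g.pos q.1 _ hne) (mul_self_nonneg _)).ne' hnorm
  rw [hhor, map_zero, zero_add] at hnorm
  exact sub_eq_zero.mp (eq_of_horizontal_vertical (hhor.trans (map_zero _).symm)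
    ((mul_self_eq_zero.mp hnorm).trans (map_zero _).symm))

theorem dt_eq (q : M × ℝ) : dt g q = tangentPair q 0 1 := by
  refine sharp_eq (fun u v h ↦ eq_of_prodMetric_sub_eq g (h _)) fun w ↦ ?_
  rw [prodMetric_eq, horizontal_tangentPair, vertical_tangentPair, map_zero]
  simp [vertical]

theorem angle_eq {S : Type*} (F : S → M × ℝ)
    (N : ∀ x : S, TangentSpace ((𝓡 n).prod 𝓘(ℝ, ℝ)) (F x)) (x : S) :
    angle g F N x = vertical (F x) (N x) := by
  rw [angle, dt_eq, prodMetric_eq, horizontal_tangentPair, vertical_tangentPair, map_zero]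
  simp

section Connection

variable {q₀ : M × ℝ} {y : EuclideanSpace ℝ (Fin n) × ℝ}

theorem coordMetric_prod (hy : y.1 ∈ (extChartAt (𝓡 n) q₀.1).target)
    (u v : EuclideanSpace ℝ (Fin n) × ℝ) :
    coordMetric (prodMetric g) q₀ y u v = metricCoord g q₀.1 y.1 u.1 v.1 + u.2 * v.2 := by
  have hsymm := extChartAt_prod_real_symm q₀ y
  have hq : ((extChartAt ((𝓡 n).prod 𝓘(ℝ, ℝ)) q₀).symm y).1 ∈ (extChartAt (𝓡 n) q₀.1).source := by
    rw [hsymm]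
    exact (extChartAt (𝓡 n) q₀.1).map_target hy
  rw [coordMetric, prodMetric_eq, horizontal_ofCoord hq, horizontal_ofCoord hq,
    vertical_ofCoord hq, vertical_ofCoord hq, hsymm]
  rfl

theorem fderiv_coordMetric_prod (hy : y.1 ∈ (extChartAt (𝓡 n) q₀.1).target)
    (u v w : EuclideanSpace ℝ (Fin n) × ℝ) :
    fderiv ℝ (fun z ↦ coordMetric (prodMetric g) q₀ z u v) y w =
      fderiv ℝ (metricCoord g q₀.1) y.1 w.1 u.1 v.1 := by
  have hcoord : (fun z ↦ coordMetric (prodMetric g) q₀ z u v) =ᶠ[𝓝 y]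
      fun z ↦ metricCoord g q₀.1 z.1 u.1 v.1 + u.2 * v.2 := by
    filter_upwards [continuous_fst.continuousAt.preimage_mem_nhds
      ((isOpen_extChartAt_target q₀.1).mem_nhds hy)] with z hz
    exact coordMetric_prod g hz u v
  have hderiv := ((hasFDerivAt_metricCoord_apply g hy u.1 v.1).comp y
    hasFDerivAt_fst).add_const (u.2 * v.2)
  rw [hcoord.fderiv_eq]
  exact congrArg (fun L : EuclideanSpace ℝ (Fin n) × ℝ →L[ℝ] ℝ ↦ L w) hderiv.fderiv

theorem eq_of_forall_coordMetric_prod_eq (hy : y.1 ∈ (extChartAt (𝓡 n) q₀.1).target)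
    {u v : EuclideanSpace ℝ (Fin n) × ℝ}
    (h : ∀ w, coordMetric (prodMetric g) q₀ y u w = coordMetric (prodMetric g) q₀ y v w) :
    u = v := by
  simp only [coordMetric_prod g hy] at h
  refine Prod.ext (metricCoord_ext g hy fun w ↦ ?_) ?_
  · simpa using h (w, 0)
  · simpa using h (0, 1)

theorem christoffel_prod (hy : y.1 ∈ (extChartAt (𝓡 n) q₀.1).target)
    (u v : EuclideanSpace ℝ (Fin n) × ℝ) :
    christoffel (prodMetric g) q₀ y u v =
      (christoffel (metric g) q₀.1 y.1 u.1 v.1, 0) := by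
  refine sharp_eq (fun _ _ ↦ eq_of_forall_coordMetric_prod_eq g hy) fun w ↦ ?_
  simp only [coordMetric_prod g hy, fderiv_coordMetric_prod g hy, zero_mul, add_zero]
  exact metricCoord_christoffel g hy _ _ _

variable {F : S → M × ℝ} {V : ∀ x : S, TangentSpace ((𝓡 n).prod 𝓘(ℝ, ℝ)) (F x)} {x : S}

theorem mvfderiv_toCoord_prod
    (hV : MDifferentiableAt J ((𝓡 n).prod 𝓘(ℝ, ℝ)).tangent
      (fun y ↦ (⟨F y, V y⟩ : TangentBundle ((𝓡 n).prod 𝓘(ℝ, ℝ)) (M × ℝ))) x)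
    (v : TangentSpace J x) :
    mvfderiv J (fun y ↦ toCoord ((𝓡 n).prod 𝓘(ℝ, ℝ)) (F x) (F y) (V y)) x v =
      (mvfderiv J (fun y ↦ toCoord (𝓡 n) (F x).1 (F y).1 (horizontal (F y) (V y))) x v,
        mvfderiv J (fun y ↦ vertical (F y) (V y)) x v) := by
  obtain ⟨hF, hcoord⟩ := mdifferentiableAt_tangentBundle_iff.mp hV
  have hpair : (fun y ↦ toCoord ((𝓡 n).prod 𝓘(ℝ, ℝ)) (F x) (F y) (V y)) =ᶠ[𝓝 x] fun y ↦
      (toCoord (𝓡 n) (F x).1 (F y).1 (horizontal (F y) (V y)), vertical (F y) (V y)) := by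
    filter_upwards [(continuous_fst.continuousAt.comp hF.continuousAt).preimage_mem_nhds
      (extChartAt_source_mem_nhds (I := 𝓡 n) (F x).1)] with y hy
    exact toCoord_prod hy _
  have hdiff := hpair.mdifferentiableAt_iff.mp hcoord
  refine (congrArg (fun L : E' →L[ℝ] EuclideanSpace ℝ (Fin n) × ℝ ↦ L v)
    hpair.mfderiv_eq).trans ?_
  exact mvfderiv_prodMk (differentiableAt_fst.comp_mdifferentiableAt hdiff)
    (differentiableAt_snd.comp_mdifferentiableAt hdiff) v

theorem covDeriv_prod
    (hV : MDifferentiableAt J ((𝓡 n).prod 𝓘(ℝ, ℝ)).tangent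
      (fun y ↦ (⟨F y, V y⟩ : TangentBundle ((𝓡 n).prod 𝓘(ℝ, ℝ)) (M × ℝ))) x)
    (v : TangentSpace J x) :
    covDeriv J (prodMetric g) F V x v =
      tangentPair (F x)
        (covDeriv J (metric g) (fun y ↦ (F y).1) (fun y ↦ horizontal (F y) (V y)) x v)
        (mvfderiv J (fun y ↦ vertical (F y) (V y)) x v) := by
  have hs := mem_extChartAt_source (I := 𝓡 n) (F x).1
  have ht := mem_extChartAt_target (I := 𝓡 n) (F x).1
  unfold covDeriv
  rw [extChartAt_prod_real, christoffel_prod g ht, toCoord_prod hs, toCoord_prod hs,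
    horizontal_mfderiv (mdifferentiableAt_tangentBundle_iff.mp hV).1, mvfderiv_toCoord_prod hV]
  refine eq_of_horizontal_vertical ((horizontal_ofCoord hs _).trans ?_)
    ((vertical_ofCoord hs _).trans ?_)
  · rw [horizontal_tangentPair]; rfl
  · rw [vertical_tangentPair]; exact add_zero _

end Connection

end Product

/-! ### Hypersurfaces of `M × ℝ` -/

section Hypersurface

variable {n : ℕ} {M : Type*} [TopologicalSpace M] [ChartedSpace (EuclideanSpace ℝ (Fin n)) M]
  [IsManifold (𝓡 n) ∞ M]
  {g : ContMDiffRiemannianMetric (𝓡 n) ∞ (EuclideanSpace ℝ (Fin n))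
      (fun x : M ↦ TangentSpace (𝓡 n) x)}
  {E' : Type*} [NormedAddCommGroup E'] [NormedSpace ℝ E']
  {H' : Type*} [TopologicalSpace H'] {J : ModelWithCorners ℝ E' H'}
  {S : Type*} [TopologicalSpace S] [ChartedSpace H' S]
  {F : S → M × ℝ} {N : ∀ x : S, TangentSpace ((𝓡 n).prod 𝓘(ℝ, ℝ)) (F x)} {x : S}

namespace IsUnitNormal

theorem contMDiff_map (hN : IsUnitNormal J (prodMetric g) F N) :
    ContMDiff J ((𝓡 n).prod 𝓘(ℝ, ℝ)) ∞ F :=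
  fun x ↦ (contMDiffAt_tangentBundle_iff.mp (hN.smooth x)).1

theorem contMDiff_base (hN : IsUnitNormal J (prodMetric g) F N) :
    ContMDiff J (𝓡 n) ∞ (fun x ↦ (F x).1) := contMDiff_fst.comp hN.contMDiff_map

theorem contMDiff_height (hN : IsUnitNormal J (prodMetric g) F N) :
    ContMDiff J 𝓘(ℝ, ℝ) ∞ (height F) := contMDiff_snd.comp hN.contMDiff_map

theorem contMDiff_horizontal (hN : IsUnitNormal J (prodMetric g) F N) :
    ContMDiff J (𝓡 n).tangent ∞
      (fun x ↦ (⟨(F x).1, horizontal (F x) (N x)⟩ : TangentBundle (𝓡 n) M)) :=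
  (contMDiff_fst.contMDiff_tangentMap le_rfl).comp hN.smooth

theorem contMDiff_vertical (hN : IsUnitNormal J (prodMetric g) F N) :
    ContMDiff J 𝓘(ℝ, ℝ) ∞ (fun x ↦ vertical (F x) (N x)) := by
  have htangent : ContMDiff J 𝓘(ℝ, ℝ).tangent ∞
      (fun x ↦ (⟨(F x).2, vertical (F x) (N x)⟩ : TangentBundle 𝓘(ℝ, ℝ) ℝ)) :=
    (contMDiff_snd.contMDiff_tangentMap le_rfl).comp hN.smooth
  have htoCoord (a b : ℝ) (v : TangentSpace 𝓘(ℝ, ℝ) b) : toCoord 𝓘(ℝ, ℝ) a b v = v := by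
    rw [toCoord, extChartAt_model_space_eq_id]
    exact congrArg (fun L : ℝ →L[ℝ] ℝ ↦ L v) (mfderiv_id (I := 𝓘(ℝ, ℝ)) (x := b))
  intro x
  exact (contMDiffAt_tangentBundle_iff.mp (htangent x)).2.congr_of_eventuallyEq
    (.of_forall fun z ↦ (htoCoord _ _ _).symm)

theorem mdifferentiableAt_map (hN : IsUnitNormal J (prodMetric g) F N) (x : S) :
    MDifferentiableAt J ((𝓡 n).prod 𝓘(ℝ, ℝ)) F x :=
  hN.contMDiff_map.mdifferentiableAt (by simp)

theorem mdifferentiableAt_base (hN : IsUnitNormal J (prodMetric g) F N) (x : S) :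
    MDifferentiableAt J (𝓡 n) (fun x ↦ (F x).1) x :=
  hN.contMDiff_base.mdifferentiableAt (by simp)

theorem mdifferentiableAt_height (hN : IsUnitNormal J (prodMetric g) F N) (x : S) :
    MDifferentiableAt J 𝓘(ℝ, ℝ) (height F) x :=
  hN.contMDiff_height.mdifferentiableAt (by simp)

theorem mdifferentiableAt_horizontal (hN : IsUnitNormal J (prodMetric g) F N) (x : S) :
    MDifferentiableAt J (𝓡 n).tangent
      (fun x ↦ (⟨(F x).1, horizontal (F x) (N x)⟩ : TangentBundle (𝓡 n) M)) x :=
  hN.contMDiff_horizontal.mdifferentiableAt (by simp)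

theorem mdifferentiableAt_vertical (hN : IsUnitNormal J (prodMetric g) F N) (x : S) :
    MDifferentiableAt J 𝓘(ℝ, ℝ) (fun x ↦ vertical (F x) (N x)) x :=
  hN.contMDiff_vertical.mdifferentiableAt (by simp)

theorem inner_add_vertical_mul_mvfderiv_height (hN : IsUnitNormal J (prodMetric g) F N) (x : S)
    (v : TangentSpace J x) :
    g.inner (F x).1 (horizontal (F x) (N x)) (mfderiv J (𝓡 n) (fun y ↦ (F y).1) x v)
      + vertical (F x) (N x) * mvfderiv J (height F) x v = 0 := by
  have hnormal := hN.normal x v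
  rwa [prodMetric_eq, horizontal_mfderiv (hN.mdifferentiableAt_map x),
    vertical_mfderiv (hN.mdifferentiableAt_map x)] at hnormal

theorem inner_horizontal_add_vertical_mul_self (hN : IsUnitNormal J (prodMetric g) F N) (x : S) :
    g.inner (F x).1 (horizontal (F x) (N x)) (horizontal (F x) (N x))
      + vertical (F x) (N x) * vertical (F x) (N x) = 1 := hN.unit x

theorem injective_mfderiv_of_base (hN : IsUnitNormal J (prodMetric g) F N)
    (hbase : Function.Injective (mfderiv J (𝓡 n) (fun y ↦ (F y).1) x)) :
    Function.Injective (mfderiv J ((𝓡 n).prod 𝓘(ℝ, ℝ)) F x) := by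
  intro v w hvw
  apply hbase
  rw [← horizontal_mfderiv (hN.mdifferentiableAt_map x),
    ← horizontal_mfderiv (hN.mdifferentiableAt_map x), hvw]

theorem injective_mfderiv_base (hN : IsUnitNormal J (prodMetric g) F N)
    (hF : Function.Injective (mfderiv J ((𝓡 n).prod 𝓘(ℝ, ℝ)) F x))
    (hθ : vertical (F x) (N x) ≠ 0) :
    Function.Injective (mfderiv J (𝓡 n) (fun y ↦ (F y).1) x) := by
  rw [injective_iff_map_eq_zero]
  intro v hv
  have hnormal := hN.inner_add_vertical_mul_mvfderiv_height x v
  rw [hv, map_zero, zero_add] at hnormal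
  have hheight : mvfderiv J (height F) x v = 0 := (mul_eq_zero.1 hnormal).resolve_left hθ
  refine (injective_iff_map_eq_zero _).1 hF v (eq_of_horizontal_vertical ?_ ?_)
  · rw [horizontal_mfderiv (hN.mdifferentiableAt_map x), hv, map_zero]
  · rw [vertical_mfderiv (hN.mdifferentiableAt_map x), map_zero]
    exact hheight

section GradHeight

variable {z : TangentSpace J x}

theorem mvfderiv_height_of_mfderiv_base_eq (hN : IsUnitNormal J (prodMetric g) F N)
    (hθ : vertical (F x) (N x) ≠ 0)
    (hz : mfderiv J (𝓡 n) (fun y ↦ (F y).1) x z =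
      -vertical (F x) (N x) • horizontal (F x) (N x)) :
    mvfderiv J (height F) x z = 1 - vertical (F x) (N x) ^ 2 := by
  have hnormal := hN.inner_add_vertical_mul_mvfderiv_height x z
  rw [hz, map_smul, smul_eq_mul] at hnormal
  refine mul_left_cancel₀ hθ ?_
  linear_combination
    hnormal + vertical (F x) (N x) * hN.inner_horizontal_add_vertical_mul_self x

theorem gradHeight_eq (hN : IsUnitNormal J (prodMetric g) F N)
    (hbase : Function.Injective (mfderiv J (𝓡 n) (fun y ↦ (F y).1) x))
    (hθ : vertical (F x) (N x) ≠ 0)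
    (hz : mfderiv J (𝓡 n) (fun y ↦ (F y).1) x z =
      -vertical (F x) (N x) • horizontal (F x) (N x)) :
    gradHeight J g F x = z := by
  refine sharp_eq (fun u v h ↦ ?_) fun w ↦ ?_
  · have hsub := h (u - v)
    rw [inducedMetric, inducedMetric, map_sub] at hsub
    exact hN.injective_mfderiv_of_base hbase (eq_of_prodMetric_sub_eq g hsub)
  · rw [inducedMetric, prodMetric_eq, horizontal_mfderiv (hN.mdifferentiableAt_map x),
      horizontal_mfderiv (hN.mdifferentiableAt_map x),
      vertical_mfderiv (hN.mdifferentiableAt_map x), vertical_mfderiv (hN.mdifferentiableAt_map x),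
      hz, map_smul, smul_apply, smul_eq_mul]
    change _ + mvfderiv J (height F) x z * mvfderiv J (height F) x w = _
    rw [hN.mvfderiv_height_of_mfderiv_base_eq hθ hz]
    linear_combination
      -vertical (F x) (N x) * hN.inner_add_vertical_mul_mvfderiv_height x w

end GradHeight

theorem hasPrincipalCurvature_iff (hN : IsUnitNormal J (prodMetric g) F N) (x : S)
    (v : TangentSpace J x) (κ : ℝ) :
    HasPrincipalCurvature g F N x v κ ↔ v ≠ 0 ∧
      -covDeriv J (metric g) (fun y ↦ (F y).1) (fun y ↦ horizontal (F y) (N y)) x v =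
        κ • mfderiv J (𝓡 n) (fun y ↦ (F y).1) x v ∧
      -mvfderiv J (fun y ↦ vertical (F y) (N y)) x v = κ * mvfderiv J (height F) x v := by
  have hF := hN.mdifferentiableAt_map x
  have hheight : vertical (F x) (mfderiv J ((𝓡 n).prod 𝓘(ℝ, ℝ)) F x v) =
      mvfderiv J (height F) x v := vertical_mfderiv hF v
  have hcov := covDeriv_prod g (hN.smooth.mdifferentiableAt (by simp)) v
  rw [HasPrincipalCurvature, shapeOperator, hcov, ← horizontal_mfderiv hF, ← hheight]
  refine and_congr_right fun _ ↦
    ⟨fun h ↦ ⟨?_, ?_⟩, fun h ↦ eq_of_horizontal_vertical ?_ ?_⟩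
  · simpa only [map_neg, horizontal_tangentPair, map_smul] using congrArg (horizontal (F x)) h
  · simpa only [map_neg, vertical_tangentPair, map_smul, smul_eq_mul] using
      congrArg (vertical (F x)) h
  · simpa only [map_neg, horizontal_tangentPair, map_smul] using h.1
  · simpa only [map_neg, vertical_tangentPair, map_smul, smul_eq_mul] using h.2

end IsUnitNormal

end Hypersurface

/-! ### Parallel families -/

section Parallel

variable {n : ℕ} {M : Type*} [TopologicalSpace M] [ChartedSpace (EuclideanSpace ℝ (Fin n)) M]
  [IsManifold (𝓡 n) ∞ M]
  {g : ContMDiffRiemannianMetric (𝓡 n) ∞ (EuclideanSpace ℝ (Fin n))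
      (fun x : M ↦ TangentSpace (𝓡 n) x)}
  {P : Type*} [TopologicalSpace P] [ChartedSpace (EuclideanSpace ℝ (Fin (n - 1))) P]
  {T : Set ℝ} {f : ℝ → P → M} {η : ∀ p : P, TangentSpace (𝓡 n) (f 0 p)}

theorem eq_of_hasDerivAt_zero {T : Set ℝ} (hT : IsOpen T) (hTconn : T.OrdConnected) {φ : ℝ → ℝ}
    (hφ : ∀ s ∈ T, HasDerivAt φ 0 s) {s t : ℝ} (hs : s ∈ T) (ht : t ∈ T) : φ s = φ t :=
  hT.is_const_of_deriv_eq_zero hTconn.isPreconnected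
    (fun r hr ↦ (hφ r hr).differentiableAt.differentiableWithinAt)
    (fun r hr ↦ (hφ r hr).deriv) hs ht

namespace IsParallelFamily

theorem inner_velocity_self (hP : IsParallelFamily g T f η) (p : P) {s : ℝ} (hs : s ∈ T) :
    g.inner (f s p) (mfderiv 𝓘(ℝ, ℝ) (𝓡 n) (fun s ↦ f s p) s (1 : ℝ))
      (mfderiv 𝓘(ℝ, ℝ) (𝓡 n) (fun s ↦ f s p) s (1 : ℝ)) = 1 := by
  refine (eq_of_hasDerivAt_zero hP.isOpen hP.ordConnected
    (fun r hr ↦ (hP.geodesic p).hasDerivAt_speed hP.isOpen hr) hs hP.zero_mem).trans ?_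
  have hunit := hP.unitNormal.unit p
  rw [← hP.velocity p] at hunit
  exact hunit

theorem inner_velocity_mfderiv [IsManifold (𝓡 (n - 1)) ∞ P] (hP : IsParallelFamily g T f η)
    (p : P) (v : TangentSpace (𝓡 (n - 1)) p) {s : ℝ} (hs : s ∈ T) :
    g.inner (f s p) (mfderiv 𝓘(ℝ, ℝ) (𝓡 n) (fun s ↦ f s p) s (1 : ℝ))
      (mfderiv (𝓡 (n - 1)) (𝓡 n) (f s) p v) = 0 := by
  refine (eq_of_hasDerivAt_zero hP.isOpen hP.ordConnected
    (fun r hr ↦ hasDerivAt_gauss g hP.isOpen hP.smooth hP.geodesic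
      (fun p s hs ↦ hP.inner_velocity_self p hs) p v hr) hs hP.zero_mem).trans ?_
  have hnormal := hP.unitNormal.normal p v
  rw [← hP.velocity p] at hnormal
  exact hnormal

end IsParallelFamily

end Parallel

theorem exists_eq_add_smul_of_finrank {K V₁ V : Type*} [Field K] [AddCommGroup V₁] [Module K V₁]
    [FiniteDimensional K V₁] [AddCommGroup V] [Module K V] [FiniteDimensional K V]
    {L : V₁ →ₗ[K] V} (hL : Function.Injective L)
    (hdim : Module.finrank K V₁ + 1 = Module.finrank K V) {ℓ : V →ₗ[K] K} (hℓ : ∀ v, ℓ (L v) = 0)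
    {u : V} (hu : ℓ u = 1) (w : V) : ∃ v, w = L v + ℓ w • u := by
  have hker : LinearMap.range L = LinearMap.ker ℓ := by
    refine Submodule.eq_of_le_of_finrank_eq (LinearMap.range_le_ker_iff.2 (LinearMap.ext hℓ)) ?_
    have hrange : LinearMap.range ℓ = ⊤ :=
      LinearMap.range_eq_top.2 fun c ↦ ⟨c • u, by rw [map_smul, hu, smul_eq_mul, mul_one]⟩
    have hrank := LinearMap.finrank_range_add_finrank_ker ℓ
    rw [hrange, finrank_top, Module.finrank_self] at hrank
    rw [LinearMap.finrank_range_of_inj hL]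
    omega
  obtain ⟨v, hv⟩ : w - ℓ w • u ∈ LinearMap.range L := by
    rw [hker, LinearMap.mem_ker, map_sub, map_smul, hu, smul_eq_mul, mul_one, sub_self]
  exact ⟨v, by rw [hv, sub_add_cancel]⟩

section Congr

variable {E : Type*} [NormedAddCommGroup E] [NormedSpace ℝ E]
  {H : Type*} [TopologicalSpace H] {I : ModelWithCorners ℝ E H}
  {X : Type*} [TopologicalSpace X] [ChartedSpace H X]
  {E' : Type*} [NormedAddCommGroup E'] [NormedSpace ℝ E']
  {H' : Type*} [TopologicalSpace H'] {J : ModelWithCorners ℝ E' H'}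
  {S : Type*} [TopologicalSpace S] [ChartedSpace H' S]
  {h : ∀ x : X, TangentSpace I x → TangentSpace I x → ℝ}

theorem metric_congr {y y' : X} (hy : y = y') {u v : TangentSpace I y} {u' v' : TangentSpace I y'}
    (hu : (u : E) = u') (hv : (v : E) = v') : h y u v = h y' u' v' := by
  subst hy
  exact congrArg₂ (h y) hu hv

theorem covDeriv_congr_map {F F' : S → X} {V : ∀ x, TangentSpace I (F x)}
    {V' : ∀ x, TangentSpace I (F' x)} {x : S} (hF : F =ᶠ[𝓝 x] F')
    (hV : ∀ᶠ y in 𝓝 x, (V y : E) = V' y) (v : TangentSpace J x) :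
    (covDeriv J h F V x v : E) = covDeriv J h F' V' x v := by
  let coord (x₀ y : X) (u : E) : E := toCoord I x₀ y u
  let connection (y : X) (d w u : E) : E :=
    ofCoord I y y (d + christoffel h y (extChartAt I y y) (coord y y w) (coord y y u))
  have hcoord : (fun y ↦ coord (F x) (F y) (V y)) =ᶠ[𝓝 x] fun y ↦ coord (F' x) (F' y) (V' y) := by
    rw [hF.self_of_nhds]
    filter_upwards [hF, hV] with y hFy hVy
    rw [hFy]
    exact congrArg (coord (F' x) (F' y)) hVy
  have hderiv : (mvfderiv J (fun y ↦ coord (F x) (F y) (V y)) x v : E) =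
      mvfderiv J (fun y ↦ coord (F' x) (F' y) (V' y)) x v :=
    congrArg (fun L : E' →L[ℝ] E ↦ L v) hcoord.mfderiv_eq
  have hvelocity : (mfderiv J I F x v : E) = mfderiv J I F' x v :=
    congrArg (fun L : E' →L[ℝ] E ↦ L v) hF.mfderiv_eq
  have hconnection : ∀ {y y' : X} {d d' w w' u u' : E}, y = y' → d = d' → w = w' → u = u' →
      connection y d w u = connection y' d' w' u' := by
    rintro y _ d _ w _ u _ rfl rfl rfl rfl
    rfl
  exact hconnection hF.self_of_nhds hderiv hvelocity hV.self_of_nhds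

end Congr

/-! ### Graphs over parallel families -/

theorem hasDerivAt_neg_mul_of_sq_mul_one_add_sq_eq_one {b θ : ℝ → ℝ} {θ' s : ℝ}
    (hb : DifferentiableAt ℝ b s) (hθ : HasDerivAt θ θ' s) (hbs : b s ≠ 0)
    (hunit : ∀ᶠ r in 𝓝 s, θ r ^ 2 * (1 + b r ^ 2) = 1) :
    HasDerivAt (fun r ↦ -b r * θ r) (θ' / b s) s := by
  have hprod := hb.neg.hasDerivAt.mul hθ
  refine hprod.congr_deriv ?_
  have hconst : HasDerivAt (fun r ↦ (-b r * θ r) ^ 2 + θ r ^ 2) 0 s :=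
    (hasDerivAt_const s (1 : ℝ)).congr_of_eventuallyEq
      (hunit.mono fun r hr ↦ by linear_combination hr)
  have hderiv := hconst.unique ((hprod.pow 2).add (hθ.pow 2))
  have hθs : θ s ≠ 0 := fun h ↦ by simpa [h] using hunit.self_of_nhds
  simp only [Pi.mul_apply, Pi.neg_apply, Nat.cast_ofNat, Nat.add_one_sub_one, pow_one] at hderiv ⊢
  rw [eq_div_iff hbs]
  refine mul_left_cancel₀ hθs ?_
  linear_combination hderiv / 2

theorem mul_pos_of_continuous_of_ne_zero {X : Type*} [TopologicalSpace X] {φ : X → ℝ}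
    (hφ : Continuous φ) (hne : ∀ x, φ x ≠ 0) (hX : PreconnectedSpace X ∨ ∀ x, 0 < φ x) (x y : X) :
    0 < φ x * φ y := by
  rcases hX with hX | hpos
  · by_contra! hneg
    suffices hzero : (0 : ℝ) ∈ range φ from hzero.elim hne
    rcases mul_nonpos_iff.1 hneg with hxy | hxy
    · exact mem_range_of_exists_le_of_exists_ge hφ ⟨y, hxy.2⟩ ⟨x, hxy.1⟩
    · exact mem_range_of_exists_le_of_exists_ge hφ ⟨x, hxy.1⟩ ⟨y, hxy.2⟩
  · exact mul_pos (hpos x) (hpos y)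

section Graph

variable {n : ℕ} {M : Type*} [TopologicalSpace M] [ChartedSpace (EuclideanSpace ℝ (Fin n)) M]
  [IsManifold (𝓡 n) ∞ M]
  {g : ContMDiffRiemannianMetric (𝓡 n) ∞ (EuclideanSpace ℝ (Fin n))
      (fun x : M ↦ TangentSpace (𝓡 n) x)}
  {E' : Type*} [NormedAddCommGroup E'] [NormedSpace ℝ E']
  {H' : Type*} [TopologicalSpace H'] {J : ModelWithCorners ℝ E' H'}
  {S : Type*} [TopologicalSpace S] [ChartedSpace H' S]
  {F : S → M × ℝ} {N : ∀ x : S, TangentSpace ((𝓡 n).prod 𝓘(ℝ, ℝ)) (F x)}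
  {P : Type*} [TopologicalSpace P] [ChartedSpace (EuclideanSpace ℝ (Fin (n - 1))) P]
  {T : Set ℝ} {f : ℝ → P → M} {η : ∀ p : P, TangentSpace (𝓡 n) (f 0 p)} {a : ℝ → ℝ}
  {Ψ : PartialDiffeomorph ((𝓡 (n - 1)).prod 𝓘(ℝ, ℝ)) J (P × ℝ) S ∞} {s : ℝ}

/-- The velocity in `S` of the parameter curve `s ↦ Ψ (p, s)`. -/
def graphVelocity (J : ModelWithCorners ℝ E' H') (Ψ : P × ℝ → S) (p : P) (s : ℝ) :
    TangentSpace J (Ψ (p, s)) :=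
  mfderiv 𝓘(ℝ, ℝ) J (fun r ↦ Ψ (p, r)) s (1 : ℝ)

/-- The velocity of the projection to `M` of the parameter curve `s ↦ Ψ (p, s)`. On an
`(f_s, a)`-graph it is the velocity of the geodesic `s ↦ f s p`, but based at `F (Ψ (p, s))`. -/
def baseVelocity (F : S → M × ℝ) (Ψ : P × ℝ → S) (p : P) (s : ℝ) :
    TangentSpace (𝓡 n) (F (Ψ (p, s))).1 :=
  mfderiv 𝓘(ℝ, ℝ) (𝓡 n) (fun r ↦ (F (Ψ (p, r))).1) s (1 : ℝ)

/-- The hypersurface `F`, with unit normal `N`, is parametrized by `Ψ` as an `(f_s, a)`-graph: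
this is `IsGraphOn` with the parametrization made explicit. -/
structure IsGraphParam (g : ContMDiffRiemannianMetric (𝓡 n) ∞ (EuclideanSpace ℝ (Fin n))
      (fun x : M ↦ TangentSpace (𝓡 n) x)) (T : Set ℝ) (f : ℝ → P → M)
    (η : ∀ p : P, TangentSpace (𝓡 n) (f 0 p)) (a : ℝ → ℝ) (F : S → M × ℝ)
    (N : ∀ x : S, TangentSpace ((𝓡 n).prod 𝓘(ℝ, ℝ)) (F x))
    (Ψ : PartialDiffeomorph ((𝓡 (n - 1)).prod 𝓘(ℝ, ℝ)) J (P × ℝ) S ∞) : Prop where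
  unitNormal : IsUnitNormal J (prodMetric g) F N
  parallel : IsParallelFamily g T f η
  smooth : ContDiffOn ℝ ∞ a T
  deriv_pos : ∀ s ∈ T, 0 < deriv a s
  source : Ψ.source = univ ×ˢ T
  map_eq : ∀ p, ∀ s ∈ T, F (Ψ (p, s)) = (f s p, a s)

namespace IsGraphParam

theorem contMDiffAt (hG : IsGraphParam g T f η a F N Ψ) (p : P) (hs : s ∈ T) :
    ContMDiffAt ((𝓡 (n - 1)).prod 𝓘(ℝ, ℝ)) J ∞ Ψ (p, s) := by
  refine Ψ.contMDiffOn_toFun.contMDiffAt (Ψ.open_source.mem_nhds ?_)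
  rw [hG.source]
  exact ⟨mem_univ p, hs⟩

theorem contMDiffAt_curve (hG : IsGraphParam g T f η a F N Ψ) (p : P) (hs : s ∈ T) :
    ContMDiffAt 𝓘(ℝ, ℝ) J ∞ (fun r ↦ Ψ (p, r)) s :=
  (hG.contMDiffAt p hs).comp s (contMDiffAt_const.prodMk contMDiffAt_id)

theorem mdifferentiableAt_curve (hG : IsGraphParam g T f η a F N Ψ) (p : P) (hs : s ∈ T) :
    MDifferentiableAt 𝓘(ℝ, ℝ) J (fun r ↦ Ψ (p, r)) s :=
  (hG.contMDiffAt_curve p hs).mdifferentiableAt (by simp)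

theorem mdifferentiableAt_slice (hG : IsGraphParam g T f η a F N Ψ) (p : P) (hs : s ∈ T) :
    MDifferentiableAt (𝓡 (n - 1)) J (fun p ↦ Ψ (p, s)) p :=
  ((hG.contMDiffAt p hs).comp p (contMDiffAt_id.prodMk contMDiffAt_const)).mdifferentiableAt
    (by simp)

theorem mfderiv_base_graphVelocity (hG : IsGraphParam g T f η a F N Ψ) (p : P) (hs : s ∈ T) :
    mfderiv J (𝓡 n) (fun y ↦ (F y).1) (Ψ (p, s)) (graphVelocity J Ψ p s) =
      baseVelocity F Ψ p s :=
  (mfderiv_comp_apply s (hG.unitNormal.mdifferentiableAt_base _)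
    (hG.mdifferentiableAt_curve p hs) (1 : ℝ)).symm

theorem curve_eventuallyEq_base (hG : IsGraphParam g T f η a F N Ψ) (p : P) (hs : s ∈ T) :
    (fun r ↦ f r p) =ᶠ[𝓝 s] fun r ↦ (F (Ψ (p, r))).1 := by
  filter_upwards [hG.parallel.isOpen.mem_nhds hs] with r hr
  rw [hG.map_eq p r hr]

theorem velocity_eq_baseVelocity (hG : IsGraphParam g T f η a F N Ψ) (p : P) (hs : s ∈ T) :
    (mfderiv 𝓘(ℝ, ℝ) (𝓡 n) (fun r ↦ f r p) s (1 : ℝ) : EuclideanSpace ℝ (Fin n)) =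
      baseVelocity F Ψ p s :=
  congrArg (fun L : ℝ →L[ℝ] EuclideanSpace ℝ (Fin n) ↦ L 1)
    (hG.curve_eventuallyEq_base p hs).mfderiv_eq

theorem inner_baseVelocity_self (hG : IsGraphParam g T f η a F N Ψ) (p : P) (hs : s ∈ T) :
    g.inner (F (Ψ (p, s))).1 (baseVelocity F Ψ p s) (baseVelocity F Ψ p s) = 1 :=
  (metric_congr (h := metric g) (hG.curve_eventuallyEq_base p hs).self_of_nhds
    (hG.velocity_eq_baseVelocity p hs) (hG.velocity_eq_baseVelocity p hs)).symm.trans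
    (hG.parallel.inner_velocity_self p hs)

theorem covDeriv_baseVelocity (hG : IsGraphParam g T f η a F N Ψ) (p : P) (hs : s ∈ T) :
    covDeriv 𝓘(ℝ, ℝ) (metric g) (fun r ↦ (F (Ψ (p, r))).1) (baseVelocity F Ψ p) s (1 : ℝ) = 0 :=
  (covDeriv_congr_map (hG.curve_eventuallyEq_base p hs)
    ((hG.parallel.isOpen.eventually_mem hs).mono fun _ hr ↦ hG.velocity_eq_baseVelocity p hr)
    (1 : ℝ)).symm.trans ((hG.parallel.geodesic p).2 s hs)

theorem mfderiv_base_slice (hG : IsGraphParam g T f η a F N Ψ) (p : P)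
    (v : TangentSpace (𝓡 (n - 1)) p) (hs : s ∈ T) :
    (mfderiv J (𝓡 n) (fun y ↦ (F y).1) (Ψ (p, s))
      (mfderiv (𝓡 (n - 1)) J (fun p ↦ Ψ (p, s)) p v) : EuclideanSpace ℝ (Fin n)) =
      mfderiv (𝓡 (n - 1)) (𝓡 n) (f s) p v := by
  have hslice : (fun q ↦ (F (Ψ (q, s))).1) = f s := funext fun q ↦ by rw [hG.map_eq q s hs]
  refine (mfderiv_comp_apply p (hG.unitNormal.mdifferentiableAt_base _)
    (hG.mdifferentiableAt_slice p hs) v).symm.trans ?_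
  exact congrArg (fun φ : P → M ↦
    (mfderiv (𝓡 (n - 1)) (𝓡 n) φ p v : EuclideanSpace ℝ (Fin n))) hslice

theorem inner_baseVelocity_slice [IsManifold (𝓡 (n - 1)) ∞ P]
    (hG : IsGraphParam g T f η a F N Ψ) (p : P) (v : TangentSpace (𝓡 (n - 1)) p) (hs : s ∈ T) :
    g.inner (F (Ψ (p, s))).1 (baseVelocity F Ψ p s)
      (mfderiv J (𝓡 n) (fun y ↦ (F y).1) (Ψ (p, s))
        (mfderiv (𝓡 (n - 1)) J (fun p ↦ Ψ (p, s)) p v)) = 0 :=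
  (metric_congr (h := metric g) (hG.curve_eventuallyEq_base p hs).self_of_nhds
    (hG.velocity_eq_baseVelocity p hs) (hG.mfderiv_base_slice p v hs).symm).symm.trans
    (hG.parallel.inner_velocity_mfderiv p v hs)

theorem mvfderiv_height_slice (hG : IsGraphParam g T f η a F N Ψ) (p : P)
    (v : TangentSpace (𝓡 (n - 1)) p) (hs : s ∈ T) :
    mvfderiv J (height F) (Ψ (p, s)) (mfderiv (𝓡 (n - 1)) J (fun p ↦ Ψ (p, s)) p v) = 0 := by
  have hslice : (fun q ↦ height F (Ψ (q, s))) = fun _ ↦ a s :=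
    funext fun q ↦ by rw [height, hG.map_eq q s hs]
  refine (mfderiv_comp_apply p (hG.unitNormal.mdifferentiableAt_height _)
    (hG.mdifferentiableAt_slice p hs) v).symm.trans ?_
  change mvfderiv (𝓡 (n - 1)) (fun q ↦ height F (Ψ (q, s))) p v = 0
  rw [hslice, mvfderiv_const, zero_apply]

theorem mvfderiv_height_graphVelocity (hG : IsGraphParam g T f η a F N Ψ) (p : P) (hs : s ∈ T) :
    mvfderiv J (height F) (Ψ (p, s)) (graphVelocity J Ψ p s) = deriv a s := by
  have hcurve : (fun r ↦ height F (Ψ (p, r))) =ᶠ[𝓝 s] a := by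
    filter_upwards [hG.parallel.isOpen.mem_nhds hs] with r hr
    rw [height, hG.map_eq p r hr]
  exact (mfderiv_comp_apply s (hG.unitNormal.mdifferentiableAt_height _)
    (hG.mdifferentiableAt_curve p hs) (1 : ℝ)).symm.trans
      (mvfderiv_real_one.trans hcurve.deriv_eq)

theorem graphVelocity_ne_zero (hG : IsGraphParam g T f η a F N Ψ) (p : P) (hs : s ∈ T) :
    graphVelocity J Ψ p s ≠ 0 := fun hzero ↦ by
  have hheight := hG.mvfderiv_height_graphVelocity p hs
  rw [hzero, map_zero] at hheight
  exact (hG.deriv_pos s hs).ne hheight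

theorem hasDerivAt_vertical_normal (hG : IsGraphParam g T f η a F N Ψ) (p : P) (hs : s ∈ T) :
    HasDerivAt (fun r ↦ vertical (F (Ψ (p, r))) (N (Ψ (p, r))))
      (mvfderiv J (fun y ↦ vertical (F y) (N y)) (Ψ (p, s)) (graphVelocity J Ψ p s)) s := by
  have hsmooth := (hG.unitNormal.contMDiff_vertical (Ψ (p, s))).comp s (hG.contMDiffAt_curve p hs)
  refine (hsmooth.contDiffAt.differentiableAt (by simp)).hasDerivAt.congr_deriv ?_
  exact mvfderiv_real_one.symm.trans (mfderiv_comp_apply s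
    (hG.unitNormal.mdifferentiableAt_vertical _) (hG.mdifferentiableAt_curve p hs) (1 : ℝ))

variable [IsManifold (𝓡 (n - 1)) ∞ P]

theorem exists_eq_slice_add_smul_baseVelocity (hn : 1 ≤ n) (hG : IsGraphParam g T f η a F N Ψ)
    (p : P) (hs : s ∈ T) (w : TangentSpace (𝓡 n) (F (Ψ (p, s))).1) :
    ∃ v : TangentSpace (𝓡 (n - 1)) p, w =
      mfderiv J (𝓡 n) (fun y ↦ (F y).1) (Ψ (p, s))
        (mfderiv (𝓡 (n - 1)) J (fun p ↦ Ψ (p, s)) p v) +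
      g.inner (F (Ψ (p, s))).1 (baseVelocity F Ψ p s) w • baseVelocity F Ψ p s := by
  let L : EuclideanSpace ℝ (Fin (n - 1)) →L[ℝ] EuclideanSpace ℝ (Fin n) :=
    (mfderiv J (𝓡 n) (fun y ↦ (F y).1) (Ψ (p, s))).comp
      (mfderiv (𝓡 (n - 1)) J (fun p ↦ Ψ (p, s)) p)
  let ℓ : EuclideanSpace ℝ (Fin n) →L[ℝ] ℝ :=
    g.inner (F (Ψ (p, s))).1 (baseVelocity F Ψ p s)
  have hL : Function.Injective L := fun v w hvw ↦ (hG.parallel.immersion s hs).injective p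
    ((hG.mfderiv_base_slice p v hs).symm.trans (hvw.trans (hG.mfderiv_base_slice p w hs)))
  have hdim : Module.finrank ℝ (EuclideanSpace ℝ (Fin (n - 1))) + 1 =
      Module.finrank ℝ (EuclideanSpace ℝ (Fin n)) := by
    rw [finrank_euclideanSpace_fin, finrank_euclideanSpace_fin, Nat.sub_add_cancel hn]
  exact exists_eq_add_smul_of_finrank (L := L.toLinearMap) hL hdim (ℓ := ℓ.toLinearMap)
    (fun v ↦ hG.inner_baseVelocity_slice p v hs) (hG.inner_baseVelocity_self p hs) w

theorem injective_mfderiv_base [FiniteDimensional ℝ E'] (hdim : Module.finrank ℝ E' = n)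
    (hn : 1 ≤ n) (hG : IsGraphParam g T f η a F N Ψ) (p : P) (hs : s ∈ T) :
    Function.Injective (mfderiv J (𝓡 n) (fun y ↦ (F y).1) (Ψ (p, s))) := by
  let L : E' →L[ℝ] EuclideanSpace ℝ (Fin n) := mfderiv J (𝓡 n) (fun y ↦ (F y).1) (Ψ (p, s))
  have hsurj : Function.Surjective L := fun w ↦ by
    obtain ⟨v, hv⟩ := hG.exists_eq_slice_add_smul_baseVelocity hn p hs w
    rw [← hG.mfderiv_base_graphVelocity p hs, ← map_smul, ← map_add] at hv
    exact ⟨_, hv.symm⟩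
  exact (LinearMap.injective_iff_surjective_of_finrank_eq_finrank (f := L.toLinearMap)
    (hdim.trans finrank_euclideanSpace_fin.symm)).2 hsurj

theorem horizontal_normal_eq (hn : 1 ≤ n) (hG : IsGraphParam g T f η a F N Ψ) (p : P)
    (hs : s ∈ T) :
    horizontal (F (Ψ (p, s))) (N (Ψ (p, s))) =
      (-deriv a s * vertical (F (Ψ (p, s))) (N (Ψ (p, s)))) • baseVelocity F Ψ p s := by
  obtain ⟨v, hv⟩ := hG.exists_eq_slice_add_smul_baseVelocity hn p hs
    (horizontal (F (Ψ (p, s))) (N (Ψ (p, s))))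
  set w := mfderiv J (𝓡 n) (fun y ↦ (F y).1) (Ψ (p, s))
    (mfderiv (𝓡 (n - 1)) J (fun p ↦ Ψ (p, s)) p v)
  have hslice : g.inner (F (Ψ (p, s))).1 (horizontal (F (Ψ (p, s))) (N (Ψ (p, s)))) w = 0 := by
    have hnormal := hG.unitNormal.inner_add_vertical_mul_mvfderiv_height (Ψ (p, s))
      (mfderiv (𝓡 (n - 1)) J (fun p ↦ Ψ (p, s)) p v)
    rwa [hG.mvfderiv_height_slice p v hs, mul_zero, add_zero] at hnormal
  have hvelocity : g.inner (F (Ψ (p, s))).1 (baseVelocity F Ψ p s)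
      (horizontal (F (Ψ (p, s))) (N (Ψ (p, s)))) =
      -deriv a s * vertical (F (Ψ (p, s))) (N (Ψ (p, s))) := by
    have hnormal := hG.unitNormal.inner_add_vertical_mul_mvfderiv_height (Ψ (p, s))
      (graphVelocity J Ψ p s)
    rw [hG.mvfderiv_height_graphVelocity p hs, hG.mfderiv_base_graphVelocity p hs] at hnormal
    rw [g.symm]
    linear_combination hnormal
  have hw_zero : w = 0 := by
    by_contra hne
    refine (g.pos _ w hne).ne' ?_
    rw [hv, map_add (g.inner (F (Ψ (p, s))).1), map_smul (g.inner (F (Ψ (p, s))).1), add_apply,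
      smul_apply, hG.inner_baseVelocity_slice p v hs, smul_zero, add_zero] at hslice
    exact hslice
  rw [hv, hw_zero, zero_add, hvelocity]

theorem vertical_normal_sq_mul (hn : 1 ≤ n) (hG : IsGraphParam g T f η a F N Ψ) (p : P)
    (hs : s ∈ T) : vertical (F (Ψ (p, s))) (N (Ψ (p, s))) ^ 2 * (1 + deriv a s ^ 2) = 1 := by
  have hunit := hG.unitNormal.inner_horizontal_add_vertical_mul_self (Ψ (p, s))
  rw [hG.horizontal_normal_eq hn p hs, map_smul, map_smul, smul_apply, smul_eq_mul, smul_eq_mul,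
    hG.inner_baseVelocity_self p hs] at hunit
  linear_combination hunit

theorem vertical_normal_ne_zero (hn : 1 ≤ n) (hG : IsGraphParam g T f η a F N Ψ) (p : P)
    (hs : s ∈ T) : vertical (F (Ψ (p, s))) (N (Ψ (p, s))) ≠ 0 := fun hzero ↦ by
  simpa [hzero] using hG.vertical_normal_sq_mul hn p hs

theorem gradHeight_eq [FiniteDimensional ℝ E'] (hdim : Module.finrank ℝ E' = n) (hn : 1 ≤ n)
    (hG : IsGraphParam g T f η a F N Ψ) (p : P) (hs : s ∈ T) :
    gradHeight J g F (Ψ (p, s)) =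
      (deriv a s * vertical (F (Ψ (p, s))) (N (Ψ (p, s))) ^ 2) • graphVelocity J Ψ p s := by
  refine hG.unitNormal.gradHeight_eq (hG.injective_mfderiv_base hdim hn p hs)
    (hG.vertical_normal_ne_zero hn p hs) ?_
  rw [map_smul, hG.mfderiv_base_graphVelocity p hs, hG.horizontal_normal_eq hn p hs, smul_smul]
  congr 1
  ring

theorem covDeriv_horizontal_normal (hn : 1 ≤ n) (hG : IsGraphParam g T f η a F N Ψ) (p : P)
    (hs : s ∈ T) :
    covDeriv J (metric g) (fun y ↦ (F y).1) (fun y ↦ horizontal (F y) (N y)) (Ψ (p, s))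
        (graphVelocity J Ψ p s) =
      (mvfderiv J (fun y ↦ vertical (F y) (N y)) (Ψ (p, s)) (graphVelocity J Ψ p s) / deriv a s) •
        baseVelocity F Ψ p s := by
  have hT := hG.parallel.isOpen.mem_nhds hs
  set ρ : ℝ → ℝ := fun r ↦ -deriv a r * vertical (F (Ψ (p, r))) (N (Ψ (p, r)))
  have hρ : HasDerivAt ρ (mvfderiv J (fun y ↦ vertical (F y) (N y)) (Ψ (p, s))
      (graphVelocity J Ψ p s) / deriv a s) s :=
    hasDerivAt_neg_mul_of_sq_mul_one_add_sq_eq_one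
      (((hG.smooth.contDiffAt hT).derivWithin (m := 1) (by norm_cast)).differentiableAt (by simp))
      (hG.hasDerivAt_vertical_normal p hs) (hG.deriv_pos s hs).ne'
      (Filter.eventually_of_mem hT fun r hr ↦ hG.vertical_normal_sq_mul hn p hr)
  have hvelocity : MDifferentiableAt 𝓘(ℝ, ℝ) (𝓡 n).tangent
      (fun r ↦ (⟨(F (Ψ (p, r))).1, baseVelocity F Ψ p r⟩ : TangentBundle (𝓡 n) M)) s :=
    (contMDiffAt_mfderiv_apply ((hG.unitNormal.contMDiff_base _).comp s
      (hG.contMDiffAt_curve p hs)) (1 : ℝ)).mdifferentiableAt (by simp)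
  calc covDeriv J (metric g) (fun y ↦ (F y).1) (fun y ↦ horizontal (F y) (N y)) (Ψ (p, s))
        (graphVelocity J Ψ p s)
      = covDeriv 𝓘(ℝ, ℝ) (metric g) (fun r ↦ (F (Ψ (p, r))).1)
          (fun r ↦ horizontal (F (Ψ (p, r))) (N (Ψ (p, r)))) s (1 : ℝ) :=
        (covDeriv_comp (hG.mdifferentiableAt_curve p hs)
          (hG.unitNormal.mdifferentiableAt_horizontal _) (1 : ℝ)).symm
    _ = covDeriv 𝓘(ℝ, ℝ) (metric g) (fun r ↦ (F (Ψ (p, r))).1)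
          (fun r ↦ ρ r • baseVelocity F Ψ p r) s (1 : ℝ) :=
        covDeriv_congr (Filter.eventually_of_mem hT fun r hr ↦ hG.horizontal_normal_eq hn p hr) _
    _ = mvfderiv 𝓘(ℝ, ℝ) ρ s (1 : ℝ) • baseVelocity F Ψ p s + ρ s • (0 : TangentSpace (𝓡 n) _) := by
        rw [← hG.covDeriv_baseVelocity p hs]
        exact covDeriv_smul g hρ.differentiableAt.mdifferentiableAt hvelocity (1 : ℝ)
    _ = _ := by rw [smul_zero, add_zero, mvfderiv_real_one.trans hρ.deriv]

theorem hasPrincipalCurvature_iff [FiniteDimensional ℝ E'] (hdim : Module.finrank ℝ E' = n)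
    (hn : 1 ≤ n) (hG : IsGraphParam g T f η a F N Ψ) (p : P) (hs : s ∈ T) (κ : ℝ) :
    HasPrincipalCurvature g F N (Ψ (p, s)) (gradHeight J g F (Ψ (p, s))) κ ↔
      κ = -(deriv (fun r ↦ vertical (F (Ψ (p, r))) (N (Ψ (p, r)))) s / deriv a s) := by
  have ha : deriv a s ≠ 0 := (hG.deriv_pos s hs).ne'
  have hfactor : deriv a s * vertical (F (Ψ (p, s))) (N (Ψ (p, s))) ^ 2 ≠ 0 :=
    mul_ne_zero ha (pow_ne_zero 2 (hG.vertical_normal_ne_zero hn p hs))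
  rw [hG.unitNormal.hasPrincipalCurvature_iff, hG.gradHeight_eq hdim hn p hs,
    (hG.hasDerivAt_vertical_normal p hs).deriv, covDeriv_smul_direction,
    hG.covDeriv_horizontal_normal hn p hs, map_smul, map_smul, map_smul,
    hG.mfderiv_base_graphVelocity p hs, hG.mvfderiv_height_graphVelocity p hs]
  simp only [smul_eq_mul]
  constructor
  · rintro ⟨-, -, hvertical⟩
    rw [← neg_div, eq_div_iff ha]
    refine mul_left_cancel₀ hfactor ?_
    linear_combination -hvertical
  · rintro rfl
    refine ⟨smul_ne_zero hfactor (hG.graphVelocity_ne_zero p hs), ?_, by field_simp⟩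
    rw [smul_smul, smul_smul, ← neg_smul]
    congr 1
    ring

theorem vertical_normal_eq (hn : 1 ≤ n) (hG : IsGraphParam g T f η a F N Ψ) {p q : P} (hs : s ∈ T)
    (hsign : 0 < vertical (F (Ψ (p, s))) (N (Ψ (p, s))) *
      vertical (F (Ψ (q, s))) (N (Ψ (q, s)))) :
    vertical (F (Ψ (p, s))) (N (Ψ (p, s))) = vertical (F (Ψ (q, s))) (N (Ψ (q, s))) := by
  have hsq : vertical (F (Ψ (p, s))) (N (Ψ (p, s))) ^ 2 =
      vertical (F (Ψ (q, s))) (N (Ψ (q, s))) ^ 2 :=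
    mul_right_cancel₀ (by positivity : 1 + deriv a s ^ 2 ≠ 0)
      ((hG.vertical_normal_sq_mul hn p hs).trans (hG.vertical_normal_sq_mul hn q hs).symm)
  refine (sq_eq_sq_iff_eq_or_eq_neg.1 hsq).resolve_right fun hneg ↦ ?_
  rw [hneg, neg_mul, neg_pos] at hsign
  exact hsign.not_ge (mul_self_nonneg _)

end IsGraphParam

namespace IsGraphOn

theorem exists_isGraphParam (hN : IsUnitNormal J (prodMetric g) F N)
    (hG : IsGraphOn J g T f η a F univ) :
    ∃ Ψ : PartialDiffeomorph ((𝓡 (n - 1)).prod 𝓘(ℝ, ℝ)) J (P × ℝ) S ∞,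
      IsGraphParam g T f η a F N Ψ ∧ ∀ x, ∃ p, ∃ s ∈ T, Ψ (p, s) = x := by
  obtain ⟨Ψ, hsource, htarget, hF⟩ := hG.param
  refine ⟨Ψ, ⟨hN, hG.parallel, hG.smooth, hG.deriv_pos, hsource, hF⟩, fun x ↦ ?_⟩
  have hx : x ∈ Ψ.target := htarget ▸ mem_univ x
  have hmem := Ψ.map_target hx
  rw [hsource] at hmem
  exact ⟨(Ψ.invFun x).1, (Ψ.invFun x).2, hmem.2, Ψ.right_inv hx⟩

theorem strictMonoOn {W : Set S} (hG : IsGraphOn J g T f η a F W) : StrictMonoOn a T :=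
  strictMonoOn_of_deriv_pos hG.parallel.ordConnected.convex hG.smooth.continuousOn
    fun r hr ↦ hG.deriv_pos r (interior_subset hr)

variable [IsManifold (𝓡 (n - 1)) ∞ P]

theorem angle_ne_zero (hn : 1 ≤ n) (hN : IsUnitNormal J (prodMetric g) F N)
    (hG : IsGraphOn J g T f η a F univ) (x : S) : angle g F N x ≠ 0 := by
  obtain ⟨Ψ, hΨ, hsurj⟩ := hG.exists_isGraphParam hN
  obtain ⟨p, s, hs, rfl⟩ := hsurj x
  rw [angle_eq]
  exact hΨ.vertical_normal_ne_zero hn p hs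

theorem isPrincipalDirection_gradHeight [FiniteDimensional ℝ E']
    (hdim : Module.finrank ℝ E' = n) (hn : 1 ≤ n) (hN : IsUnitNormal J (prodMetric g) F N)
    (hG : IsGraphOn J g T f η a F univ) (x : S) :
    IsPrincipalDirection g F N x (gradHeight J g F x) := by
  obtain ⟨Ψ, hΨ, hsurj⟩ := hG.exists_isGraphParam hN
  obtain ⟨p, s, hs, rfl⟩ := hsurj x
  exact ⟨_, (hΨ.hasPrincipalCurvature_iff hdim hn p hs _).2 rfl⟩

theorem angle_eq_and_principalCurvature_eq [FiniteDimensional ℝ E']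
    (hdim : Module.finrank ℝ E' = n) (hn : 1 ≤ n) (hN : IsUnitNormal J (prodMetric g) F N)
    (hG : IsGraphOn J g T f η a F univ) (hsign : PreconnectedSpace S ∨ ∀ x, 0 < angle g F N x)
    {x y : S} (hxy : height F x = height F y) :
    angle g F N x = angle g F N y ∧
      ∀ κ μ : ℝ, HasPrincipalCurvature g F N x (gradHeight J g F x) κ →
        HasPrincipalCurvature g F N y (gradHeight J g F y) μ → κ = μ := by
  have hne := hG.angle_ne_zero hn hN
  simp only [angle_eq] at hsign hne ⊢
  obtain ⟨Ψ, hΨ, hsurj⟩ := hG.exists_isGraphParam hN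
  obtain ⟨p, s, hs, rfl⟩ := hsurj x
  obtain ⟨q, t, ht, rfl⟩ := hsurj y
  rw [height, height, hΨ.map_eq p s hs, hΨ.map_eq q t ht] at hxy
  obtain rfl : s = t := hG.strictMonoOn.injOn hs ht hxy
  have hvertical : ∀ r ∈ T, vertical (F (Ψ (p, r))) (N (Ψ (p, r))) =
      vertical (F (Ψ (q, r))) (N (Ψ (q, r))) := fun r hr ↦
    hΨ.vertical_normal_eq hn hr
      (mul_pos_of_continuous_of_ne_zero hN.contMDiff_vertical.continuous hne hsign _ _)
  refine ⟨hvertical s hs, fun κ μ hκ hμ ↦ ?_⟩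
  rw [hΨ.hasPrincipalCurvature_iff hdim hn _ hs] at hκ hμ
  rw [hκ, hμ, Filter.EventuallyEq.deriv_eq
    (Filter.eventuallyEq_of_mem (hG.parallel.isOpen.mem_nhds hs) hvertical)]

end IsGraphOn

end Graph

/-! ### Hypersurfaces with a principal height gradient -/

section Principal

variable {n : ℕ} {M : Type*} [TopologicalSpace M] [ChartedSpace (EuclideanSpace ℝ (Fin n)) M]
  [IsManifold (𝓡 n) ∞ M]
  {E' : Type*} [NormedAddCommGroup E'] [NormedSpace ℝ E']
  {H' : Type*} [TopologicalSpace H'] {J : ModelWithCorners ℝ E' H'}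
  {S : Type*} [TopologicalSpace S] [ChartedSpace H' S]

/-- A hypersurface of `M × ℝ` whose angle function never vanishes and whose height gradient is a
principal direction. The angle function is expressed through the normal field alone. -/
structure IsHeightPrincipal (J : ModelWithCorners ℝ E' H')
    (g : ContMDiffRiemannianMetric (𝓡 n) ∞ (EuclideanSpace ℝ (Fin n))
      (fun x : M ↦ TangentSpace (𝓡 n) x)) (F : S → M × ℝ)
    (N : ∀ x : S, TangentSpace ((𝓡 n).prod 𝓘(ℝ, ℝ)) (F x)) : Prop where
  finrank_eq : Module.finrank ℝ E' = n
  unitNormal : IsUnitNormal J (prodMetric g) F N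
  injective : ∀ x, Function.Injective (mfderiv J ((𝓡 n).prod 𝓘(ℝ, ℝ)) F x)
  vertical_ne_zero : ∀ x, vertical (F x) (N x) ≠ 0
  principal : ∀ x, IsPrincipalDirection g F N x (gradHeight J g F x)

/-- The inverse of the length of the projection to `M` of the height gradient: integral curves of
the height gradient, reparametrized with this speed, project to curves of unit speed. -/
def speedFactor (F : S → M × ℝ) (N : ∀ x : S, TangentSpace ((𝓡 n).prod 𝓘(ℝ, ℝ)) (F x))
    (x : S) : ℝ :=
  (√(vertical (F x) (N x) ^ 2 * (1 - vertical (F x) (N x) ^ 2)))⁻¹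

namespace IsHeightPrincipal

variable {g : ContMDiffRiemannianMetric (𝓡 n) ∞ (EuclideanSpace ℝ (Fin n))
      (fun x : M ↦ TangentSpace (𝓡 n) x)}
  {F : S → M × ℝ} {N : ∀ x : S, TangentSpace ((𝓡 n).prod 𝓘(ℝ, ℝ)) (F x)}

theorem injective_mfderiv_base (h : IsHeightPrincipal J g F N) (x : S) :
    Function.Injective (mfderiv J (𝓡 n) (fun y ↦ (F y).1) x) :=
  h.unitNormal.injective_mfderiv_base (h.injective x) (h.vertical_ne_zero x)

variable [FiniteDimensional ℝ E']

theorem surjective_mfderiv_base (h : IsHeightPrincipal J g F N) (x : S) :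
    Function.Surjective (mfderiv J (𝓡 n) (fun y ↦ (F y).1) x) := by
  let L : E' →L[ℝ] EuclideanSpace ℝ (Fin n) := mfderiv J (𝓡 n) (fun y ↦ (F y).1) x
  exact (LinearMap.injective_iff_surjective_of_finrank_eq_finrank (f := L.toLinearMap)
    (h.finrank_eq.trans finrank_euclideanSpace_fin.symm)).1 (h.injective_mfderiv_base x)

theorem mfderiv_base_gradHeight (h : IsHeightPrincipal J g F N) (x : S) :
    mfderiv J (𝓡 n) (fun y ↦ (F y).1) x (gradHeight J g F x) =
      -vertical (F x) (N x) • horizontal (F x) (N x) := by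
  obtain ⟨z, hz⟩ := h.surjective_mfderiv_base x (-vertical (F x) (N x) • horizontal (F x) (N x))
  rwa [h.unitNormal.gradHeight_eq (h.injective_mfderiv_base x) (h.vertical_ne_zero x) hz]

theorem mvfderiv_height_gradHeight (h : IsHeightPrincipal J g F N) (x : S) :
    mvfderiv J (height F) x (gradHeight J g F x) = 1 - vertical (F x) (N x) ^ 2 :=
  h.unitNormal.mvfderiv_height_of_mfderiv_base_eq (h.vertical_ne_zero x)
    (h.mfderiv_base_gradHeight x)

theorem one_sub_vertical_sq_pos (h : IsHeightPrincipal J g F N) (x : S) :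
    0 < 1 - vertical (F x) (N x) ^ 2 := by
  obtain ⟨κ, hgrad, -⟩ := h.principal x
  have hhorizontal : horizontal (F x) (N x) ≠ 0 := fun hzero ↦ hgrad <|
    (injective_iff_map_eq_zero _).1 (h.injective_mfderiv_base x) _ <| by
      rw [h.mfderiv_base_gradHeight x, hzero, smul_zero]
  have hpos := g.pos _ _ hhorizontal
  have hunit := h.unitNormal.inner_horizontal_add_vertical_mul_self x
  linarith [sq (vertical (F x) (N x))]

theorem vertical_sq_mul_one_sub_pos (h : IsHeightPrincipal J g F N) (x : S) :
    0 < vertical (F x) (N x) ^ 2 * (1 - vertical (F x) (N x) ^ 2) :=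
  mul_pos (sq_pos_of_ne_zero (h.vertical_ne_zero x)) (h.one_sub_vertical_sq_pos x)

theorem speedFactor_pos (h : IsHeightPrincipal J g F N) (x : S) : 0 < speedFactor F N x :=
  inv_pos.2 (Real.sqrt_pos.2 (h.vertical_sq_mul_one_sub_pos x))

theorem speedFactor_sq_mul (h : IsHeightPrincipal J g F N) (x : S) :
    speedFactor F N x ^ 2 * (vertical (F x) (N x) ^ 2 * (1 - vertical (F x) (N x) ^ 2)) = 1 := by
  have hpos := h.vertical_sq_mul_one_sub_pos x
  rw [speedFactor, inv_pow, Real.sq_sqrt hpos.le, inv_mul_cancel₀ hpos.ne']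

theorem contMDiff_speedFactor (h : IsHeightPrincipal J g F N) :
    ContMDiff J 𝓘(ℝ, ℝ) ∞ (speedFactor F N) := fun x ↦ by
  have hpos := h.vertical_sq_mul_one_sub_pos x
  have hsmooth : ContDiffAt ℝ ∞ (fun t : ℝ ↦ (√(t ^ 2 * (1 - t ^ 2)))⁻¹)
      (vertical (F x) (N x)) :=
    (ContDiffAt.sqrt (f := fun t : ℝ ↦ t ^ 2 * (1 - t ^ 2)) (by fun_prop) hpos.ne').inv
      (Real.sqrt_pos.2 hpos).ne'
  exact ContMDiffAt.comp (g := fun t : ℝ ↦ (√(t ^ 2 * (1 - t ^ 2)))⁻¹) x hsmooth.contMDiffAt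
    (h.unitNormal.contMDiff_vertical x)

section Curve

variable {c : ℝ → S} {T : Set ℝ} {s : ℝ}

theorem mfderiv_base_curve (h : IsHeightPrincipal J g F N) (hc : MDifferentiableAt 𝓘(ℝ, ℝ) J c s)
    (hv : mfderiv 𝓘(ℝ, ℝ) J c s (1 : ℝ) = speedFactor F N (c s) • gradHeight J g F (c s)) :
    mfderiv 𝓘(ℝ, ℝ) (𝓡 n) (fun r ↦ (F (c r)).1) s (1 : ℝ) =
      (-speedFactor F N (c s) * vertical (F (c s)) (N (c s))) •
        horizontal (F (c s)) (N (c s)) := by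
  refine (mfderiv_comp_apply s (h.unitNormal.mdifferentiableAt_base _) hc (1 : ℝ)).trans ?_
  rw [hv, map_smul, h.mfderiv_base_gradHeight, smul_smul, mul_neg, neg_mul]

theorem hasDerivAt_height_curve (h : IsHeightPrincipal J g F N)
    (hc : ContMDiffAt 𝓘(ℝ, ℝ) J ∞ c s)
    (hv : mfderiv 𝓘(ℝ, ℝ) J c s (1 : ℝ) = speedFactor F N (c s) • gradHeight J g F (c s)) :
    HasDerivAt (fun r ↦ height F (c r))
      (speedFactor F N (c s) * (1 - vertical (F (c s)) (N (c s)) ^ 2)) s := by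
  have hheight : ContMDiffAt 𝓘(ℝ, ℝ) 𝓘(ℝ, ℝ) ∞ (fun r ↦ height F (c r)) s :=
    (h.unitNormal.contMDiff_height (c s)).comp s hc
  refine (hheight.contDiffAt.differentiableAt (by simp)).hasDerivAt.congr_deriv ?_
  refine mvfderiv_real_one.symm.trans ((mfderiv_comp_apply s
    (h.unitNormal.mdifferentiableAt_height _) (hc.mdifferentiableAt (by simp)) (1 : ℝ)).trans ?_)
  rw [hv, map_smul]
  exact congrArg (speedFactor F N (c s) * ·) (h.mvfderiv_height_gradHeight (c s))

theorem inner_velocity_curve (h : IsHeightPrincipal J g F N)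
    (hc : MDifferentiableAt 𝓘(ℝ, ℝ) J c s)
    (hv : mfderiv 𝓘(ℝ, ℝ) J c s (1 : ℝ) = speedFactor F N (c s) • gradHeight J g F (c s)) :
    g.inner (F (c s)).1 (mfderiv 𝓘(ℝ, ℝ) (𝓡 n) (fun r ↦ (F (c r)).1) s (1 : ℝ))
      (mfderiv 𝓘(ℝ, ℝ) (𝓡 n) (fun r ↦ (F (c r)).1) s (1 : ℝ)) = 1 := by
  rw [h.mfderiv_base_curve hc hv, map_smul, map_smul, smul_apply, smul_eq_mul, smul_eq_mul]
  linear_combination h.speedFactor_sq_mul (c s) + speedFactor F N (c s) ^ 2 *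
    vertical (F (c s)) (N (c s)) ^ 2 * h.unitNormal.inner_horizontal_add_vertical_mul_self (c s)

theorem exists_covDeriv_horizontal_curve_eq_smul (h : IsHeightPrincipal J g F N)
    (hc : MDifferentiableAt 𝓘(ℝ, ℝ) J c s)
    (hv : mfderiv 𝓘(ℝ, ℝ) J c s (1 : ℝ) = speedFactor F N (c s) • gradHeight J g F (c s)) :
    ∃ τ : ℝ, covDeriv 𝓘(ℝ, ℝ) (metric g) (fun r ↦ (F (c r)).1)
      (fun r ↦ horizontal (F (c r)) (N (c r))) s (1 : ℝ) =
        τ • horizontal (F (c s)) (N (c s)) := by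
  obtain ⟨κ, hκ⟩ := h.principal (c s)
  rw [h.unitNormal.hasPrincipalCurvature_iff, h.mfderiv_base_gradHeight] at hκ
  refine ⟨speedFactor F N (c s) * -(κ * -vertical (F (c s)) (N (c s))), ?_⟩
  refine (covDeriv_comp hc (h.unitNormal.mdifferentiableAt_horizontal _) (1 : ℝ)).trans ?_
  rw [hv, covDeriv_smul_direction, neg_eq_iff_eq_neg.1 hκ.2.1, smul_smul, ← neg_smul, smul_smul]

theorem exists_covDeriv_velocity_eq_smul (h : IsHeightPrincipal J g F N) (hT : IsOpen T)
    (hc : ∀ s ∈ T, ContMDiffAt 𝓘(ℝ, ℝ) J ∞ c s)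
    (hv : ∀ s ∈ T,
      mfderiv 𝓘(ℝ, ℝ) J c s (1 : ℝ) = speedFactor F N (c s) • gradHeight J g F (c s))
    (hs : s ∈ T) :
    ∃ τ : ℝ, covDeriv 𝓘(ℝ, ℝ) (metric g) (fun r ↦ (F (c r)).1)
      (fun r ↦ mfderiv 𝓘(ℝ, ℝ) (𝓡 n) (fun r ↦ (F (c r)).1) r (1 : ℝ)) s (1 : ℝ) =
        τ • horizontal (F (c s)) (N (c s)) := by
  let ρ : ℝ → ℝ := fun r ↦ -speedFactor F N (c r) * vertical (F (c r)) (N (c r))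
  have hρ : MDifferentiableAt 𝓘(ℝ, ℝ) 𝓘(ℝ, ℝ) ρ s := by
    have hfactor : ContMDiffAt J 𝓘(ℝ, ℝ) ∞
        (fun x ↦ -speedFactor F N x * vertical (F x) (N x)) (c s) :=
      (h.contMDiff_speedFactor (c s)).neg.mul (h.unitNormal.contMDiff_vertical (c s))
    exact (hfactor.comp s (hc s hs)).mdifferentiableAt (by simp)
  have hhorizontal : MDifferentiableAt 𝓘(ℝ, ℝ) (𝓡 n).tangent (fun r ↦
      (⟨(F (c r)).1, horizontal (F (c r)) (N (c r))⟩ : TangentBundle (𝓡 n) M)) s :=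
    ((h.unitNormal.contMDiff_horizontal (c s)).comp s (hc s hs)).mdifferentiableAt (by simp)
  obtain ⟨τ, hτ⟩ := h.exists_covDeriv_horizontal_curve_eq_smul
    ((hc s hs).mdifferentiableAt (by simp)) (hv s hs)
  refine ⟨mvfderiv 𝓘(ℝ, ℝ) ρ s (1 : ℝ) + ρ s * τ, ?_⟩
  rw [add_smul, mul_smul, ← hτ]
  refine (covDeriv_congr ?_ (1 : ℝ)).trans (covDeriv_smul g hρ hhorizontal (1 : ℝ))
  filter_upwards [hT.mem_nhds hs] with r hr
  exact h.mfderiv_base_curve ((hc r hr).mdifferentiableAt (by simp)) (hv r hr)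

-- The acceleration is a multiple of the velocity, which has constant length.
theorem isGeodesicOn_base_curve (h : IsHeightPrincipal J g F N) (hT : IsOpen T)
    (hc : ∀ s ∈ T, ContMDiffAt 𝓘(ℝ, ℝ) J ∞ c s)
    (hv : ∀ s ∈ T,
      mfderiv 𝓘(ℝ, ℝ) J c s (1 : ℝ) = speedFactor F N (c s) • gradHeight J g F (c s)) :
    IsGeodesicOn (metric g) (fun s ↦ (F (c s)).1) T := by
  have hγ : ∀ s ∈ T, ContMDiffAt 𝓘(ℝ, ℝ) (𝓡 n) ∞ (fun r ↦ (F (c r)).1) s := fun s hs ↦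
    (h.unitNormal.contMDiff_base (c s)).comp s (hc s hs)
  refine ⟨fun s hs ↦ (hγ s hs).contMDiffWithinAt, fun s hs ↦ ?_⟩
  obtain ⟨τ, hτ⟩ := h.exists_covDeriv_velocity_eq_smul hT hc hv hs
  have hvelocity := contMDiffAt_mfderiv_apply (hγ s hs) (1 : ℝ)
  have hspeed : (fun r ↦ g.inner (F (c r)).1
      (mfderiv 𝓘(ℝ, ℝ) (𝓡 n) (fun r ↦ (F (c r)).1) r (1 : ℝ))
      (mfderiv 𝓘(ℝ, ℝ) (𝓡 n) (fun r ↦ (F (c r)).1) r (1 : ℝ))) =ᶠ[𝓝 s] fun _ ↦ 1 := by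
    filter_upwards [hT.mem_nhds hs] with r hr
    exact h.inner_velocity_curve ((hc r hr).mdifferentiableAt (by simp)) (hv r hr)
  have hderiv := (hasDerivAt_inner g hvelocity hvelocity).unique
    ((hasDerivAt_const s (1 : ℝ)).congr_of_eventuallyEq hspeed)
  have hfactor : -speedFactor F N (c s) * vertical (F (c s)) (N (c s)) *
      g.inner (F (c s)).1 (horizontal (F (c s)) (N (c s))) (horizontal (F (c s)) (N (c s))) ≠
        0 := by
    rw [eq_sub_of_add_eq (h.unitNormal.inner_horizontal_add_vertical_mul_self (c s)), ← sq]
    exact mul_ne_zero (mul_ne_zero (neg_ne_zero.2 (h.speedFactor_pos _).ne')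
      (h.vertical_ne_zero _)) (h.one_sub_vertical_sq_pos _).ne'
  rw [hτ, h.mfderiv_base_curve ((hc s hs).mdifferentiableAt (by simp)) (hv s hs)] at hderiv
  simp only [map_smul, smul_apply, smul_eq_mul] at hderiv
  have hτ_zero : τ = 0 := by
    refine (mul_eq_zero.1 ?_).resolve_right hfactor
    linear_combination hderiv / 2
  rw [hτ, hτ_zero, zero_smul]

end Curve

end IsHeightPrincipal

end Principal

/-! ### Local diffeomorphisms -/

theorem isInvertible_of_injective {E F : Type*} [NormedAddCommGroup E] [NormedSpace ℝ E]
    [FiniteDimensional ℝ E] [NormedAddCommGroup F] [NormedSpace ℝ F] [FiniteDimensional ℝ F]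
    (hdim : Module.finrank ℝ E = Module.finrank ℝ F) {L : E →L[ℝ] F} (hL : Function.Injective L) :
    L.IsInvertible :=
  ⟨(LinearEquiv.ofInjectiveOfFinrankEq L.toLinearMap hL hdim).toContinuousLinearEquiv, rfl⟩

theorem exists_partialDiffeomorph_of_isInvertible_fderiv {E F : Type*} [NormedAddCommGroup E]
    [NormedSpace ℝ E] [CompleteSpace E] [NormedAddCommGroup F] [NormedSpace ℝ F] {f : E → F}
    {U : Set E} (hU : IsOpen U) (hf : ContDiffOn ℝ ∞ f U) {a : E} (ha : a ∈ U)
    (hinv : (fderiv ℝ f a).IsInvertible) :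
    ∃ e : PartialDiffeomorph 𝓘(ℝ, E) 𝓘(ℝ, F) E F ∞,
      a ∈ e.source ∧ e.source ⊆ U ∧ ∀ x, e x = f x := by
  obtain ⟨e, ha, heU, he, hsymm⟩ := exists_openPartialHomeomorph_contDiffOn_symm hU hf ha hinv
  exact ⟨{ e with
    contMDiffOn_toFun := ((hf.mono heU).congr fun x _ ↦ he x).contMDiffOn
    contMDiffOn_invFun := hsymm.contMDiffOn }, ha, heU, he⟩

section LocalDiffeomorph

variable {E : Type*} [NormedAddCommGroup E] [NormedSpace ℝ E]
  {H : Type*} [TopologicalSpace H] {I : ModelWithCorners ℝ E H}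
  {X : Type*} [TopologicalSpace X] [ChartedSpace H X]
  {E' : Type*} [NormedAddCommGroup E'] [NormedSpace ℝ E']
  {H' : Type*} [TopologicalSpace H'] {J : ModelWithCorners ℝ E' H'}
  {S : Type*} [TopologicalSpace S] [ChartedSpace H' S]

theorem contMDiffAt_of_mem_source {Ψ : PartialDiffeomorph J I S X ∞} {x : S} (hx : x ∈ Ψ.source) :
    ContMDiffAt J I ∞ Ψ x :=
  Ψ.contMDiffOn.contMDiffAt (Ψ.open_source.mem_nhds hx)

theorem injective_mfderiv_of_mem_source {Ψ : PartialDiffeomorph J I S X ∞} {x : S}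
    (hx : x ∈ Ψ.source) : Function.Injective (mfderiv J I Ψ x) :=
  ((Ψ.isLocalDiffeomorphAt J I ∞ hx).mfderivToContinuousLinearEquiv (by simp)).injective

variable [IsManifold I ∞ X]

variable (I) in
/-- The extended chart of a manifold without boundary, as a diffeomorphism between open sets. -/
def extChartDiffeomorph [I.Boundaryless] (x₀ : X) :
    PartialDiffeomorph I 𝓘(ℝ, E) X E ∞ where
  toPartialEquiv := extChartAt I x₀
  open_source := isOpen_extChartAt_source x₀
  open_target := isOpen_extChartAt_target x₀
  contMDiffOn_toFun := by simpa only [extChartAt_source] using contMDiffOn_extChartAt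
  contMDiffOn_invFun := contMDiffOn_extChartAt_symm x₀

theorem isLocalDiffeomorphAt_of_injective_mfderiv [I.Boundaryless] [J.Boundaryless]
    [IsManifold J ∞ S] [FiniteDimensional ℝ E] [FiniteDimensional ℝ E']
    (hdim : Module.finrank ℝ E' = Module.finrank ℝ E) {G : S → X} (hG : ContMDiff J I ∞ G) {x : S}
    (hinj : Function.Injective (mfderiv J I G x)) : IsLocalDiffeomorphAt J I ∞ G x := by
  let φ := extChartDiffeomorph J x
  let χ := extChartDiffeomorph I (G x)
  let U : Set E' := φ.target ∩ (fun y ↦ G (φ.symm y)) ⁻¹' χ.source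
  have hU : IsOpen U := (hG.continuous.comp_continuousOn
    φ.symm.contMDiffOn.continuousOn).isOpen_inter_preimage φ.open_target χ.open_source
  have hφx : φ.symm (φ x) = x := φ.left_inv (mem_extChartAt_source x)
  have hxU : φ x ∈ U := ⟨mem_extChartAt_target x, by
    rw [mem_preimage, hφx]; exact mem_extChartAt_source (G x)⟩
  have hlocal : ∀ y ∈ U, ContMDiffAt 𝓘(ℝ, E') 𝓘(ℝ, E) ∞ (fun y ↦ χ (G (φ.symm y))) y :=
    fun y hy ↦ (contMDiffAt_of_mem_source hy.2).comp y
      ((hG _).comp y (contMDiffAt_of_mem_source (Ψ := φ.symm) hy.1))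
  have hinjφ : Function.Injective (mfderiv J I G (φ.symm (φ x))) := by rwa [hφx]
  have hinv : (fderiv ℝ (fun y ↦ χ (G (φ.symm y))) (φ x)).IsInvertible := by
    have hderiv : HasMFDerivAt 𝓘(ℝ, E') 𝓘(ℝ, E) (fun y ↦ χ (G (φ.symm y))) (φ x) _ :=
      ((contMDiffAt_of_mem_source hxU.2).mdifferentiableAt (by simp)).hasMFDerivAt.comp (φ x)
        ((hG.mdifferentiableAt (by simp)).hasMFDerivAt.comp (φ x)
          ((contMDiffAt_of_mem_source (Ψ := φ.symm) hxU.1).mdifferentiableAt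
            (by simp)).hasMFDerivAt)
    refine isInvertible_of_injective hdim ?_
    rw [← mfderiv_eq_fderiv, hderiv.mfderiv]
    exact (injective_mfderiv_of_mem_source hxU.2).comp
      (hinjφ.comp (injective_mfderiv_of_mem_source (Ψ := φ.symm) hxU.1))
  obtain ⟨e, hxe, heU, he⟩ := exists_partialDiffeomorph_of_isInvertible_fderiv hU
    (fun y hy ↦ (hlocal y hy).contDiffAt.contDiffWithinAt) hxU hinv
  have hχe : ∀ y ∈ e.source, G (φ.symm y) = χ.symm (e y) := fun y hy ↦ by
    rw [he]; exact (χ.left_inv (heU hy).2).symm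
  refine ⟨φ.trans (e.trans χ.symm), ⟨mem_extChartAt_source x, hxe, ?_⟩, fun y hy ↦ ?_⟩
  · change e (φ x) ∈ χ.target
    rw [he]
    exact χ.map_source hxU.2
  · exact (congrArg G (φ.left_inv hy.1)).symm.trans (hχe (φ y) hy.2.1)

theorem exists_partialDiffeomorph_extChartAt_apply [I.Boundaryless] {G : S → X} {x : S}
    (hG : IsLocalDiffeomorphAt J I ∞ G x) :
    ∃ β : PartialDiffeomorph 𝓘(ℝ, E) J E S ∞, x ∈ β.target ∧ ∀ y ∈ β.source,
      G (β y) ∈ (extChartAt I (G x)).source ∧ extChartAt I (G x) (G (β y)) = y := by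
  let χ := extChartDiffeomorph I (G x)
  have hinv : ∀ y ∈ hG.localInverse.source, G (hG.localInverse y) = y :=
    fun y hy ↦ hG.localInverse_right_inv hy
  have hleft : hG.localInverse (G x) = x := hG.localInverse_left_inv hG.localInverse_mem_target
  let β := χ.symm.trans hG.localInverse
  have hχx : χ.symm (χ (G x)) = G x := χ.left_inv (mem_extChartAt_source (G x))
  have hmem : χ (G x) ∈ β.source := ⟨mem_extChartAt_target (G x), by
    change χ.symm (χ (G x)) ∈ hG.localInverse.source
    rw [hχx]; exact hG.localInverse_mem_source⟩
  have hβx : β (χ (G x)) = x := by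
    change hG.localInverse (χ.symm (χ (G x))) = x
    rw [hχx, hleft]
  refine ⟨β, ?_, fun y hy ↦ ?_⟩
  · rw [← hβx]
    exact β.map_source hmem
  · have hGβ : G (β y) = χ.symm y := hinv _ hy.2
    rw [hGβ]
    exact ⟨χ.symm.map_source hy.1, χ.right_inv hy.1⟩

theorem exists_contDiffOn_mfderiv_apply_eq {G : S → X} {W : ∀ x : S, TangentSpace I (G x)}
    (hW : ContMDiff J I.tangent ∞ (fun x ↦ (⟨G x, W x⟩ : TangentBundle I X))) {x₀ : X}
    {β : PartialDiffeomorph 𝓘(ℝ, E) J E S ∞} (hβ : ∀ y ∈ β.source,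
      G (β y) ∈ (extChartAt I x₀).source ∧ extChartAt I x₀ (G (β y)) = y) :
    ∃ v : E → E, ContDiffOn ℝ ∞ v β.source ∧ ∀ y ∈ β.source,
      mfderiv J I G (β y) (mfderiv 𝓘(ℝ, E) J β y (v y)) = W (β y) := by
  refine ⟨fun y ↦ toCoord I x₀ (G (β y)) (W (β y)), fun y hy ↦ ?_, fun y hy ↦ ?_⟩
  · have hcoord := ((contMDiffAt_tangentBundle_iff_of_mem (hβ y hy).1).1 (hW (β y))).2
    exact (ContMDiffAt.comp (f := β) y hcoord
      (contMDiffAt_of_mem_source hy)).contDiffAt.contDiffWithinAt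
  · have hG : MDifferentiableAt J I G (β y) :=
      (contMDiffAt_tangentBundle_iff.1 (hW (β y))).1.mdifferentiableAt (by simp)
    have hβd : MDifferentiableAt 𝓘(ℝ, E) J β y :=
      (contMDiffAt_of_mem_source hy).mdifferentiableAt (by simp)
    have hid : (fun z ↦ extChartAt I x₀ (G (β z))) =ᶠ[𝓝 y] id := by
      filter_upwards [β.open_source.mem_nhds hy] with z hz using (hβ z hz).2
    have htoCoord : ∀ w : E,
        toCoord I x₀ (G (β y)) (mfderiv J I G (β y) (mfderiv 𝓘(ℝ, E) J β y w)) = w := fun w ↦ by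
      refine (congrArg _ (mfderiv_comp_apply y hG hβd w).symm).trans ?_
      refine (toCoord_mfderiv (hG.comp y hβd) (hβ y hy).1 w).trans ?_
      exact congrArg (fun L : E →L[ℝ] E ↦ L w) (hid.mfderiv_eq.trans mfderiv_id)
    exact (isInvertible_toCoord (hβ y hy).1).injective (htoCoord _)

end LocalDiffeomorph

/-! ### Flow boxes -/

section FlowBox

theorem exists_box_subset {V : Type*} [SeminormedAddCommGroup V] {U : Set (V × ℝ)}
    (hU : IsOpen U) (h0 : (0, 0) ∈ U) :
    ∃ ε > 0, Metric.ball 0 ε ×ˢ Ioo (-ε) ε ⊆ U := by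
  obtain ⟨ε, hε, hball⟩ := Metric.isOpen_iff.1 hU _ h0
  rw [← ball_prod_same, Real.ball_eq_Ioo, zero_sub, zero_add] at hball
  exact ⟨ε, hε, hball⟩

variable {V E : Type*} [NormedAddCommGroup V] [NormedSpace ℝ V]
  [NormedAddCommGroup E] [NormedSpace ℝ E]

theorem exists_equiv_prod_of_apply_ne_zero [FiniteDimensional ℝ V] [FiniteDimensional ℝ E]
    (hdim : Module.finrank ℝ E = Module.finrank ℝ V + 1) (ℓ : E →L[ℝ] ℝ) {u : E} (hu : ℓ u ≠ 0) :
    ∃ A : (V × ℝ) ≃L[ℝ] E, (∀ q, ℓ (A q) = q.2 * ℓ u) ∧ A (0, 1) = u := by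
  have hker : Module.finrank ℝ V = Module.finrank ℝ (LinearMap.ker ℓ.toLinearMap) := by
    have hrank := ℓ.toLinearMap.finrank_range_add_finrank_ker
    rw [LinearMap.range_eq_top.2 (LinearMap.surjective fun h ↦ hu (LinearMap.congr_fun h u)),
      finrank_top, Module.finrank_self] at hrank
    omega
  let B : V ≃ₗ[ℝ] LinearMap.ker ℓ.toLinearMap := LinearEquiv.ofFinrankEq _ _ hker
  let K : V × ℝ →L[ℝ] E := ((LinearMap.ker ℓ.toLinearMap).subtype ∘ₗ
    B.toLinearMap).toContinuousLinearMap.coprod (ContinuousLinearMap.toSpanSingleton ℝ u)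
  have hK : ∀ q, K q = B q.1 + q.2 • u := fun q ↦ rfl
  have hℓK : ∀ q, ℓ (K q) = q.2 * ℓ u := fun q ↦ by
    have hBker : ℓ (B q.1) = 0 := (B q.1).2
    rw [hK, map_add, map_smul, hBker, zero_add, smul_eq_mul]
  have hinj : Function.Injective K := (injective_iff_map_eq_zero K).2 fun q hq ↦ by
    have hq₂ : q.2 = 0 := by
      have := hℓK q
      rw [hq, map_zero] at this
      exact (mul_eq_zero.1 this.symm).resolve_right hu
    rw [hK, hq₂, zero_smul, add_zero, Submodule.coe_eq_zero, B.map_eq_zero_iff] at hq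
    exact Prod.ext hq hq₂
  obtain ⟨A, hA⟩ := isInvertible_of_injective (by simp [hdim]) hinj
  have hAK : ∀ q, A q = K q := fun q ↦ congrArg (fun L : _ →L[ℝ] E ↦ L q) hA
  exact ⟨A, fun q ↦ by rw [hAK, hℓK], by rw [hAK, hK, map_zero, one_smul]; exact zero_add u⟩

theorem hasFDerivAt_of_partial {Ξ : V × ℝ → E} {A : V × ℝ →L[ℝ] E} {p : V} {s : ℝ}
    (hΞ : DifferentiableAt ℝ Ξ (p, s))
    (hleft : HasFDerivAt (fun p ↦ Ξ (p, s)) (A.comp (.inl ℝ V ℝ)) p)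
    (hright : HasDerivAt (fun r ↦ Ξ (p, r)) (A (0, 1)) s) : HasFDerivAt Ξ A (p, s) := by
  have hD := hΞ.hasFDerivAt
  have hDleft : HasFDerivAt (fun p ↦ Ξ (p, s)) ((fderiv ℝ Ξ (p, s)).comp (.inl ℝ V ℝ)) p :=
    HasFDerivAt.comp (g := Ξ) p hD (hasFDerivAt_prodMk_left p s)
  have hDright : HasDerivAt (fun r ↦ Ξ (p, r)) (fderiv ℝ Ξ (p, s) (0, 1)) s :=
    HasFDerivAt.comp_hasDerivAt (l := Ξ) s hD ((hasDerivAt_const s p).prodMk (hasDerivAt_id s))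
  refine hD.congr_fderiv (ContinuousLinearMap.prod_ext (hDleft.unique hleft) ?_)
  ext
  exact hDright.unique hright

theorem exists_contDiffOn_level_parametrization [CompleteSpace E] {U : Set E} (hU : IsOpen U)
    {ζ : E → ℝ} (hζ : ContDiffOn ℝ ∞ ζ U) {y₀ : E} (hy₀ : y₀ ∈ U) {c : ℝ} (hc : c ≠ 0)
    (A : (V × ℝ) ≃L[ℝ] E) (hA : ∀ q, fderiv ℝ ζ y₀ (A q) = q.2 * c) :
    ∃ σ : V → E, ∃ D : Set V, IsOpen D ∧ 0 ∈ D ∧ ContDiffOn ℝ ∞ σ D ∧ σ 0 = y₀ ∧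
      HasFDerivAt σ ((A : V × ℝ →L[ℝ] E).comp (.inl ℝ V ℝ)) 0 ∧ ∀ p ∈ D, ζ (σ p) = ζ y₀ := by
  let Θ : E → V × ℝ := fun y ↦ ((A.symm (y - y₀)).1, c⁻¹ * (ζ y - ζ y₀))
  have hΘ : ContDiffOn ℝ ∞ Θ U := ContDiffOn.prodMk
    (contDiff_fst.comp (A.symm.contDiff.comp (contDiff_id.sub contDiff_const))).contDiffOn
    (contDiffOn_const.mul (hζ.sub contDiffOn_const))
  have hΘderiv : HasFDerivAt Θ (A.symm : E →L[ℝ] V × ℝ) y₀ := by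
    have hfst := (ContinuousLinearMap.fst ℝ V ℝ).hasFDerivAt.comp y₀
      ((A.symm : E →L[ℝ] V × ℝ).hasFDerivAt.comp y₀ ((hasFDerivAt_id y₀).sub_const y₀))
    have hsnd := (((hζ.contDiffAt (hU.mem_nhds hy₀)).differentiableAt
      (by simp)).hasFDerivAt.sub_const (ζ y₀)).const_mul c⁻¹
    refine (hfst.prodMk hsnd).congr_fderiv (ContinuousLinearMap.ext fun w ↦ ?_)
    obtain ⟨q, rfl⟩ := A.surjective w
    exact Prod.ext rfl (by simp [hA, hc, mul_comm])
  obtain ⟨e, hye, -, he, hsymm⟩ := exists_openPartialHomeomorph_contDiffOn_symm hU hΘ hy₀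
    (hΘderiv.fderiv ▸ ⟨A.symm, rfl⟩)
  have hey₀ : e y₀ = (0, 0) := by rw [he]; simp [Θ]
  have hsymm0 : e.symm (0, 0) = y₀ := by rw [← hey₀, e.left_inv hye]
  have hmem : ((0, 0) : V × ℝ) ∈ e.target := hey₀ ▸ e.map_source hye
  have hderiv : HasFDerivAt e.symm (A : V × ℝ →L[ℝ] E) (0, 0) :=
    e.hasFDerivAt_symm (f' := A.symm) hmem (by
      rw [hsymm0]; exact hΘderiv.congr_of_eventuallyEq (.of_forall he))
  refine ⟨fun p ↦ e.symm (p, 0), (fun p ↦ (p, (0 : ℝ))) ⁻¹' e.target,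
    e.open_target.preimage (by fun_prop), hmem,
    hsymm.comp (contDiff_id.prodMk contDiff_const).contDiffOn fun p hp ↦ hp, hsymm0,
    HasFDerivAt.comp (g := e.symm) 0 hderiv (hasFDerivAt_prodMk_left 0 0), fun p hp ↦ ?_⟩
  have hΘp : Θ (e.symm (p, 0)) = (p, 0) := by rw [← he]; exact e.right_inv hp
  have hζp : c⁻¹ * (ζ (e.symm (p, 0)) - ζ y₀) = 0 := congrArg Prod.snd hΘp
  exact sub_eq_zero.1 ((mul_eq_zero.1 hζp).resolve_left (inv_ne_zero hc))

theorem exists_contDiffOn_flow_of_level [FiniteDimensional ℝ V] [FiniteDimensional ℝ E]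
    (hdim : Module.finrank ℝ E = Module.finrank ℝ V + 1) {U : Set E} (hU : IsOpen U)
    {v : E → E} (hv : ContDiffOn ℝ ∞ v U) {ζ : E → ℝ} (hζ : ContDiffOn ℝ ∞ ζ U) {y₀ : E}
    (hy₀ : y₀ ∈ U) (htransverse : fderiv ℝ ζ y₀ (v y₀) ≠ 0) :
    ∃ Ξ : V × ℝ → E, ∃ D : Set (V × ℝ), IsOpen D ∧ (0, 0) ∈ D ∧ ContDiffOn ℝ ∞ Ξ D ∧
      Ξ (0, 0) = y₀ ∧ (fderiv ℝ Ξ (0, 0)).IsInvertible ∧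
      (∀ q ∈ D, Ξ q ∈ U ∧ HasDerivAt (fun r ↦ Ξ (q.1, r)) (v (Ξ q)) q.2) ∧
      ∀ p, (p, 0) ∈ D → ζ (Ξ (p, 0)) = ζ y₀ := by
  obtain ⟨A, hA, hA1⟩ := exists_equiv_prod_of_apply_ne_zero (V := V) hdim _ htransverse
  obtain ⟨σ, Dσ, hDσ, h0Dσ, hσ, hσ0, hσderiv, hσlevel⟩ :=
    exists_contDiffOn_level_parametrization hU hζ hy₀ htransverse A hA
  obtain ⟨Φ, δ, hδ, hΦ, hΦ0, hΦderiv⟩ := exists_contDiffOn_flow_of_contDiffOn hU hv hy₀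
  let D : Set (V × ℝ) := Dσ ×ˢ univ ∩ (fun q ↦ (q.2, σ q.1)) ⁻¹' Metric.ball (0, y₀) δ
  have hστ : ContDiffOn ℝ ∞ (fun q : V × ℝ ↦ (q.2, σ q.1)) (Dσ ×ˢ univ) :=
    contDiffOn_snd.prodMk (hσ.comp contDiffOn_fst fun q hq ↦ hq.1)
  have hD : IsOpen D :=
    hστ.continuousOn.isOpen_inter_preimage (hDσ.prod isOpen_univ) Metric.isOpen_ball
  have hmem : ((0, 0) : V × ℝ) ∈ D := ⟨⟨h0Dσ, mem_univ _⟩, by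
    rw [mem_preimage, hσ0]; exact Metric.mem_ball_self hδ⟩
  have hΞ : ContDiffOn ℝ ∞ (fun q : V × ℝ ↦ Φ (q.2, σ q.1)) D :=
    hΦ.comp (hστ.mono inter_subset_left) fun q hq ↦ hq.2
  have hlevel : ∀ p, (p, 0) ∈ D → Φ (0, σ p) = σ p := fun p hp ↦ by
    have hball : ((0 : ℝ), σ p) ∈ Metric.ball (0, y₀) δ := hp.2
    rw [← ball_prod_same] at hball
    exact hΦ0 _ hball.2
  have hderiv : HasFDerivAt (fun q : V × ℝ ↦ Φ (q.2, σ q.1)) (A : V × ℝ →L[ℝ] E) (0, 0) := by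
    refine hasFDerivAt_of_partial
      ((hΞ.contDiffAt (hD.mem_nhds hmem)).differentiableAt (by simp)) ?_ ?_
    · refine hσderiv.congr_of_eventuallyEq ?_
      have hcont : Continuous fun p : V ↦ (p, (0 : ℝ)) := by fun_prop
      filter_upwards [(hD.preimage hcont).mem_nhds hmem] with p hp using hlevel p hp
    · refine (hΦderiv _ hmem.2).2.congr_deriv ?_
      change v (Φ (0, σ 0)) = A (0, 1)
      rw [hlevel 0 hmem, hσ0, hA1]
  refine ⟨fun q ↦ Φ (q.2, σ q.1), D, hD, hmem, hΞ, (hlevel 0 hmem).trans hσ0,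
    hderiv.fderiv ▸ ⟨A, rfl⟩, fun q hq ↦ hΦderiv _ hq.2, fun p hp ↦ ?_⟩
  exact (congrArg ζ (hlevel p hp)).trans (hσlevel p hp.1.1)

end FlowBox

section Box

variable {V : Type*} [NormedAddCommGroup V] [InnerProductSpace ℝ V]

/-- Rescaling of the first factor, as a diffeomorphism of `V × (-ε, ε)` onto the product of the
ball of radius `ε` and `(-ε, ε)`. -/
def boxDiffeomorph (V : Type*) [NormedAddCommGroup V] [InnerProductSpace ℝ V] {ε : ℝ} (hε : 0 < ε) :
    PartialDiffeomorph (𝓘(ℝ, V).prod 𝓘(ℝ, ℝ)) 𝓘(ℝ, V × ℝ) (V × ℝ) (V × ℝ) ∞ where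
  toPartialEquiv := (OpenPartialHomeomorph.univBall (0 : V) ε).toPartialEquiv.prod
    (PartialEquiv.ofSet (Ioo (-ε) ε))
  open_source := (OpenPartialHomeomorph.univBall 0 ε).open_source.prod isOpen_Ioo
  open_target := (OpenPartialHomeomorph.univBall 0 ε).open_target.prod isOpen_Ioo
  contMDiffOn_toFun :=
    ((OpenPartialHomeomorph.contDiff_univBall.contMDiff.comp
      contMDiff_fst).prodMk_space contMDiff_snd).contMDiffOn
  contMDiffOn_invFun := by
    have hball : (OpenPartialHomeomorph.univBall (0 : V) ε).target = Metric.ball 0 ε :=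
      OpenPartialHomeomorph.univBall_target _ hε
    refine ContMDiffOn.prodMk ?_ contDiff_snd.contMDiff.contMDiffOn
    exact OpenPartialHomeomorph.contDiffOn_univBall_symm.contMDiffOn.comp
      contDiff_fst.contMDiff.contMDiffOn fun q hq ↦ hball ▸ hq.1

theorem exists_flowBox {E : Type*} [NormedAddCommGroup E] [NormedSpace ℝ E]
    [FiniteDimensional ℝ V] [FiniteDimensional ℝ E]
    (hdim : Module.finrank ℝ E = Module.finrank ℝ V + 1) {U : Set E} (hU : IsOpen U)
    {v : E → E} (hv : ContDiffOn ℝ ∞ v U) {ζ : E → ℝ} (hζ : ContDiffOn ℝ ∞ ζ U) {y₀ : E}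
    (hy₀ : y₀ ∈ U) (htransverse : fderiv ℝ ζ y₀ (v y₀) ≠ 0) :
    ∃ ε > 0, ∃ Ξ : PartialDiffeomorph (𝓘(ℝ, V).prod 𝓘(ℝ, ℝ)) 𝓘(ℝ, E) (V × ℝ) E ∞,
      Ξ.source = univ ×ˢ Ioo (-ε) ε ∧ Ξ (0, 0) = y₀ ∧
      (∀ p, ∀ s ∈ Ioo (-ε) ε, Ξ (p, s) ∈ U ∧ HasDerivAt (fun r ↦ Ξ (p, r)) (v (Ξ (p, s))) s) ∧
      ∀ p, ζ (Ξ (p, 0)) = ζ y₀ := by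
  obtain ⟨f, D, hD, hmem, hf, hf0, hinv, hflow, hlevel⟩ :=
    exists_contDiffOn_flow_of_level (V := V) hdim hU hv hζ hy₀ htransverse
  obtain ⟨e, he0, heD, he⟩ := exists_partialDiffeomorph_of_isInvertible_fderiv hD hf hmem hinv
  obtain ⟨ε, hε, hbox⟩ := exists_box_subset e.open_source he0
  let b := OpenPartialHomeomorph.univBall (0 : V) ε
  have hmaps : ∀ p, ∀ s ∈ Ioo (-ε) ε, (b p, s) ∈ e.source := fun p s hs ↦ hbox ⟨by
    rw [← OpenPartialHomeomorph.univBall_target (0 : V) hε]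
    exact b.map_source (by rw [OpenPartialHomeomorph.univBall_source]; exact mem_univ p), hs⟩
  have hzero : (0 : ℝ) ∈ Ioo (-ε) ε := ⟨neg_lt_zero.2 hε, hε⟩
  have happly : ∀ p s, (boxDiffeomorph V hε).trans e (p, s) = f (b p, s) := fun p s ↦ he (b p, s)
  refine ⟨ε, hε, (boxDiffeomorph V hε).trans e, ?_, ?_, fun p s hs ↦ ?_, fun p ↦ ?_⟩
  · ext ⟨p, s⟩
    refine ⟨fun h ↦ ⟨mem_univ p, h.1.2⟩, fun h ↦ ⟨⟨?_, h.2⟩, hmaps p s h.2⟩⟩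
    rw [OpenPartialHomeomorph.univBall_source]
    exact mem_univ p
  · rw [happly, OpenPartialHomeomorph.univBall_apply_zero, hf0]
  · simp only [happly]
    exact hflow _ (heD (hmaps p s hs))
  · rw [happly]
    exact hlevel _ (heD (hmaps p 0 hzero))

end Box

/-! ### Hypersurfaces swept out by integral curves of the height gradient -/

section FlowParam

variable {n : ℕ} {M : Type*} [TopologicalSpace M] [ChartedSpace (EuclideanSpace ℝ (Fin n)) M]
  [IsManifold (𝓡 n) ∞ M]
  {E' : Type*} [NormedAddCommGroup E'] [NormedSpace ℝ E']
  {H' : Type*} [TopologicalSpace H'] {J : ModelWithCorners ℝ E' H'}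
  {S : Type*} [TopologicalSpace S] [ChartedSpace H' S]

/-- `Ψ` parametrizes a part of the hypersurface `F` by integral curves `s ↦ Ψ (p, s)` of the height
gradient, reparametrized with the speed `speedFactor` and starting on a level set of the height. -/
structure IsFlowParam (g : ContMDiffRiemannianMetric (𝓡 n) ∞ (EuclideanSpace ℝ (Fin n))
      (fun x : M ↦ TangentSpace (𝓡 n) x)) (F : S → M × ℝ)
    (N : ∀ x : S, TangentSpace ((𝓡 n).prod 𝓘(ℝ, ℝ)) (F x)) (T : Set ℝ)
    (Ψ : PartialDiffeomorph ((𝓡 (n - 1)).prod 𝓘(ℝ, ℝ)) J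
      (EuclideanSpace ℝ (Fin (n - 1)) × ℝ) S ∞) : Prop where
  principal : IsHeightPrincipal J g F N
  isOpen : IsOpen T
  ordConnected : T.OrdConnected
  zero_mem : (0 : ℝ) ∈ T
  source : Ψ.source = univ ×ˢ T
  velocity : ∀ p, ∀ s ∈ T, mfderiv 𝓘(ℝ, ℝ) J (fun r ↦ Ψ (p, r)) s (1 : ℝ) =
    speedFactor F N (Ψ (p, s)) • gradHeight J g F (Ψ (p, s))
  level : ∀ p, height F (Ψ (p, 0)) = height F (Ψ (0, 0))

variable {g : ContMDiffRiemannianMetric (𝓡 n) ∞ (EuclideanSpace ℝ (Fin n))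
      (fun x : M ↦ TangentSpace (𝓡 n) x)}
  {F : S → M × ℝ} {N : ∀ x : S, TangentSpace ((𝓡 n).prod 𝓘(ℝ, ℝ)) (F x)}

theorem IsHeightPrincipal.contMDiff_smul_horizontal [FiniteDimensional ℝ E']
    (h : IsHeightPrincipal J g F N) :
    ContMDiff J (𝓡 n).tangent ∞ (fun x ↦ (⟨(F x).1,
      (-speedFactor F N x * vertical (F x) (N x)) • horizontal (F x) (N x)⟩ :
        TangentBundle (𝓡 n) M)) := fun x ↦ by
  obtain ⟨hbase, hcoord⟩ := contMDiffAt_tangentBundle_iff.1 (h.unitNormal.contMDiff_horizontal x)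
  refine contMDiffAt_tangentBundle_iff.2 ⟨hbase, ?_⟩
  simp only [map_smul]
  exact ((h.contMDiff_speedFactor x).neg.mul (h.unitNormal.contMDiff_vertical x)).smul hcoord

variable {T : Set ℝ}
  {Ψ : PartialDiffeomorph ((𝓡 (n - 1)).prod 𝓘(ℝ, ℝ)) J (EuclideanSpace ℝ (Fin (n - 1)) × ℝ) S ∞}
  {s : ℝ}

namespace IsFlowParam

theorem contMDiffAt (h : IsFlowParam g F N T Ψ) (p : EuclideanSpace ℝ (Fin (n - 1)))
    (hs : s ∈ T) : ContMDiffAt ((𝓡 (n - 1)).prod 𝓘(ℝ, ℝ)) J ∞ Ψ (p, s) :=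
  contMDiffAt_of_mem_source (h.source ▸ ⟨mem_univ p, hs⟩)

theorem contMDiffAt_curve (h : IsFlowParam g F N T Ψ) (p : EuclideanSpace ℝ (Fin (n - 1)))
    (hs : s ∈ T) : ContMDiffAt 𝓘(ℝ, ℝ) J ∞ (fun r ↦ Ψ (p, r)) s :=
  (h.contMDiffAt p hs).comp s (contMDiffAt_const.prodMk contMDiffAt_id)

theorem mdifferentiableAt_curve (h : IsFlowParam g F N T Ψ) (p : EuclideanSpace ℝ (Fin (n - 1)))
    (hs : s ∈ T) : MDifferentiableAt 𝓘(ℝ, ℝ) J (fun r ↦ Ψ (p, r)) s :=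
  (h.contMDiffAt_curve p hs).mdifferentiableAt (by simp)

theorem contMDiff_slice (h : IsFlowParam g F N T Ψ) (hs : s ∈ T) :
    ContMDiff (𝓡 (n - 1)) J ∞ (fun p ↦ Ψ (p, s)) := fun p ↦
  (h.contMDiffAt p hs).comp p (contMDiffAt_id.prodMk contMDiffAt_const)

theorem contMDiffOn_base (h : IsFlowParam g F N T Ψ) :
    ContMDiffOn ((𝓡 (n - 1)).prod 𝓘(ℝ, ℝ)) (𝓡 n) ∞
      (fun q : EuclideanSpace ℝ (Fin (n - 1)) × ℝ ↦ (F (Ψ (q.1, q.2))).1) (univ ×ˢ T) := by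
  rw [← h.source]
  exact h.principal.unitNormal.contMDiff_base.comp_contMDiffOn Ψ.contMDiffOn

theorem contMDiff_base_slice (h : IsFlowParam g F N T Ψ) (hs : s ∈ T) :
    ContMDiff (𝓡 (n - 1)) (𝓡 n) ∞ (fun p ↦ (F (Ψ (p, s))).1) :=
  h.principal.unitNormal.contMDiff_base.comp (h.contMDiff_slice hs)

theorem contMDiff_height_slice (h : IsFlowParam g F N T Ψ) (hs : s ∈ T) :
    ContMDiff (𝓡 (n - 1)) 𝓘(ℝ, ℝ) ∞ (fun p ↦ height F (Ψ (p, s))) :=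
  h.principal.unitNormal.contMDiff_height.comp (h.contMDiff_slice hs)

variable [FiniteDimensional ℝ E']

theorem isGeodesicOn (h : IsFlowParam g F N T Ψ) (p : EuclideanSpace ℝ (Fin (n - 1))) :
    IsGeodesicOn (metric g) (fun s ↦ (F (Ψ (p, s))).1) T :=
  h.principal.isGeodesicOn_base_curve h.isOpen (fun _ hs ↦ h.contMDiffAt_curve p hs)
    (h.velocity p)

theorem inner_velocity_self (h : IsFlowParam g F N T Ψ) (p : EuclideanSpace ℝ (Fin (n - 1)))
    (hs : s ∈ T) :
    g.inner (F (Ψ (p, s))).1 (mfderiv 𝓘(ℝ, ℝ) (𝓡 n) (fun s ↦ (F (Ψ (p, s))).1) s (1 : ℝ))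
      (mfderiv 𝓘(ℝ, ℝ) (𝓡 n) (fun s ↦ (F (Ψ (p, s))).1) s (1 : ℝ)) = 1 :=
  h.principal.inner_velocity_curve (h.mdifferentiableAt_curve p hs) (h.velocity p s hs)

theorem velocity_eq (h : IsFlowParam g F N T Ψ) (p : EuclideanSpace ℝ (Fin (n - 1)))
    (hs : s ∈ T) :
    mfderiv 𝓘(ℝ, ℝ) (𝓡 n) (fun s ↦ (F (Ψ (p, s))).1) s (1 : ℝ) =
      (-speedFactor F N (Ψ (p, s)) * vertical (F (Ψ (p, s))) (N (Ψ (p, s)))) •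
        horizontal (F (Ψ (p, s))) (N (Ψ (p, s))) :=
  h.principal.mfderiv_base_curve (h.mdifferentiableAt_curve p hs) (h.velocity p s hs)

theorem inner_velocity_slice (h : IsFlowParam g F N T Ψ) (p : EuclideanSpace ℝ (Fin (n - 1)))
    (v : TangentSpace (𝓡 (n - 1)) p) (hs : s ∈ T) :
    g.inner (F (Ψ (p, s))).1 (mfderiv 𝓘(ℝ, ℝ) (𝓡 n) (fun s ↦ (F (Ψ (p, s))).1) s (1 : ℝ))
      (mfderiv (𝓡 (n - 1)) (𝓡 n) (fun p ↦ (F (Ψ (p, s))).1) p v) =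
    speedFactor F N (Ψ (p, s)) * vertical (F (Ψ (p, s))) (N (Ψ (p, s))) ^ 2 *
      mvfderiv (𝓡 (n - 1)) (fun p ↦ height F (Ψ (p, s))) p v := by
  have hslice : MDifferentiableAt (𝓡 (n - 1)) J (fun p ↦ Ψ (p, s)) p :=
    (h.contMDiff_slice hs).mdifferentiableAt (by simp)
  have hbase : mfderiv (𝓡 (n - 1)) (𝓡 n) (fun p ↦ (F (Ψ (p, s))).1) p v = _ :=
    mfderiv_comp_apply p (h.principal.unitNormal.mdifferentiableAt_base _) hslice v
  have hheight : mvfderiv (𝓡 (n - 1)) (fun p ↦ height F (Ψ (p, s))) p v =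
      mvfderiv J (height F) (Ψ (p, s)) (mfderiv (𝓡 (n - 1)) J (fun p ↦ Ψ (p, s)) p v) :=
    mfderiv_comp_apply p (h.principal.unitNormal.mdifferentiableAt_height _) hslice v
  have hnormal := h.principal.unitNormal.inner_add_vertical_mul_mvfderiv_height (Ψ (p, s))
    (mfderiv (𝓡 (n - 1)) J (fun p ↦ Ψ (p, s)) p v)
  rw [hbase, hheight, h.velocity_eq p hs, map_smul, smul_apply, smul_eq_mul]
  linear_combination
    (-speedFactor F N (Ψ (p, s)) * vertical (F (Ψ (p, s))) (N (Ψ (p, s)))) * hnormal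

theorem inner_velocity_slice_zero (h : IsFlowParam g F N T Ψ)
    (p : EuclideanSpace ℝ (Fin (n - 1))) (v : TangentSpace (𝓡 (n - 1)) p) :
    g.inner (F (Ψ (p, 0))).1 (mfderiv 𝓘(ℝ, ℝ) (𝓡 n) (fun s ↦ (F (Ψ (p, s))).1) 0 (1 : ℝ))
      (mfderiv (𝓡 (n - 1)) (𝓡 n) (fun p ↦ (F (Ψ (p, 0))).1) p v) = 0 := by
  have hconst : (fun p ↦ height F (Ψ (p, 0))) = fun _ ↦ height F (Ψ (0, 0)) := funext h.level
  rw [h.inner_velocity_slice p v h.zero_mem, hconst, mvfderiv_const]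
  exact mul_zero _

-- By the Gauss lemma the geodesics stay orthogonal to the slices, on which the height is therefore
-- critical.
theorem mvfderiv_height_slice (h : IsFlowParam g F N T Ψ) (p : EuclideanSpace ℝ (Fin (n - 1)))
    (v : TangentSpace (𝓡 (n - 1)) p) (hs : s ∈ T) :
    mvfderiv (𝓡 (n - 1)) (fun p ↦ height F (Ψ (p, s))) p v = 0 := by
  have hgauss := eq_of_hasDerivAt_zero h.isOpen h.ordConnected (fun r hr ↦
    hasDerivAt_gauss g (f := fun s p ↦ (F (Ψ (p, s))).1) h.isOpen h.contMDiffOn_base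
      h.isGeodesicOn (fun p s hs ↦ h.inner_velocity_self p hs) p v hr) hs h.zero_mem
  have hzero := (h.inner_velocity_slice p v hs).symm.trans
    (hgauss.trans (h.inner_velocity_slice_zero p v))
  exact (mul_eq_zero.1 hzero).resolve_left (mul_ne_zero (h.principal.speedFactor_pos _).ne'
    (pow_ne_zero 2 (h.principal.vertical_ne_zero _)))

theorem height_eq (h : IsFlowParam g F N T Ψ) (p : EuclideanSpace ℝ (Fin (n - 1))) (hs : s ∈ T) :
    height F (Ψ (p, s)) = height F (Ψ (0, s)) := by
  refine is_const_of_fderiv_eq_zero (𝕜 := ℝ) (f := fun p ↦ height F (Ψ (p, s)))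
    ((h.contMDiff_height_slice hs).contDiff.differentiable (by simp)) (fun q ↦ ?_) p 0
  rw [← mfderiv_eq_fderiv]
  exact ContinuousLinearMap.ext fun v ↦ h.mvfderiv_height_slice q v hs

theorem isUnitNormal (h : IsFlowParam g F N T Ψ) :
    IsUnitNormal (𝓡 (n - 1)) (metric g) (fun p ↦ (F (Ψ (p, 0))).1)
      (fun p ↦ mfderiv 𝓘(ℝ, ℝ) (𝓡 n) (fun s ↦ (F (Ψ (p, s))).1) 0 (1 : ℝ)) where
  smooth := (h.principal.contMDiff_smul_horizontal.comp (h.contMDiff_slice h.zero_mem)).congr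
    fun p ↦ congrArg (TotalSpace.mk _) (h.velocity_eq p h.zero_mem)
  unit := fun p ↦ h.inner_velocity_self p h.zero_mem
  normal := h.inner_velocity_slice_zero

omit [FiniteDimensional ℝ E'] in
theorem isImmersed_base_slice (h : IsFlowParam g F N T Ψ) (hs : s ∈ T) :
    IsImmersed (𝓡 (n - 1)) (𝓡 n) (fun p ↦ (F (Ψ (p, s))).1) where
  smooth := h.contMDiff_base_slice hs
  injective := fun p ↦ by
    have hmem : (p, s) ∈ Ψ.source := h.source ▸ ⟨mem_univ p, hs⟩
    have hincl : HasMFDerivAt (𝓡 (n - 1)) ((𝓡 (n - 1)).prod 𝓘(ℝ, ℝ))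
        (fun q : EuclideanSpace ℝ (Fin (n - 1)) ↦ (q, s)) p
        (ContinuousLinearMap.inl ℝ (EuclideanSpace ℝ (Fin (n - 1))) ℝ) :=
      (hasMFDerivAt_id p).prodMk (hasMFDerivAt_const s p)
    have hderiv := (h.principal.unitNormal.mdifferentiableAt_base (Ψ (p, s))).hasMFDerivAt.comp p
      (((h.contMDiffAt p hs).mdifferentiableAt (by simp)).hasMFDerivAt.comp p hincl)
    rw [HasMFDerivAt.mfderiv (f := fun p ↦ (F (Ψ (p, s))).1) hderiv]
    exact (h.principal.injective_mfderiv_base _).comp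
      ((injective_mfderiv_of_mem_source hmem).comp fun _ _ heq ↦ congrArg Prod.fst heq)

theorem isGraphOn (h : IsFlowParam g F N T Ψ) :
    IsGraphOn J g T (fun s p ↦ (F (Ψ (p, s))).1)
      (fun p ↦ mfderiv 𝓘(ℝ, ℝ) (𝓡 n) (fun s ↦ (F (Ψ (p, s))).1) 0 (1 : ℝ))
      (fun s ↦ height F (Ψ (0, s))) F Ψ.target where
  parallel :=
    { isOpen := h.isOpen
      ordConnected := h.ordConnected
      zero_mem := h.zero_mem
      smooth := h.contMDiffOn_base
      unitNormal := h.isUnitNormal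
      geodesic := h.isGeodesicOn
      velocity := fun p ↦ rfl
      immersion := fun s hs ↦ h.isImmersed_base_slice hs }
  smooth := fun s hs ↦ ((h.principal.unitNormal.contMDiff_height _).comp s
    (h.contMDiffAt_curve 0 hs)).contDiffAt.contDiffWithinAt
  deriv_pos := fun s hs ↦ by
    rw [(h.principal.hasDerivAt_height_curve (h.contMDiffAt_curve 0 hs)
      (h.velocity 0 s hs)).deriv]
    exact mul_pos (h.principal.speedFactor_pos _) (h.principal.one_sub_vertical_sq_pos _)
  param := ⟨Ψ, h.source, rfl, fun p s hs ↦ Prod.ext rfl (h.height_eq p hs)⟩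

end IsFlowParam

namespace IsHeightPrincipal

variable [FiniteDimensional ℝ E']

theorem mvfderiv_height_smul_gradHeight_pos (h : IsHeightPrincipal J g F N) (x : S) :
    0 < mvfderiv J (height F) x (speedFactor F N x • gradHeight J g F x) := by
  rw [map_smul, h.mvfderiv_height_gradHeight, smul_eq_mul]
  exact mul_pos (h.speedFactor_pos x) (h.one_sub_vertical_sq_pos x)

theorem fderiv_height_comp_ne_zero (h : IsHeightPrincipal J g F N) {E : Type*}
    [NormedAddCommGroup E] [NormedSpace ℝ E] {β : E → S} {y v : E}
    (hβ : MDifferentiableAt 𝓘(ℝ, E) J β y)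
    (hv : mfderiv 𝓘(ℝ, E) J β y v = speedFactor F N (β y) • gradHeight J g F (β y)) :
    fderiv ℝ (fun y ↦ height F (β y)) y v ≠ 0 := by
  rw [← mfderiv_eq_fderiv]
  refine ne_of_eq_of_ne (mfderiv_comp_apply _ (h.unitNormal.mdifferentiableAt_height _) hβ _) ?_
  rw [hv]
  exact (h.mvfderiv_height_smul_gradHeight_pos _).ne'

theorem exists_contDiffOn_mfderiv_eq_smul_gradHeight (h : IsHeightPrincipal J g F N) {x₀ : M}
    {β : PartialDiffeomorph 𝓘(ℝ, EuclideanSpace ℝ (Fin n)) J (EuclideanSpace ℝ (Fin n)) S ∞}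
    (hβ : ∀ y ∈ β.source, (F (β y)).1 ∈ (extChartAt (𝓡 n) x₀).source ∧
      extChartAt (𝓡 n) x₀ (F (β y)).1 = y) :
    ∃ v : EuclideanSpace ℝ (Fin n) → EuclideanSpace ℝ (Fin n), ContDiffOn ℝ ∞ v β.source ∧
      ∀ y ∈ β.source, mfderiv 𝓘(ℝ, EuclideanSpace ℝ (Fin n)) J β y (v y) =
        speedFactor F N (β y) • gradHeight J g F (β y) := by
  obtain ⟨v, hv, hvβ⟩ := exists_contDiffOn_mfderiv_apply_eq h.contMDiff_smul_horizontal hβ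
  refine ⟨v, hv, fun y hy ↦ h.injective_mfderiv_base (β y) ((hvβ y hy).trans ?_)⟩
  rw [map_smul, h.mfderiv_base_gradHeight, smul_smul, mul_neg, neg_mul]

variable [J.Boundaryless] [IsManifold J ∞ S]

theorem exists_isFlowParam (h : IsHeightPrincipal J g F N) (hn : 1 ≤ n) (x₀ : S) :
    ∃ (T : Set ℝ) (Ψ : PartialDiffeomorph ((𝓡 (n - 1)).prod 𝓘(ℝ, ℝ)) J
        (EuclideanSpace ℝ (Fin (n - 1)) × ℝ) S ∞)
      (Φ : PartialDiffeomorph ((𝓡 (n - 1)).prod 𝓘(ℝ, ℝ)) (𝓡 n)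
        (EuclideanSpace ℝ (Fin (n - 1)) × ℝ) M ∞),
      IsFlowParam g F N T Ψ ∧ x₀ ∈ Ψ.target ∧ Φ.source = univ ×ˢ T ∧
        ∀ p, ∀ s ∈ T, Φ (p, s) = (F (Ψ (p, s))).1 := by
  obtain ⟨β, hx₀, hβ⟩ := exists_partialDiffeomorph_extChartAt_apply
    (isLocalDiffeomorphAt_of_injective_mfderiv
      (h.finrank_eq.trans finrank_euclideanSpace_fin.symm) h.unitNormal.contMDiff_base
      (h.injective_mfderiv_base x₀))
  have hβd : ∀ y ∈ β.source, MDifferentiableAt 𝓘(ℝ, EuclideanSpace ℝ (Fin n)) J β y :=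
    fun y hy ↦ (contMDiffAt_of_mem_source hy).mdifferentiableAt (by simp)
  obtain ⟨v, hv, hvβ⟩ := h.exists_contDiffOn_mfderiv_eq_smul_gradHeight hβ
  have hy₀ : β.symm x₀ ∈ β.source := β.symm.map_source hx₀
  obtain ⟨ε, hε, Ξ, hΞ, hΞ0, hΞv, hΞlevel⟩ := exists_flowBox
    (V := EuclideanSpace ℝ (Fin (n - 1)))
    (by rw [finrank_euclideanSpace_fin, finrank_euclideanSpace_fin, Nat.sub_add_cancel hn])
    β.open_source hv (h.unitNormal.contMDiff_height.comp_contMDiffOn β.contMDiffOn).contDiffOn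
    hy₀ (h.fderiv_height_comp_ne_zero (hβd _ hy₀) (hvβ _ hy₀))
  have hzero : (0 : ℝ) ∈ Ioo (-ε) ε := ⟨neg_lt_zero.2 hε, hε⟩
  have hΞβ : MapsTo Ξ (univ ×ˢ Ioo (-ε) ε) β.source := fun q hq ↦ (hΞv q.1 q.2 hq.2).1
  have hΨ : (Ξ.trans β).source = univ ×ˢ Ioo (-ε) ε :=
    (inter_eq_left.2 (hΞ.subset.trans hΞβ)).trans hΞ
  let χ := extChartDiffeomorph (𝓡 n) (F x₀).1
  have hΞχ : MapsTo Ξ (univ ×ˢ Ioo (-ε) ε) χ.target := fun q hq ↦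
    (hβ _ (hΞβ hq)).2 ▸ χ.map_source (hβ _ (hΞβ hq)).1
  have hΦ : (Ξ.trans χ.symm).source = univ ×ˢ Ioo (-ε) ε :=
    (inter_eq_left.2 (hΞ.subset.trans hΞχ)).trans hΞ
  refine ⟨Ioo (-ε) ε, Ξ.trans β, Ξ.trans χ.symm, ⟨h, isOpen_Ioo, ordConnected_Ioo, hzero, hΨ,
    fun p s hs ↦ ?_, fun p ↦ (hΞlevel p).trans (hΞlevel 0).symm⟩, ?_, hΦ, fun p s hs ↦ ?_⟩
  · obtain ⟨hmem, hderiv⟩ := hΞv p s hs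
    refine (mfderiv_comp_apply s (hβd _ hmem)
      hderiv.differentiableAt.mdifferentiableAt (1 : ℝ)).trans ?_
    exact (congrArg _ (mvfderiv_real_one.trans hderiv.deriv)).trans (hvβ _ hmem)
  · have hx : (Ξ.trans β) (0, 0) = x₀ := (congrArg β hΞ0).trans (β.right_inv hx₀)
    rw [← hx]
    exact (Ξ.trans β).map_source (hΨ ▸ ⟨mem_univ _, hzero⟩)
  · obtain ⟨hmem, hχ⟩ := hβ _ (hΞv p s hs).1
    exact (congrArg χ.symm hχ.symm).trans (χ.left_inv hmem)

theorem isLocallyGraph (h : IsHeightPrincipal J g F N) (hn : 1 ≤ n) : IsLocallyGraph J g F := by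
  intro x₀
  obtain ⟨T, Ψ, Φ, hΨ, hx₀, hΦ, hΦΨ⟩ := h.exists_isFlowParam hn x₀
  exact ⟨Ψ.target, Ψ.open_target, hx₀, EuclideanSpace ℝ (Fin (n - 1)), inferInstance,
    inferInstance, inferInstance, inferInstance, inferInstance, T, _, _, _, hΨ.isGraphOn, Φ, hΦ,
    hΦΨ⟩

end IsHeightPrincipal

end FlowParam

end ParallelGraph

end

theorem mainTheorem6 {n : ℕ} (hn : 2 ≤ n)
    {M : Type*} [TopologicalSpace M] [T2Space M] [ChartedSpace (EuclideanSpace ℝ (Fin n)) M]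
    [IsManifold (𝓡 n) ∞ M]
    (g : ContMDiffRiemannianMetric (𝓡 n) ∞ (EuclideanSpace ℝ (Fin n))
      (fun x : M ↦ TangentSpace (𝓡 n) x))
    {E' : Type*} [NormedAddCommGroup E'] [NormedSpace ℝ E'] [FiniteDimensional ℝ E']
    {H' : Type*} [TopologicalSpace H'] (J : ModelWithCorners ℝ E' H') [J.Boundaryless]
    {S : Type*} [TopologicalSpace S] [T2Space S] [ChartedSpace H' S] [IsManifold J ∞ S]
    (hdim : Module.finrank ℝ E' = n)
    (F : S → M × ℝ) (N : ∀ x : S, TangentSpace ((𝓡 n).prod 𝓘(ℝ, ℝ)) (F x))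
    (hN : ParallelGraph.IsUnitNormal J (ParallelGraph.prodMetric g) F N) :
    (∀ (P : Type*) [TopologicalSpace P] [T2Space P]
        [ChartedSpace (EuclideanSpace ℝ (Fin (n - 1))) P] [IsManifold (𝓡 (n - 1)) ∞ P]
        (T : Set ℝ) (f : ℝ → P → M) (η : ∀ p : P, TangentSpace (𝓡 n) (f 0 p)) (a : ℝ → ℝ),
        ParallelGraph.IsGraphOn J g T f η a F univ →
        (∀ x, ParallelGraph.angle g F N x ≠ 0 ∧ ParallelGraph.gradHeight J g F x ≠ 0) ∧
        (∀ x, ParallelGraph.IsPrincipalDirection g F N x (ParallelGraph.gradHeight J g F x)) ∧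
        ((PreconnectedSpace S ∨ ∀ x, 0 < ParallelGraph.angle g F N x) →
          ∀ x y, ParallelGraph.height F x = ParallelGraph.height F y →
            ParallelGraph.angle g F N x = ParallelGraph.angle g F N y ∧
            ∀ κ μ : ℝ,
              ParallelGraph.HasPrincipalCurvature g F N x (ParallelGraph.gradHeight J g F x) κ →
              ParallelGraph.HasPrincipalCurvature g F N y (ParallelGraph.gradHeight J g F y) μ →
              κ = μ)) ∧
    (ParallelGraph.IsImmersed J ((𝓡 n).prod 𝓘(ℝ, ℝ)) F →
      (∀ x, ParallelGraph.angle g F N x ≠ 0) →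
      (∀ x, ParallelGraph.IsPrincipalDirection g F N x (ParallelGraph.gradHeight J g F x)) →
      ParallelGraph.IsLocallyGraph J g F) := by
  refine ⟨fun P _ _ _ _ T f η a hG ↦ ?_, fun hF hθ hA ↦ ?_⟩
  · have hprincipal := hG.isPrincipalDirection_gradHeight hdim (by omega) hN
    have hgrad : ∀ x, ParallelGraph.gradHeight J g F x ≠ 0 := fun x ↦ (hprincipal x).choose_spec.1
    exact ⟨fun x ↦ ⟨hG.angle_ne_zero (by omega) hN x, hgrad x⟩, hprincipal, fun hsign x y hxy ↦
      hG.angle_eq_and_principalCurvature_eq hdim (by omega) hN hsign hxy⟩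
  · simp only [ParallelGraph.angle_eq] at hθ
    exact ParallelGraph.IsHeightPrincipal.isLocallyGraph ⟨hdim, hN, hF.injective, hθ, hA⟩ (by omega)
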